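/- Let $T,d,a,m>0$. Let $f\in C^1(\mathbb R)$ be real-valued, $T$-periodic and odd, and let $g\in C^1(\mathbb R)$ be real-valued, $T$-periodic and even. For $\varepsilon\in\mathbb R$ consider stationary solutions $\mathbf u=(w,p)^\top:\mathbb R\to\mathbb R^2$ of the Klausmeier system, that is, solutions of $$w''+\varepsilon\,(f w'+g w)-w-wp^2+a=0,\qquad d^2p''-mp+wp^2=0 ,$$ where derivatives are weak and the equations hold almost everywhere. For $\mathbf u=(w,p)^\top\in L^\infty(\mathbb R;\mathbb R^2)$ let $L_\varepsilon(\mathbf u)$ be the linearization, i.e. the unbounded operator on $L^2(\mathbb R;\mathbb C^2)$ with domain $H^2(\mathbb R;\mathbb C^2)$ given by $$L_\varepsilon(\mathbf u)\begin{pmatrix}W\\P\end{pmatrix}=\begin{pmatrix}W''+\varepsilon fW'+(\varepsilon g-1-p^2)W-2wp\,P\\ d^2P''+p^2W+(2wp-m)P\end{pmatrix},$$ and let $\sigma(L_\varepsilon(\mathbf u))$ be its spectrum. An eigenvalue is called simple if its algebraic multiplicity is one. Let $\mathbf u_0=\mathbf z_0+\mathbf v_0$ with $\mathbf z_0\in H^2(\mathbb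 R;\mathbb R^2)$ and constant $\mathbf v_0\in\mathbb R^2$ be an even stationary solution for $\varepsilon=0$ that is spectrally stable with simple eigenvalue $0$: there is $\varrho>0$ such that $\sigma(L_0(\mathbf u_0))\subset\{\lambda\in\mathbb C:\operatorname{Re}\lambda\le-\varrho\}\cup\{0\}$, and $0$ is a simple eigenvalue of $L_0(\mathbf u_0)$. Let $\Psi\in H^2(\mathbb R;\mathbb R^2)$ span the kernel of the adjoint $L_0(\mathbf u_0)^*$ and satisfy $\langle\partial_x\mathbf u_0,\Psi\rangle_{L^2}=1$, and assume that $$\mathcal M=\int_{\mathbb R}\big(f'(x)\,\partial_x\mathbf u_{01}(x)+g'(x)\,\mathbf u_{01}(x)\big)\Psi_1(x)\,dx\neq 0 ,$$ where the index $1$ denotes the first component. Then there exist constants $C,\varepsilon_0,\eta>0$ and, for each $\varepsilon\in(-\varepsilon_0,\varepsilon_0)$, an even stationary solution $$\mathbf u(\varepsilon)=\mathbf z(\varepsilon)+\mathbf v(\varepsilon),\qquad \mathbf z(\varepsilon)\in H^2(\mathbb R;\mathbb R^2),\quad \mathbf v(\varepsilon)\in H^2_{\mathrm{per}}(0,T)\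 (\mathbb R^2\text{-valued}),$$ of the system with parameter $\varepsilon$, and a number $\lambda_0(\varepsilon)\in\mathbb R$, such that for all $\varepsilon\in(-\varepsilon_0,\varepsilon_0)$ $$\|\mathbf u(\varepsilon)-\mathbf u_0\|_{L^\infty}\le C|\varepsilon|,\qquad \|\mathbf v(\varepsilon)-\mathbf v_0\|_{H^2_{\mathrm{per}}(0,T)}\le C|\varepsilon|,$$ $$\sigma(L_\varepsilon(\mathbf u(\varepsilon)))\subset\{\lambda\in\mathbb C:\operatorname{Re}\lambda\le-\eta\}\cup\{\lambda_0(\varepsilon)\},$$ $\lambda_0(\varepsilon)$ is a simple eigenvalue of $L_\varepsilon(\mathbf u(\varepsilon))$, and $|\lambda_0(\varepsilon)+\varepsilon\mathcal M|\le C\varepsilon^2$. Moreover, for $\varepsilon\neq0$ the solution $\mathbf u(\varepsilon)$ is nondegenerate, i.e. $L_\varepsilon(\mathbf u(\varepsilon))$ is invertible. -/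

import Mathlib

open MeasureTheory Set Filter Topology
open scoped ContDiff ENNReal

noncomputable section

namespace Klausmeier

/-- Values `(w, p)` of real profiles. -/
abbrev R2 : Type := EuclideanSpace ℝ (Fin 2)

/-- Values of the complex perturbations on which the linearization acts. -/
abbrev C2 : Type := EuclideanSpace ℂ (Fin 2)

/-- The complex Hilbert space `L²(ℝ; ℂ²)`. -/
abbrev L2 : Type := Lp C2 2 (volume : Measure ℝ)

/-! ### Weak derivatives and Sobolev spaces on the line -/

section Sobolev

variable {E : Type*} [NormedAddCommGroup E] [NormedSpace ℝ E]

/-- `u'` is a weak (distributional) derivative of `u` on `ℝ`. -/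
def HasWeakDeriv (u u' : ℝ → E) : Prop :=
  LocallyIntegrable u volume ∧ LocallyIntegrable u' volume ∧
    ∀ φ : ℝ → ℝ, ContDiff ℝ ∞ φ → HasCompactSupport φ →
      ∫ x, deriv φ x • u x = -∫ x, φ x • u' x

open Classical in
/-- The weak derivative of `u` (unique up to null sets); `0` if there is none. -/
def weakDeriv (u : ℝ → E) : ℝ → E :=
  if h : ∃ u', HasWeakDeriv u u' then h.choose else 0

/-- `u ∈ H²(ℝ)`. -/
def MemH2 (u : ℝ → E) : Prop :=
  MemLp u 2 volume ∧ ∃ u₁ u₂ : ℝ → E, HasWeakDeriv u u₁ ∧ HasWeakDeriv u₁ u₂ ∧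
    MemLp u₁ 2 volume ∧ MemLp u₂ 2 volume

/-- `v ∈ H²_per(0,T)`: a `T`-periodic function on `ℝ` that is weakly twice differentiable, with
`v, v', v''` square integrable over one period. -/
def MemH2Per (T : ℝ) (v : ℝ → E) : Prop :=
  (∀ᵐ x : ℝ, v (x + T) = v x) ∧ MemLp v 2 (volume.restrict (Ioc 0 T)) ∧
    ∃ v₁ v₂ : ℝ → E, HasWeakDeriv v v₁ ∧ HasWeakDeriv v₁ v₂ ∧
      MemLp v₁ 2 (volume.restrict (Ioc 0 T)) ∧ MemLp v₂ 2 (volume.restrict (Ioc 0 T))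

/-- The norm of `H²_per(0,T)`. -/
def h2PerNorm (T : ℝ) (v : ℝ → E) : ℝ :=
  Real.sqrt (∫ x in Ioc 0 T,
    (‖v x‖ ^ 2 + ‖weakDeriv v x‖ ^ 2 + ‖weakDeriv (weakDeriv v) x‖ ^ 2))

/-- Evenness of a function that is determined up to null sets. -/
def IsEvenAE (u : ℝ → E) : Prop := ∀ᵐ x : ℝ, u (-x) = u x

theorem HasWeakDeriv.ae_unique [CompleteSpace E] {u v v' : ℝ → E}
    (h : HasWeakDeriv u v) (h' : HasWeakDeriv u v') : v =ᵐ[volume] v' := by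
  refine ae_eq_of_integral_contDiff_smul_eq h.2.1 h'.2.1 fun φ hφ hc => ?_
  have := (h.2.2 φ hφ hc).symm.trans (h'.2.2 φ hφ hc)
  exact neg_injective this

theorem HasWeakDeriv.congr {u v u' v' : ℝ → E} (h : HasWeakDeriv u u')
    (hu : u =ᵐ[volume] v) (hu' : u' =ᵐ[volume] v') : HasWeakDeriv v v' := by
  refine ⟨(locallyIntegrable_congr hu).1 h.1, (locallyIntegrable_congr hu').1 h.2.1,
    fun φ hφ hc => ?_⟩
  have e1 : ∫ x, deriv φ x • v x = ∫ x, deriv φ x • u x :=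
    integral_congr_ae (hu.mono fun x hx => by simp only [hx])
  have e2 : ∫ x, φ x • v' x = ∫ x, φ x • u' x :=
    integral_congr_ae (hu'.mono fun x hx => by simp only [hx])
  rw [e1, e2]
  exact h.2.2 φ hφ hc

theorem HasWeakDeriv.add {u v u' v' : ℝ → E} (h : HasWeakDeriv u u')
    (k : HasWeakDeriv v v') : HasWeakDeriv (u + v) (u' + v') := by
  refine ⟨h.1.add k.1, h.2.1.add k.2.1, fun φ hφ hc => ?_⟩
  have hd : Continuous (deriv φ) := hφ.continuous_deriv (by norm_num)
  simp only [Pi.add_apply, smul_add]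
  rw [integral_add (h.1.integrable_smul_left_of_hasCompactSupport hd hc.deriv)
      (k.1.integrable_smul_left_of_hasCompactSupport hd hc.deriv),
    integral_add (h.2.1.integrable_smul_left_of_hasCompactSupport hφ.continuous hc)
      (k.2.1.integrable_smul_left_of_hasCompactSupport hφ.continuous hc),
    h.2.2 φ hφ hc, k.2.2 φ hφ hc, neg_add]

theorem HasWeakDeriv.const_smul [NormedSpace ℂ E] [SMulCommClass ℝ ℂ E] (c : ℂ) {u u' : ℝ → E}
    (h : HasWeakDeriv u u') : HasWeakDeriv (c • u) (c • u') := by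
  refine ⟨h.1.smul c, h.2.1.smul c, fun φ hφ hc => ?_⟩
  simp only [Pi.smul_apply, smul_comm _ c]
  rw [integral_smul, integral_smul, h.2.2 φ hφ hc, smul_neg]

theorem HasWeakDeriv.zero : HasWeakDeriv (0 : ℝ → E) 0 :=
  ⟨locallyIntegrable_zero, locallyIntegrable_zero, fun φ _ _ => by simp⟩

theorem hasWeakDeriv_weakDeriv {u u' : ℝ → E} (h : HasWeakDeriv u u') :
    HasWeakDeriv u (weakDeriv u) := by
  have hex : ∃ u', HasWeakDeriv u u' := ⟨u', h⟩
  rw [weakDeriv, dif_pos hex]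
  exact hex.choose_spec

theorem HasWeakDeriv.weakDeriv_ae [CompleteSpace E] {u u' : ℝ → E} (h : HasWeakDeriv u u') :
    weakDeriv u =ᵐ[volume] u' :=
  (hasWeakDeriv_weakDeriv h).ae_unique h

theorem HasWeakDeriv.weakDeriv_weakDeriv_ae [CompleteSpace E] {u u₁ u₂ : ℝ → E}
    (h : HasWeakDeriv u u₁) (h' : HasWeakDeriv u₁ u₂) :
    weakDeriv (weakDeriv u) =ᵐ[volume] u₂ :=
  (h'.congr h.weakDeriv_ae.symm (ae_eq_refl _)).weakDeriv_ae

theorem MemH2.add {u v : ℝ → E} (h : MemH2 u) (k : MemH2 v) : MemH2 (u + v) := by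
  obtain ⟨h0, u1, u2, a, b, c, d⟩ := h
  obtain ⟨k0, v1, v2, a', b', c', d'⟩ := k
  exact ⟨h0.add k0, u1 + v1, u2 + v2, a.add a', b.add b', c.add c', d.add d'⟩

theorem MemH2.const_smul [NormedSpace ℂ E] [SMulCommClass ℝ ℂ E] (c : ℂ) {u : ℝ → E}
    (h : MemH2 u) : MemH2 (c • u) := by
  obtain ⟨h0, u1, u2, a, b, p, q⟩ := h
  exact ⟨h0.const_smul c, c • u1, c • u2, a.const_smul c, b.const_smul c,
    p.const_smul c, q.const_smul c⟩

theorem MemH2.zero : MemH2 (0 : ℝ → E) :=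
  ⟨MemLp.zero, 0, 0, HasWeakDeriv.zero, HasWeakDeriv.zero, MemLp.zero, MemLp.zero⟩

theorem MemH2.congr {u v : ℝ → E} (h : MemH2 u) (e : u =ᵐ[volume] v) : MemH2 v := by
  obtain ⟨h0, u1, u2, a, b, p, q⟩ := h
  exact ⟨(memLp_congr_ae e).1 h0, u1, u2, a.congr e (ae_eq_refl _), b, p, q⟩

end Sobolev

/-! ### The Klausmeier system -/

/-- The nonlinearity `(w, p) ↦ (ε g w - w - w p² + a, -m p + w p²)`, where `γ` stands for `g x`. -/
def reaction (a m ε γ : ℝ) (U : R2) : R2 :=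
  !₂[ε * γ * U 0 - U 0 - U 0 * U 1 ^ 2 + a, -m * U 1 + U 0 * U 1 ^ 2]

/-- The Jacobian matrix of `reaction` at `U`. -/
def reactionJacobian (m ε γ : ℝ) (U : R2) : Matrix (Fin 2) (Fin 2) ℝ :=
  !![ε * γ - 1 - U 1 ^ 2, -(2 * U 0 * U 1);
     U 1 ^ 2, -m + 2 * U 0 * U 1]

theorem hasFDerivAt_reaction (a m ε γ : ℝ) (U : R2) :
    HasFDerivAt (reaction a m ε γ)
      (Matrix.toEuclideanCLM (𝕜 := ℝ) (reactionJacobian m ε γ U)) U := by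
  refine HasStrictFDerivAt.hasFDerivAt ((hasStrictFDerivAt_piLp 2).2 ?_)
  have h0 : HasStrictFDerivAt (fun V : R2 => V 0) (EuclideanSpace.proj (𝕜 := ℝ) (0 : Fin 2)) U :=
    (EuclideanSpace.proj (𝕜 := ℝ) (0 : Fin 2)).hasStrictFDerivAt
  have h1 : HasStrictFDerivAt (fun V : R2 => V 1) (EuclideanSpace.proj (𝕜 := ℝ) (1 : Fin 2)) U :=
    (EuclideanSpace.proj (𝕜 := ℝ) (1 : Fin 2)).hasStrictFDerivAt
  intro i
  fin_cases i
  · refine (((((h0.const_mul (ε * γ)).sub h0).sub (h0.mul (h1.pow 2))).add_const a)).congr_fderiv ?_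
    ext V
    simp [reactionJacobian, Matrix.ofLp_toEuclideanCLM, Matrix.mulVec,
      dotProduct, Fin.sum_univ_two]
    ring
  · refine ((h1.const_mul (-m)).add (h0.mul (h1.pow 2))).congr_fderiv ?_
    ext V
    simp [reactionJacobian, Matrix.ofLp_toEuclideanCLM, Matrix.mulVec,
      dotProduct, Fin.sum_univ_two]
    ring

/-- `u` is a stationary solution: `u` is weakly twice differentiable and
`w'' + ε (f w' + g w) - w - w p² + a = 0`, `d² p'' - m p + w p² = 0` almost everywhere. -/
def IsStationarySolution (d a m ε : ℝ) (f g : ℝ → ℝ) (u : ℝ → R2) : Prop :=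
  ∃ u₁ u₂ : ℝ → R2, HasWeakDeriv u u₁ ∧ HasWeakDeriv u₁ u₂ ∧
    ∀ᵐ x : ℝ, !₂[u₂ x 0 + ε * f x * u₁ x 0, d ^ 2 * u₂ x 1]
      + reaction a m ε (g x) (u x) = 0

/-- The differential expression of the linearization about `u`, applied to a complex-valued `y`:
`(y₁'' + ε f y₁', d² y₂'') + J(x) y` with `J(x)` the Jacobian of the nonlinearity at `u x`. -/
def linExpr (d m ε : ℝ) (f g : ℝ → ℝ) (u : ℝ → R2) (y : ℝ → C2) (x : ℝ) : C2 :=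
  !₂[weakDeriv (weakDeriv y) x 0 + (ε * f x : ℝ) * weakDeriv y x 0
      + (reactionJacobian m ε (g x) (u x) 0 0 : ℝ) * y x 0
      + (reactionJacobian m ε (g x) (u x) 0 1 : ℝ) * y x 1,
    (d ^ 2 : ℝ) * weakDeriv (weakDeriv y) x 1
      + (reactionJacobian m ε (g x) (u x) 1 0 : ℝ) * y x 0
      + (reactionJacobian m ε (g x) (u x) 1 1 : ℝ) * y x 1]

theorem linExpr_add (d m ε : ℝ) (f g : ℝ → ℝ) (u : ℝ → R2) {y z s : ℝ → C2}
    (hy : MemH2 y) (hz : MemH2 z) (hs : s =ᵐ[volume] y + z) :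
    linExpr d m ε f g u s =ᵐ[volume] linExpr d m ε f g u y + linExpr d m ε f g u z := by
  obtain ⟨-, y1, y2, a, b, -, -⟩ := hy
  obtain ⟨-, z1, z2, a', b', -, -⟩ := hz
  have A := (a.add a').congr hs.symm (ae_eq_refl _)
  have B := b.add b'
  filter_upwards [hs, A.weakDeriv_ae, A.weakDeriv_weakDeriv_ae B, a.weakDeriv_ae,
    a.weakDeriv_weakDeriv_ae b, a'.weakDeriv_ae, a'.weakDeriv_weakDeriv_ae b']
    with x h0 h1 h2 h3 h4 h5 h6
  ext i
  fin_cases i <;> simp [linExpr, h0, h1, h2, h3, h4, h5, h6] <;> ring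

theorem linExpr_smul (d m ε : ℝ) (f g : ℝ → ℝ) (u : ℝ → R2) (c : ℂ) {y s : ℝ → C2}
    (hy : MemH2 y) (hs : s =ᵐ[volume] c • y) :
    linExpr d m ε f g u s =ᵐ[volume] c • linExpr d m ε f g u y := by
  obtain ⟨-, y1, y2, a, b, -, -⟩ := hy
  have A := (a.const_smul c).congr hs.symm (ae_eq_refl _)
  have B := b.const_smul c
  filter_upwards [hs, A.weakDeriv_ae, A.weakDeriv_weakDeriv_ae B, a.weakDeriv_ae,
    a.weakDeriv_weakDeriv_ae b] with x h0 h1 h2 h3 h4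
  ext i
  fin_cases i <;> simp [linExpr, h0, h1, h2, h3, h4] <;> ring

/-- The domain of the linearization: those `y ∈ H²(ℝ; ℂ²)` that are mapped to `L²(ℝ; ℂ²)`. For
bounded coefficients this is all of `H²(ℝ; ℂ²)`, see `mem_linDomain_iff`. -/
def linDomain (d m ε : ℝ) (f g : ℝ → ℝ) (u : ℝ → R2) : Submodule ℂ L2 where
  carrier := {y | MemH2 y ∧ MemLp (linExpr d m ε f g u y) 2 volume}
  add_mem' := by
    rintro y z ⟨hy, hy'⟩ ⟨hz, hz'⟩
    exact ⟨(hy.add hz).congr (Lp.coeFn_add y z).symm,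
      (memLp_congr_ae (linExpr_add d m ε f g u hy hz (Lp.coeFn_add y z))).2 (hy'.add hz')⟩
  zero_mem' := by
    have h0 : MemH2 ((0 : L2) : ℝ → C2) := MemH2.zero.congr (Lp.coeFn_zero _ _ _).symm
    refine ⟨h0, ?_⟩
    have e : ((0 : L2) : ℝ → C2) =ᵐ[volume] (0 : ℂ) • ((0 : L2) : ℝ → C2) := by
      filter_upwards [Lp.coeFn_zero C2 2 (volume : Measure ℝ)] with x _
      simp
    refine (memLp_congr_ae (linExpr_smul d m ε f g u 0 h0 e)).2 ?_
    rw [zero_smul]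
    exact MemLp.zero
  smul_mem' := by
    rintro c y ⟨hy, hy'⟩
    exact ⟨(hy.const_smul c).congr (Lp.coeFn_smul c y).symm,
      (memLp_congr_ae (linExpr_smul d m ε f g u c hy (Lp.coeFn_smul c y))).2 (hy'.const_smul c)⟩

/-- The linearization `L_ε(u) = A_ε + ∂_u N_ε(u, ·)`, an unbounded operator on `L²(ℝ; ℂ²)`. -/
def linearization (d m ε : ℝ) (f g : ℝ → ℝ) (u : ℝ → R2) : L2 →ₗ.[ℂ] L2 where
  domain := linDomain d m ε f g u
  toFun :=
    { toFun := fun y => y.2.2.toLp (linExpr d m ε f g u (y : L2))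
      map_add' := fun y z => by
        rw [← MemLp.toLp_add]
        exact MemLp.toLp_congr _ _ (linExpr_add d m ε f g u y.2.1 z.2.1 (Lp.coeFn_add _ _))
      map_smul' := fun c y => by
        rw [RingHom.id_apply, ← MemLp.toLp_const_smul]
        exact MemLp.toLp_congr _ _ (linExpr_smul d m ε f g u c y.2.1 (Lp.coeFn_smul _ _)) }

theorem mem_linDomain_iff (d m ε : ℝ) {f g : ℝ → ℝ} {u : ℝ → R2} (hf : MemLp f ∞ volume)
    (hg : MemLp g ∞ volume) (hu : MemLp u ∞ volume) (y : L2) :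
    y ∈ (linearization d m ε f g u).domain ↔ MemH2 (y : ℝ → C2) := by
  refine ⟨fun h => h.1, fun h => ⟨h, ?_⟩⟩
  obtain ⟨hy, y1, y2, a, b, hy1, hy2⟩ := h
  have k1 := (memLp_congr_ae a.weakDeriv_ae).2 hy1
  have k2 := (memLp_congr_ae (a.weakDeriv_weakDeriv_ae b)).2 hy2
  have u0 : MemLp (fun x => u x 0) ∞ volume := hu.eval_piLp 0
  have u1 : MemLp (fun x => u x 1) ∞ volume := hu.eval_piLp 1
  have c1 : ∀ c : ℝ, MemLp (fun _ : ℝ => c) ∞ volume := fun c => memLp_top_const c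
  have q : MemLp (fun x => u x 1 ^ 2) ∞ volume := by
    simpa [pow_two] using u1.mul' (r := ∞) u1
  have r : MemLp (fun x => 2 * u x 0 * u x 1) ∞ volume := u1.mul' (r := ∞) (u0.const_mul 2)
  have key : ∀ (c : ℝ → ℝ) (w : ℝ → ℂ), MemLp c ∞ volume → MemLp w 2 volume →
      MemLp (fun x => (c x : ℂ) * w x) 2 volume := fun c w hc hw =>
    hw.mul' (p := ∞) hc.ofReal
  rw [memLp_piLp_iff]
  intro i
  fin_cases i
  · exact (((k2.eval_piLp 0).add (key _ _ (hf.const_mul ε) (k1.eval_piLp 0))).add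
      (key _ _ (((hg.const_mul ε).sub (c1 1)).sub q) (hy.eval_piLp 0))).add
      (key _ _ r.neg (hy.eval_piLp 1))
  · exact ((key _ _ (c1 (d ^ 2)) (k2.eval_piLp 1)).add
      (key _ _ q (hy.eval_piLp 0))).add
      (key _ _ ((c1 (-m)).add r) (hy.eval_piLp 1))

/-! ### Spectral notions for unbounded operators -/

section Spectral

variable {H : Type*} [NormedAddCommGroup H] [NormedSpace ℂ H]

/-- `A - μ : D(A) → H` is bijective with bounded inverse. -/
def IsInResolventSet (A : H →ₗ.[ℂ] H) (μ : ℂ) : Prop :=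
  ∃ R : H →L[ℂ] H, (∀ y : H, ∃ h : R y ∈ A.domain, A ⟨R y, h⟩ - μ • R y = y) ∧
    ∀ y : A.domain, R (A y - μ • (y : H)) = y

/-- The spectrum of an unbounded operator. -/
def spectrumOf (A : H →ₗ.[ℂ] H) : Set ℂ := {μ | ¬ IsInResolventSet A μ}

/-- The kernel of `(A - μ)ⁿ`. -/
def kerPow (A : H →ₗ.[ℂ] H) (μ : ℂ) : ℕ → Submodule ℂ H
  | 0 => ⊥
  | n + 1 => ((kerPow A μ n).comap (A.toFun - μ • A.domain.subtype)).map A.domain.subtype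

/-- `μ` is an eigenvalue of algebraic multiplicity one: the generalized eigenspace
`⋃ₙ ker (A - μ)ⁿ` is one-dimensional. -/
def IsSimpleEigenvalue (A : H →ₗ.[ℂ] H) (μ : ℂ) : Prop :=
  Module.finrank ℂ (⨆ n, kerPow A μ n : Submodule ℂ H) = 1

/-- All spectrum other than the simple eigenvalue `0` lies in `{Re μ ≤ -ϱ}` for some `ϱ > 0`. -/
def SpectrallyStableWithSimpleZero (A : H →ₗ.[ℂ] H) : Prop :=
  (∃ ϱ : ℝ, 0 < ϱ ∧ spectrumOf A ⊆ {μ : ℂ | μ.re ≤ -ϱ} ∪ {0}) ∧ IsSimpleEigenvalue A 0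

/-- The operator is invertible with bounded inverse. -/
def IsInvertible (A : H →ₗ.[ℂ] H) : Prop := IsInResolventSet A 0

end Spectral

/-- The real profile `Ψ ∈ L²(ℝ; ℝ²)`, regarded as `ℂ²`-valued, spans the kernel of the Hilbert
space adjoint `A*`. -/
def SpansAdjointKernel (A : L2 →ₗ.[ℂ] L2) (Ψ : ℝ → R2) : Prop :=
  ∀ y : L2, (∃ h : y ∈ A.adjoint.domain, A.adjoint ⟨y, h⟩ = 0) ↔
    ∃ c : ℂ, ∀ᵐ x : ℝ, ∀ i, y x i = c * (Ψ x i : ℂ)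

/-- The Melnikov integral `∫ (f' ∂ₓu₁ + g' u₁) Ψ₁ dx`. -/
def melnikov (f g : ℝ → ℝ) (u Ψ : ℝ → R2) : ℝ :=
  ∫ x : ℝ, (deriv f x * weakDeriv u x 0 + deriv g x * u x 0) * Ψ x 0

end Klausmeier

end

open Klausmeier

open MeasureTheory Set Filter Topology
open scoped ContDiff ENNReal

noncomputable section

namespace Klausmeier


/-! ### Calculus of weak derivatives on the line -/

section WeakDerivCalculus

variable {E F : Type*} [NormedAddCommGroup E] [NormedSpace ℝ E]
  [NormedAddCommGroup F] [NormedSpace ℝ F]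

/-! The operator G = (1 - ∂²)⁻¹ (`opG`) is a bounded bijection of L² onto H². Writing H² functions
as G h turns the linearization L into the bounded operator S = L G (`linS`). Then L - μ is
invertible exactly when S - μG is a unit (`isInResolventSet_iff_isUnit`), and the multiplicity of an
eigenvalue can be read off from S as well (`isSimpleEigenvalue_of_factored`). The given solution
becomes v + G h, and its translational mode ∂ₓu₀ becomes G η (`exists_wave`).

Outside zero the spectral gap makes S - μG invertible. Wave packets pushed to infinity then show
that the matrix symbol of the asymptotic constant-coefficient operator is invertible at these μ
(`det_ne_zero_of_isUnit`), and a gap argument for its determinant includes μ = 0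
(`symbol_det_ne_zero`). Hence the constant-coefficient operator is invertible both on L² and on
bounded continuous functions (`isUnit_symbol`). Since the coefficients of S converge at infinity, S
is a compact perturbation of it. The Fredholm alternative, simplicity of the kernel and ⟨Ψ, ∂ₓu₀⟩ =
1 make the bordered operator (S, Φ; ℓ, 0) with Φ = ∂ₓu₀ invertible (`Wave.isUnit_bordered`).

The implicit function theorem is used three times, analytically in complex ε (`Wave.exists_branch`):
for the periodic background in bounded continuous functions, for the localized profile in L² with a
phase condition and a Lagrange multiplier, and for a normalized eigenpair. Local uniqueness
transports symmetries: periodicity, evenness and reality are inherited from the equations, and the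
multiplier vanishes because Φ is odd while the profile is even. The eigenvalue is -μ(ε), which is
real for real ε.

No other spectrum lies in Re z ≥ -ϱ/2 (`Branch.spectrum_eq`): large z are excluded by a resolvent
estimate, a compact intermediate region by openness of the units, and z near 0 by the bordered
operator and uniqueness of the eigenpair.

Finally μ'(0) is the Melnikov integral (`Branch.deriv_μ_eq_melnikov`). Pairing the ε-derivative of
the eigenvalue equation with Ψ gives μ'(0) = -⟨Ψ, Ṡη⟩, where Ṡ is the derivative of S along the
branch. Differentiating the equation for the tangent of the branch in x shows that L₀ applied to the
x-derivative of the tangent is -Ṡη - (f'∂ₓu₀₁ + g'u₀₁)e₁. This derivative is only bounded, because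
the background moves too, so Ψ is tested against it by cutoffs (`Wave.integral_inner_eq_zero`).
Analyticity of μ gives the quadratic error bound. -/

theorem hasWeakDeriv_of_hasDerivAt [CompleteSpace E] {u u' : ℝ → E}
    (h : ∀ x, HasDerivAt u (u' x) x) (hc : Continuous u') : HasWeakDeriv u u' := by
  have hu : Continuous u := continuous_iff_continuousAt.2 fun x => (h x).continuousAt
  refine ⟨hu.locallyIntegrable, hc.locallyIntegrable, fun φ hφ hs => ?_⟩
  have hd : Continuous (deriv φ) := hφ.continuous_deriv (by norm_num)
  have := integral_bilinear_hasDerivAt_right_eq_neg_left_of_integrable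
    (L := ContinuousLinearMap.lsmul ℝ ℝ) (u := φ) (u' := deriv φ) (v := u) (v' := u')
    (fun x _ => (hφ.differentiable (by norm_num) x).hasDerivAt) (fun x _ => h x)
    (hc.locallyIntegrable.integrable_smul_left_of_hasCompactSupport hφ.continuous hs)
    (hu.locallyIntegrable.integrable_smul_left_of_hasCompactSupport hd hs.deriv)
    (hu.locallyIntegrable.integrable_smul_left_of_hasCompactSupport hφ.continuous hs)
  simp only [ContinuousLinearMap.lsmul_apply] at this
  rw [this, neg_neg]

theorem HasWeakDeriv.clm_comp [CompleteSpace E] [CompleteSpace F] {u u' : ℝ → E}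
    (h : HasWeakDeriv u u') (L : E →L[ℝ] F) :
    HasWeakDeriv (fun x => L (u x)) (fun x => L (u' x)) := by
  have key : ∀ {v : ℝ → E}, LocallyIntegrable v volume →
      LocallyIntegrable (fun x => L (v x)) volume := fun hv x => by
    obtain ⟨s, hs, hi⟩ := hv x
    exact ⟨s, hs, L.integrable_comp hi⟩
  refine ⟨key h.1, key h.2.1, fun φ hφ hs => ?_⟩
  have hd : Continuous (deriv φ) := hφ.continuous_deriv (by norm_num)
  have e1 := L.integral_comp_comm
    (h.1.integrable_smul_left_of_hasCompactSupport hd hs.deriv)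
  have e2 := L.integral_comp_comm
    (h.2.1.integrable_smul_left_of_hasCompactSupport hφ.continuous hs)
  simp only [map_smul] at e1 e2
  rw [e1, e2, h.2.2 φ hφ hs, map_neg]

theorem HasWeakDeriv.neg [CompleteSpace E] {u u' : ℝ → E} (h : HasWeakDeriv u u') :
    HasWeakDeriv (-u) (-u') := by
  simpa using! h.clm_comp (-ContinuousLinearMap.id ℝ E)

theorem HasWeakDeriv.sub [CompleteSpace E] {u u' v v' : ℝ → E} (h : HasWeakDeriv u u')
    (k : HasWeakDeriv v v') : HasWeakDeriv (u - v) (u' - v') := by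
  simpa only [sub_eq_add_neg] using h.add k.neg

theorem hasWeakDeriv_const [CompleteSpace E] (c : E) :
    HasWeakDeriv (fun _ : ℝ => c) (fun _ => 0) :=
  hasWeakDeriv_of_hasDerivAt (fun x => hasDerivAt_const x c) continuous_const

/-- The smooth factor is moved onto the test function, since `s * φ` is again admissible. With `s =
Real.exp` this provides the integrating factor for w' = -w. -/
theorem HasWeakDeriv.smul_contDiff [CompleteSpace E] {u u' : ℝ → E} (h : HasWeakDeriv u u')
    {s : ℝ → ℝ} (hs : ContDiff ℝ ∞ s) :
    HasWeakDeriv (fun x => s x • u x) (fun x => deriv s x • u x + s x • u' x) := by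
  have hds : ContDiff ℝ ∞ (deriv s) := ((contDiff_infty_iff_deriv (f := s)).1 hs).2
  have l1 : LocallyIntegrable (fun x => s x • u x) volume :=
    (h.1.locallyIntegrableOn univ).continuousOn_smul isOpen_univ.isLocallyClosed
      hs.continuous.continuousOn |> locallyIntegrableOn_univ.1
  have l2 : LocallyIntegrable (fun x => deriv s x • u x) volume :=
    (h.1.locallyIntegrableOn univ).continuousOn_smul isOpen_univ.isLocallyClosed
      hds.continuous.continuousOn |> locallyIntegrableOn_univ.1
  have l3 : LocallyIntegrable (fun x => s x • u' x) volume :=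
    (h.2.1.locallyIntegrableOn univ).continuousOn_smul isOpen_univ.isLocallyClosed
      hs.continuous.continuousOn |> locallyIntegrableOn_univ.1
  refine ⟨l1, l2.add l3, fun φ hφ hc => ?_⟩
  have hd : Continuous (deriv φ) := hφ.continuous_deriv (by norm_num)
  have hsφ : ContDiff ℝ ∞ (fun x => s x * φ x) := hs.mul hφ
  have hsc : HasCompactSupport (fun x => s x * φ x) := hc.mul_left
  have e := h.2.2 _ hsφ hsc
  have e1 : ∀ x, deriv (fun x => s x * φ x) x = deriv s x * φ x + s x * deriv φ x := fun x =>
    deriv_fun_mul (hs.differentiable (by norm_num) x) (hφ.differentiable (by norm_num) x)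
  have i1 : Integrable (fun x => deriv φ x • (s x • u x)) volume :=
    l1.integrable_smul_left_of_hasCompactSupport hd hc.deriv
  have i2 : Integrable (fun x => φ x • (deriv s x • u x)) volume :=
    l2.integrable_smul_left_of_hasCompactSupport hφ.continuous hc
  have i3 : Integrable (fun x => φ x • (s x • u' x)) volume :=
    l3.integrable_smul_left_of_hasCompactSupport hφ.continuous hc
  have e2 : ∫ x, deriv (fun x => s x * φ x) x • u x
      = (∫ x, φ x • (deriv s x • u x)) + ∫ x, deriv φ x • (s x • u x) := by
    rw [← integral_add i2 i1]
    refine integral_congr_ae (ae_of_all _ fun x => ?_)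
    simp only [e1, add_smul, smul_smul]
    congr 2 <;> ring
  have e3 : ∫ x, (s x * φ x) • u' x = ∫ x, φ x • (s x • u' x) :=
    integral_congr_ae (ae_of_all _ fun x => by simp only [smul_smul]; congr 1; ring)
  rw [e2, e3] at e
  simp only [smul_add]
  rw [integral_add i2 i3, ← sub_eq_iff_eq_add'.2 e.symm]
  abel

/-- The du Bois-Reymond lemma. -/
theorem HasWeakDeriv.ae_eq_const [CompleteSpace E] {w : ℝ → E} (h : HasWeakDeriv w 0) :
    ∃ c : E, w =ᵐ[volume] fun _ => c := by
  let b : ContDiffBump (0 : ℝ) := ⟨1, 2, by norm_num, by norm_num⟩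
  set θ : ℝ → ℝ := b.normed volume with hθ
  have hθd : ContDiff ℝ ∞ θ := b.contDiff_normed
  have hθs : HasCompactSupport θ := b.hasCompactSupport_normed
  have hθ1 : ∫ x, θ x = 1 := b.integral_normed
  refine ⟨∫ x, θ x • w x, ?_⟩
  refine ae_eq_of_integral_contDiff_smul_eq h.1 (locallyIntegrable_const _) fun φ hφ hφs => ?_
  set a : ℝ := ∫ x, φ x
  -- Removing the mean of φ with the unit-mass bump θ gives a test function of integral zero. Its
  -- primitive `p` is then compactly supported and can itself be used as a test function.
  set ψ : ℝ → ℝ := fun x => φ x - a * θ x with hψ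
  have hψd : ContDiff ℝ ∞ ψ := hφ.sub (contDiff_const.mul hθd)
  have hψs : HasCompactSupport ψ := hφs.sub hθs.mul_left
  have hφi : Integrable φ volume := hφ.continuous.integrable_of_hasCompactSupport hφs
  have hθi : Integrable θ volume := hθd.continuous.integrable_of_hasCompactSupport hθs
  have hψi : Integrable ψ volume := hψd.continuous.integrable_of_hasCompactSupport hψs
  have hψ0 : ∫ x, ψ x = 0 := by
    rw [hψ, integral_sub hφi (hθi.const_mul a), integral_const_mul, hθ1]
    simp [a]
  obtain ⟨r, hr⟩ := hψs.isBounded.subset_closedBall 0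
  have hz : ∀ x, r < |x| → ψ x = 0 := fun x hx => by
    by_contra hne
    have := hr (subset_tsupport _ (Function.mem_support.2 hne))
    rw [mem_closedBall_zero_iff, Real.norm_eq_abs] at this
    linarith
  set p : ℝ → ℝ := fun x => ∫ t in Iic x, ψ t with hp
  have hpd : ∀ x, HasDerivAt p (ψ x) x := by
    intro x
    have : p = fun x => (∫ t in Iic (0 : ℝ), ψ t) + ∫ t in (0 : ℝ)..x, ψ t := by
      funext y
      rw [hp, ← intervalIntegral.integral_Iic_sub_Iic hψi.integrableOn hψi.integrableOn]
      ring
    rw [this]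
    exact (intervalIntegral.integral_hasDerivAt_right (hψi.intervalIntegrable)
      (hψd.continuous.stronglyMeasurableAtFilter _ _) hψd.continuous.continuousAt).const_add _
  have hpderiv : deriv p = ψ := funext fun x => (hpd x).deriv
  have hpc : ContDiff ℝ ∞ p :=
    contDiff_infty_iff_deriv.2 ⟨fun x => (hpd x).differentiableAt, hpderiv ▸ hψd⟩
  have hps : HasCompactSupport p := by
    refine HasCompactSupport.intro (isCompact_closedBall (0 : ℝ) r) fun x hx => ?_
    rw [mem_closedBall_zero_iff, Real.norm_eq_abs, not_le] at hx
    rcases lt_abs.1 hx with hx' | hx'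
    · have h1 : ∫ t in Ioi x, ψ t = 0 := by
        refine setIntegral_eq_zero_of_forall_eq_zero fun t ht => hz t ?_
        exact lt_of_lt_of_le (hx'.trans ht) (le_abs_self t)
      have h2 := intervalIntegral.integral_Iic_add_Ioi (b := x) hψi.integrableOn hψi.integrableOn
      rw [h1, hψ0, add_zero] at h2
      exact h2
    · refine setIntegral_eq_zero_of_forall_eq_zero fun t ht => hz t ?_
      have : t ≤ x := ht
      exact lt_of_lt_of_le (by linarith) (neg_le_abs t)
  have e := h.2.2 p hpc hps
  simp only [hpderiv, Pi.zero_apply, smul_zero, integral_zero, neg_zero] at e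
  have i1 : Integrable (fun x => φ x • w x) volume :=
    h.1.integrable_smul_left_of_hasCompactSupport hφ.continuous hφs
  have i2 : Integrable (fun x => θ x • w x) volume :=
    h.1.integrable_smul_left_of_hasCompactSupport hθd.continuous hθs
  have e2 : ∫ x, ψ x • w x = (∫ x, φ x • w x) - a • ∫ x, θ x • w x := by
    rw [← integral_smul, ← integral_sub i1 (i2.fun_smul a)]
    exact integral_congr_ae (ae_of_all _ fun x => by simp [hψ, sub_smul, smul_smul])
  rw [e2, sub_eq_zero] at e
  rw [e, integral_smul_const]

/-- The integrating factor eˣ makes eˣ w constant, and c e⁻ˣ is not square integrable at -∞ unless c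
= 0. This is uniqueness in L² for y' + y = h. -/
theorem HasWeakDeriv.ae_eq_zero_of_neg_self [CompleteSpace E] {w : ℝ → E}
    (h : HasWeakDeriv w (-w)) (hw : MemLp w 2 volume) : w =ᵐ[volume] 0 := by
  have h1 := h.smul_contDiff (s := Real.exp) Real.contDiff_exp
  have h2 : HasWeakDeriv (fun x => Real.exp x • w x) 0 := by
    refine h1.congr (ae_eq_refl _) (ae_of_all _ fun x => ?_)
    simp
  obtain ⟨c, hc⟩ := h2.ae_eq_const
  have hw' : w =ᵐ[volume] fun x => Real.exp (-x) • c := by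
    filter_upwards [hc] with x hx
    rw [← hx, smul_smul, ← Real.exp_add]
    simp
  by_cases hc0 : c = 0
  · filter_upwards [hw'] with x hx
    simp [hx, hc0]
  exfalso
  have h3 := (memLp_congr_ae hw').1 hw
  have h4 := (memLp_two_iff_integrable_sq_norm h3.1).1 h3
  have h5 : IntegrableOn (fun _ : ℝ => ‖c‖ ^ 2) (Iic 0) volume := by
    refine Integrable.mono' h4.integrableOn aestronglyMeasurable_const ?_
    filter_upwards [ae_restrict_mem measurableSet_Iic] with x hx
    have : (1 : ℝ) ≤ Real.exp (-x) := Real.one_le_exp (by simpa using hx)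
    simp only [norm_smul, Real.norm_eq_abs, Real.abs_exp, mul_pow, abs_pow, abs_norm]
    exact le_mul_of_one_le_left (by positivity) (one_le_pow₀ this)
  rw [integrableOn_const_iff] at h5
  · simp [hc0] at h5

end WeakDerivCalculus


/-! ### The one-sided exponential kernel on L² -/

section ExpKernel

set_option linter.unusedSectionVars false

variable {E F W : Type*} [NormedAddCommGroup E] [NormedSpace ℝ E]
  [NormedAddCommGroup F] [NormedSpace ℝ F] [NormedAddCommGroup W] [NormedSpace ℝ W]

theorem hasDerivAt_integral_Iic [CompleteSpace E] {k : ℝ → E} (hi : ∀ x, IntegrableOn k (Iic x))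
    (hc : Continuous k) (x : ℝ) : HasDerivAt (fun x => ∫ t in Iic x, k t) (k x) x := by
  have : (fun x => ∫ t in Iic x, k t)
      = fun x => (∫ t in Iic (0 : ℝ), k t) + ∫ t in (0 : ℝ)..x, k t := by
    funext y
    rw [← intervalIntegral.integral_Iic_sub_Iic (hi _) (hi _)]
    abel
  rw [this]
  exact (intervalIntegral.integral_hasDerivAt_right (hc.intervalIntegrable _ _)
    (hc.stronglyMeasurableAtFilter _ _) hc.continuousAt).const_add _

theorem continuous_integral_Iic {k : ℝ → E} (hi : ∀ x, IntegrableOn k (Iic x)) :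
    Continuous fun x => ∫ t in Iic x, k t := by
  have : (fun x => ∫ t in Iic x, k t)
      = fun x => (∫ t in Iic (0 : ℝ), k t) + ∫ t in (0 : ℝ)..x, k t := by
    funext y
    rw [← intervalIntegral.integral_Iic_sub_Iic (hi _) (hi _)]
    abel
  rw [this]
  refine continuous_const.add (intervalIntegral.continuous_primitive (fun a b => ?_) 0)
  exact ⟨(hi b).mono_set Ioc_subset_Iic_self, (hi a).mono_set Ioc_subset_Iic_self⟩

/-- The bounded solution of `y' + y = h`. -/
def expInt (h : ℝ → E) (x : ℝ) : E := ∫ t in Iic x, Real.exp (t - x) • h t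

/-- The bounded solution of `y - y' = h`. -/
def expIntR (h : ℝ → E) (x : ℝ) : E := expInt (fun t => h (-t)) (-x)

theorem expIntR_eq (h : ℝ → E) (x : ℝ) :
    expIntR h x = ∫ t in Ioi x, Real.exp (x - t) • h t := by
  have := integral_comp_neg_Iic (-x) (fun t => Real.exp (x - t) • h t)
  rw [neg_neg] at this
  rw [← this, expIntR, expInt]
  refine integral_congr_ae (ae_of_all _ fun t => ?_)
  simp only
  congr 2
  ring

/-- Pulling out e⁻ˣ leaves an integrand independent of x, so that the fundamental theorem of
calculus applies. -/
theorem expInt_eq (h : ℝ → E) (x : ℝ) :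
    expInt h x = Real.exp (-x) • ∫ t in Iic x, Real.exp t • h t := by
  rw [expInt, ← integral_smul]
  refine integral_congr_ae (ae_of_all _ fun t => ?_)
  simp only [smul_smul, ← Real.exp_add]
  congr 2
  ring

theorem expInt_congr {h k : ℝ → E} (e : h =ᵐ[volume] k) : expInt h = expInt k := by
  funext x
  exact integral_congr_ae (ae_restrict_of_ae (e.mono fun t ht => by simp only [ht]))

theorem ae_comp_neg {p : ℝ → Prop} (h : ∀ᵐ x : ℝ, p x) : ∀ᵐ x : ℝ, p (-x) :=
  (Measure.measurePreserving_neg (volume : Measure ℝ)).quasiMeasurePreserving.ae h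

theorem memLp_comp_neg {h : ℝ → E} {p : ℝ≥0∞} (hh : MemLp h p volume) :
    MemLp (fun t => h (-t)) p volume :=
  hh.comp_measurePreserving (Measure.measurePreserving_neg (volume : Measure ℝ))

theorem expIntR_congr {h k : ℝ → E} (e : h =ᵐ[volume] k) : expIntR h = expIntR k := by
  funext x
  exact congrFun (expInt_congr (ae_comp_neg (p := fun x => h x = k x) e)) (-x)

theorem lintegral_exp_Iic (x : ℝ) :
    ∫⁻ t in Iic x, ENNReal.ofReal (Real.exp (t - x)) = 1 := by
  have h0 : IntegrableOn (fun t => Real.exp (t - x)) (Iic x) := by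
    simp only [sub_eq_add_neg, Real.exp_add]
    exact (integrableOn_exp_Iic x).mul_const _
  rw [← ofReal_integral_eq_lintegral_ofReal h0 (ae_of_all _ fun t => (Real.exp_pos _).le)]
  simp only [sub_eq_add_neg, Real.exp_add]
  rw [integral_mul_const, integral_exp_Iic, ← Real.exp_add]
  simp

theorem lintegral_exp_Ici (t : ℝ) :
    ∫⁻ x in Ici t, ENNReal.ofReal (Real.exp (t - x)) = 1 := by
  have h0 : IntegrableOn (fun x => Real.exp (t - x)) (Ioi t) := by
    simp only [sub_eq_add_neg, Real.exp_add]
    exact (integrableOn_exp_neg_Ioi t).const_mul _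
  rw [setLIntegral_congr Ioi_ae_eq_Ici.symm,
    ← ofReal_integral_eq_lintegral_ofReal h0 (ae_of_all _ fun t => (Real.exp_pos _).le)]
  simp only [sub_eq_add_neg, Real.exp_add]
  rw [integral_const_mul, integral_exp_neg_Ioi, ← Real.exp_add]
  simp

/-- Cauchy–Schwarz with the kernel split into two equal square roots `e`; the kernel has total mass
one in t. -/
theorem lintegral_expKernel_sq_le {h : ℝ → ℝ≥0∞} (hh : AEMeasurable h volume) (x : ℝ) :
    (∫⁻ t in Iic x, ENNReal.ofReal (Real.exp (t - x)) * h t) ^ 2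
      ≤ ∫⁻ t in Iic x, ENNReal.ofReal (Real.exp (t - x)) * h t ^ 2 := by
  set e : ℝ → ℝ≥0∞ := fun t => ENNReal.ofReal (Real.exp ((t - x) / 2)) with he
  have hem : Measurable e := by fun_prop
  have hee : ∀ t, ENNReal.ofReal (Real.exp (t - x)) = e t ^ 2 := fun t => by
    rw [he, ← ENNReal.ofReal_pow (Real.exp_pos _).le, ← Real.exp_nat_mul]
    congr 2
    push_cast
    ring
  have H := ENNReal.lintegral_mul_le_Lp_mul_Lq (volume.restrict (Iic x))
    (Real.HolderConjugate.two_two) hem.aemeasurable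
    ((hem.aemeasurable).mul hh.restrict)
  have e1 : ∫⁻ t in Iic x, e t ^ (2 : ℝ) = 1 := by
    rw [← lintegral_exp_Iic x]
    exact lintegral_congr fun t => by rw [hee, ENNReal.rpow_two]
  rw [e1, ENNReal.one_rpow, one_mul] at H
  have e2 : (∫⁻ t in Iic x, ENNReal.ofReal (Real.exp (t - x)) * h t)
      = ∫⁻ t in Iic x, (e * (e * h)) t :=
    lintegral_congr fun t => by simp only [hee, Pi.mul_apply]; ring
  have e3 : (∫⁻ t in Iic x, ENNReal.ofReal (Real.exp (t - x)) * h t ^ 2)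
      = ∫⁻ t in Iic x, (e * h) t ^ (2 : ℝ) :=
    lintegral_congr fun t => by simp only [hee, Pi.mul_apply, ENNReal.rpow_two, mul_pow]
  rw [e2, e3]
  calc _ ≤ ((∫⁻ t in Iic x, (e * h) t ^ (2 : ℝ)) ^ (1 / (2 : ℝ))) ^ 2 := by gcongr
    _ = _ := by
      rw [← ENNReal.rpow_two, ← ENNReal.rpow_mul]
      norm_num

/-- By Tonelli, since the kernel also has mass one in x. Together with the pointwise square bound
this is Schur's test, with norm at most one. -/
theorem lintegral_lintegral_expKernel {h : ℝ → ℝ≥0∞} (hh : AEMeasurable h volume) :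
    ∫⁻ x, ∫⁻ t in Iic x, ENNReal.ofReal (Real.exp (t - x)) * h t = ∫⁻ t, h t := by
  have hm : AEMeasurable (fun p : ℝ × ℝ => (Iic p.1).indicator
      (fun t => ENNReal.ofReal (Real.exp (t - p.1)) * h t) p.2) (volume.prod volume) := by
    have : (fun p : ℝ × ℝ => (Iic p.1).indicator
        (fun t => ENNReal.ofReal (Real.exp (t - p.1)) * h t) p.2)
        = {p : ℝ × ℝ | p.2 ≤ p.1}.indicator
          (fun p => ENNReal.ofReal (Real.exp (p.2 - p.1)) * h p.2) := by
      funext p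
      simp [indicator_apply]
    rw [this]
    refine AEMeasurable.indicator ?_ (measurableSet_le measurable_snd measurable_fst)
    exact (by fun_prop : Measurable fun p : ℝ × ℝ =>
      ENNReal.ofReal (Real.exp (p.2 - p.1))).aemeasurable.mul hh.comp_snd
  calc ∫⁻ x, ∫⁻ t in Iic x, ENNReal.ofReal (Real.exp (t - x)) * h t
      = ∫⁻ x, ∫⁻ t, (Iic x).indicator
          (fun t => ENNReal.ofReal (Real.exp (t - x)) * h t) t := by
        simp only [lintegral_indicator measurableSet_Iic]
    _ = ∫⁻ t, ∫⁻ x, (Iic x).indicator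
          (fun t => ENNReal.ofReal (Real.exp (t - x)) * h t) t :=
        lintegral_lintegral_swap hm
    _ = ∫⁻ t, h t := by
        refine lintegral_congr fun t => ?_
        have : ∀ x, (Iic x).indicator (fun t => ENNReal.ofReal (Real.exp (t - x)) * h t) t
            = h t * (Ici t).indicator (fun x => ENNReal.ofReal (Real.exp (t - x))) x := fun x => by
          by_cases hx : t ≤ x <;> simp [hx, mul_comm]
        simp only [this]
        rw [lintegral_const_mul _ (by
          exact (by fun_prop : Measurable fun x : ℝ =>
            ENNReal.ofReal (Real.exp (t - x))).indicator measurableSet_Ici),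
          lintegral_indicator measurableSet_Ici, lintegral_exp_Ici, mul_one]

theorem integrableOn_expKernel {h : ℝ → E} (hh : MemLp h 2 volume) (x : ℝ) :
    IntegrableOn (fun t => Real.exp (t - x) • h t) (Iic x) volume := by
  refine ⟨((by fun_prop : Continuous fun t : ℝ => Real.exp (t - x)).aestronglyMeasurable.smul
    hh.1).restrict, ?_⟩
  have h1 := lintegral_expKernel_sq_le hh.1.enorm x
  have h2 : ∫⁻ t in Iic x, ENNReal.ofReal (Real.exp (t - x)) * ‖h t‖ₑ ^ 2 < ⊤ := by
    refine lt_of_le_of_lt (setLIntegral_mono' (g := fun t => ‖h t‖ₑ ^ 2) measurableSet_Iic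
      fun t ht => ?_) (lt_of_le_of_lt (setLIntegral_le_lintegral _ _) ?_)
    · refine mul_le_of_le_one_left' ?_
      rw [ENNReal.ofReal_le_one, Real.exp_le_one_iff]
      simpa using ht
    · have := hh.eLpNorm_lt_top
      rw [eLpNorm_lt_top_iff_lintegral_rpow_enorm_lt_top (by norm_num) (by norm_num)] at this
      simpa using this
  have h3 := h1.trans_lt h2
  rw [ENNReal.pow_lt_top_iff] at h3
  simp only [HasFiniteIntegral, enorm_smul, Real.enorm_eq_ofReal (Real.exp_pos _).le]
  simpa using h3

theorem enorm_expInt_le (h : ℝ → E) (x : ℝ) :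
    ‖expInt h x‖ₑ ≤ ∫⁻ t in Iic x, ENNReal.ofReal (Real.exp (t - x)) * ‖h t‖ₑ := by
  refine (enorm_integral_le_lintegral_enorm _).trans (le_of_eq (lintegral_congr fun t => ?_))
  rw [enorm_smul, Real.enorm_eq_ofReal (Real.exp_pos _).le]

theorem enorm_expInt_sq_le {h : ℝ → E} (hh : AEStronglyMeasurable h volume) (x : ℝ) :
    ‖expInt h x‖ₑ ^ 2 ≤ ∫⁻ t in Iic x, ENNReal.ofReal (Real.exp (t - x)) * ‖h t‖ₑ ^ 2 :=
  (pow_le_pow_left' (enorm_expInt_le h x) 2).trans (lintegral_expKernel_sq_le hh.enorm x)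

theorem eLpNorm_two_eq (h : ℝ → E) : eLpNorm h 2 volume = (∫⁻ t, ‖h t‖ₑ ^ 2) ^ (1 / 2 : ℝ) := by
  rw [eLpNorm_eq_lintegral_rpow_enorm_toReal (by norm_num) (by norm_num)]
  simp

/-- The kernel is at most one for t ≤ x, so the same square bound also gives the sup-norm estimate
behind the continuous representatives. -/
theorem enorm_expInt_le_eLpNorm {h : ℝ → E} (hh : AEStronglyMeasurable h volume) (x : ℝ) :
    ‖expInt h x‖ₑ ≤ eLpNorm h 2 volume := by
  rw [eLpNorm_two_eq]
  have : ‖expInt h x‖ₑ = (‖expInt h x‖ₑ ^ 2) ^ (1 / 2 : ℝ) := by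
    rw [← ENNReal.rpow_two, ← ENNReal.rpow_mul]
    norm_num
  rw [this]
  gcongr
  refine (enorm_expInt_sq_le hh x).trans ((setLIntegral_mono' (g := fun t => ‖h t‖ₑ ^ 2)
    measurableSet_Iic fun t ht => ?_).trans (setLIntegral_le_lintegral _ _))
  refine mul_le_of_le_one_left' ?_
  rw [ENNReal.ofReal_le_one, Real.exp_le_one_iff]
  simpa using ht

theorem eLpNorm_expInt_le {h : ℝ → E} (hh : AEStronglyMeasurable h volume) :
    eLpNorm (expInt h) 2 volume ≤ eLpNorm h 2 volume := by
  rw [eLpNorm_two_eq, eLpNorm_two_eq]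
  refine ENNReal.rpow_le_rpow ?_ (by norm_num)
  refine (lintegral_mono (enorm_expInt_sq_le hh)).trans (le_of_eq ?_)
  exact lintegral_lintegral_expKernel (hh.enorm.pow_const 2)

theorem integrableOn_exp_smul {h : ℝ → E} (hh : MemLp h 2 volume) (x : ℝ) :
    IntegrableOn (fun t => Real.exp t • h t) (Iic x) volume := by
  have := (integrableOn_expKernel hh x).smul (Real.exp x)
  refine this.congr (ae_of_all _ fun t => ?_)
  simp [smul_smul, ← Real.exp_add]

theorem continuous_expInt {h : ℝ → E} (hh : MemLp h 2 volume) : Continuous (expInt h) := by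
  have : expInt h = fun x => Real.exp (-x) • ∫ t in Iic x, Real.exp t • h t :=
    funext fun x => expInt_eq h x
  rw [this]
  exact (Real.continuous_exp.comp continuous_neg).smul
    (continuous_integral_Iic (integrableOn_exp_smul hh))

theorem hasDerivAt_expInt [CompleteSpace E] {h : ℝ → E} (hh : MemLp h 2 volume) (hc : Continuous h)
    (x : ℝ) : HasDerivAt (expInt h) (h x - expInt h x) x := by
  have : expInt h = fun x => Real.exp (-x) • ∫ t in Iic x, Real.exp t • h t :=
    funext fun x => expInt_eq h x
  have d1 := hasDerivAt_integral_Iic (integrableOn_exp_smul hh) (Real.continuous_exp.smul hc) x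
  have d2 : HasDerivAt (fun x : ℝ => Real.exp (-x)) (-Real.exp (-x)) x := by
    simpa using (hasDerivAt_neg x).exp
  rw [expInt_eq h x]
  rw [this]
  refine (d2.smul d1).congr_deriv ?_
  simp only [smul_smul, ← Real.exp_add, neg_smul]
  simp [sub_eq_add_neg]

theorem memLp_expInt {h : ℝ → E} (hh : MemLp h 2 volume) : MemLp (expInt h) 2 volume :=
  ⟨(continuous_expInt hh).aestronglyMeasurable, (eLpNorm_expInt_le hh.1).trans_lt hh.2⟩

theorem memLp_expIntR {h : ℝ → E} (hh : MemLp h 2 volume) : MemLp (expIntR h) 2 volume :=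
  memLp_comp_neg (memLp_expInt (memLp_comp_neg hh))

theorem continuous_expIntR {h : ℝ → E} (hh : MemLp h 2 volume) : Continuous (expIntR h) :=
  (continuous_expInt (memLp_comp_neg hh)).comp continuous_neg

theorem hasDerivAt_expIntR [CompleteSpace E] {h : ℝ → E} (hh : MemLp h 2 volume)
    (hc : Continuous h) (x : ℝ) : HasDerivAt (expIntR h) (expIntR h x - h x) x := by
  have := (hasDerivAt_expInt (memLp_comp_neg hh) (hc.comp continuous_neg) (-x)).scomp x
    (hasDerivAt_neg x)
  refine this.congr_deriv ?_
  simp [expIntR]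

/-- Fubini: integrating the kernel over x ≥ t instead of t ≤ x gives the kernel of `expIntR`. A
general bilinear `B` covers both scalar test functions and the inner product of L². -/
theorem integral_bilin_expInt [CompleteSpace E] [CompleteSpace F] [CompleteSpace W]
    (B : F →L[ℝ] E →L[ℝ] W) {k : ℝ → F} {h : ℝ → E}
    (hk : MemLp k 2 volume) (hh : MemLp h 2 volume) :
    ∫ x, B (k x) (expInt h x) = ∫ t, B (expIntR k t) (h t) := by
  set Φ : ℝ → ℝ → W := fun x t => (Iic x).indicator
    (fun t => Real.exp (t - x) • B (k x) (h t)) t with hΦ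
  have hΦ' : ∀ x t, Φ x t = (Ici t).indicator
      (fun x => Real.exp (t - x) • B (k x) (h t)) x := fun x t => by
    by_cases hx : t ≤ x <;> simp [hΦ, hx]
  have hm : AEStronglyMeasurable (Function.uncurry Φ) (volume.prod volume) := by
    have : Function.uncurry Φ = {p : ℝ × ℝ | p.2 ≤ p.1}.indicator
        (fun p => Real.exp (p.2 - p.1) • B (k p.1) (h p.2)) := by
      funext p
      simp [hΦ, Function.uncurry, indicator_apply]
    rw [this]
    refine AEStronglyMeasurable.indicator ?_ (measurableSet_le measurable_snd measurable_fst)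
    refine (by fun_prop : Continuous fun p : ℝ × ℝ =>
      Real.exp (p.2 - p.1)).aestronglyMeasurable.smul ?_
    exact B.aestronglyMeasurable_comp₂ hk.1.comp_fst hh.1.comp_snd
  have hi : Integrable (Function.uncurry Φ) (volume.prod volume) := by
    rw [integrable_prod_iff hm]
    constructor
    · refine ae_of_all _ fun x => ?_
      simp only [Function.uncurry_apply_pair, hΦ]
      rw [integrable_indicator_iff measurableSet_Iic]
      have := (B (k x)).integrable_comp (integrableOn_expKernel hh x)
      simpa only [map_smul, IntegrableOn] using this
    -- The inner integral of the norm is dominated by ‖B‖ ‖k‖ `expInt` ‖h‖, a product of two L²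
    -- functions.
    · have hn : MemLp (expInt fun t => ‖h t‖) 2 volume := memLp_expInt hh.norm
      have hprod : Integrable (fun x => ‖B‖ * (‖k x‖ * expInt (fun t => ‖h t‖) x)) volume :=
        (hk.norm.integrable_mul hn).const_mul _
      refine Integrable.mono' hprod hm.norm.integral_prod_right' (ae_of_all _ fun x => ?_)
      rw [Real.norm_of_nonneg (integral_nonneg fun t => norm_nonneg _)]
      rw [expInt, ← integral_const_mul, ← integral_const_mul, ← integral_indicator measurableSet_Iic]
      refine integral_mono_of_nonneg (ae_of_all _ fun t => norm_nonneg _) ?_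
        (ae_of_all _ fun t => ?_)
      · rw [integrable_indicator_iff measurableSet_Iic]
        exact ((integrableOn_expKernel hh.norm x).const_mul _).const_mul _
      · by_cases hx : t ≤ x
        · simp only [Function.uncurry_apply_pair, hΦ, mem_Iic, hx, indicator_of_mem, norm_smul,
            Real.norm_eq_abs, Real.abs_exp, smul_eq_mul]
          have := B.le_opNorm₂ (k x) (h t)
          have e0 := Real.exp_pos (t - x)
          nlinarith
        · simp [hΦ, hx]
  calc ∫ x, B (k x) (expInt h x) = ∫ x, ∫ t, Φ x t := by
        refine integral_congr_ae (ae_of_all _ fun x => ?_)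
        simp only [hΦ]
        rw [integral_indicator measurableSet_Iic, expInt,
          ← (B (k x)).integral_comp_comm (integrableOn_expKernel hh x)]
        simp only [map_smul]
    _ = ∫ t, ∫ x, Φ x t := integral_integral_swap hi
    _ = ∫ t, B (expIntR k t) (h t) := by
        refine integral_congr_ae (ae_of_all _ fun t => ?_)
        simp only [hΦ']
        rw [integral_indicator measurableSet_Ici, expIntR_eq, integral_Ici_eq_integral_Ioi]
        have hik : IntegrableOn (fun x => Real.exp (t - x) • k x) (Ioi t) := by
          have h1 := integrableOn_expKernel (memLp_comp_neg hk) (-t)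
          rw [← integrableOn_Ici_iff_integrableOn_Ioi]
          have h2 := (Measure.measurePreserving_neg (volume : Measure ℝ)).integrableOn_comp_preimage
            (Homeomorph.neg ℝ).measurableEmbedding (f := fun x => Real.exp (t - x) • k x)
            (s := Ici t)
          rw [← h2]
          simpa [Function.comp_def, sub_eq_add_neg, add_comm] using h1
        have := (B.flip (h t)).integral_comp_comm hik
        simp only [ContinuousLinearMap.flip_apply] at this
        rw [← this]
        simp only [map_smul, smul_apply]

end ExpKernel


/-! ### Weak first-order equations solved by the exponential kernel -/

section WeakExp

variable {E : Type*} [NormedAddCommGroup E] [NormedSpace ℝ E] [CompleteSpace E]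

/-- Integration by parts on (t, ∞); the boundary term is -φ(t). -/
theorem expIntR_deriv {φ : ℝ → ℝ} (hφ : ContDiff ℝ ∞ φ) (hs : HasCompactSupport φ) (t : ℝ) :
    expIntR (deriv φ) t = expIntR φ t - φ t := by
  have hd : Continuous (deriv φ) := hφ.continuous_deriv (by norm_num)
  have he : Continuous fun x : ℝ => Real.exp (t - x) := by fun_prop
  have hc : ContDiff ℝ 1 (fun x => Real.exp (t - x) * φ x) :=
    (by fun_prop : ContDiff ℝ 1 fun x : ℝ => Real.exp (t - x)).mul (hφ.of_le (by norm_num))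
  have hcs : HasCompactSupport (fun x => Real.exp (t - x) * φ x) := hs.mul_left
  have h1 := hcs.integral_Ioi_deriv_eq hc t
  have h2 : ∀ x, deriv (fun x => Real.exp (t - x) * φ x) x
      = Real.exp (t - x) * deriv φ x - Real.exp (t - x) * φ x := fun x => by
    have d1 : HasDerivAt (fun x : ℝ => Real.exp (t - x)) (-Real.exp (t - x)) x := by
      simpa using ((hasDerivAt_id x).const_sub t).exp
    rw [(d1.fun_mul (hφ.differentiable (by norm_num) x).hasDerivAt).deriv]
    ring
  simp only [h2] at h1
  have i1 : Integrable (fun x => Real.exp (t - x) * deriv φ x) volume :=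
    (he.mul hd).integrable_of_hasCompactSupport hs.deriv.mul_left
  have i2 : Integrable (fun x => Real.exp (t - x) * φ x) volume :=
    (he.mul hφ.continuous).integrable_of_hasCompactSupport hcs
  rw [integral_sub i1.integrableOn i2.integrableOn] at h1
  simp only [expIntR_eq, smul_eq_mul]
  simp only [sub_self, Real.exp_zero, one_mul] at h1
  linarith

/-- Transposing the kernel onto the smooth test function means that no regularity of h beyond L² is
needed. -/
theorem hasWeakDeriv_expInt {h : ℝ → E} (hh : MemLp h 2 volume) :
    HasWeakDeriv (expInt h) (h - expInt h) := by
  have l1 := (continuous_expInt hh).locallyIntegrable (μ := volume)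
  have l2 : LocallyIntegrable h volume := hh.locallyIntegrable (by norm_num)
  refine ⟨l1, l2.sub l1, fun φ hφ hs => ?_⟩
  have hd : Continuous (deriv φ) := hφ.continuous_deriv (by norm_num)
  have m1 : MemLp φ 2 volume := hφ.continuous.memLp_of_hasCompactSupport hs
  have m2 : MemLp (deriv φ) 2 volume := hd.memLp_of_hasCompactSupport hs.deriv
  have e1 := integral_bilin_expInt (ContinuousLinearMap.lsmul ℝ ℝ) m2 hh
  have e2 := integral_bilin_expInt (ContinuousLinearMap.lsmul ℝ ℝ) m1 hh
  simp only [ContinuousLinearMap.lsmul_apply] at e1 e2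
  have i1 : Integrable (fun x => φ x • h x) volume :=
    l2.integrable_smul_left_of_hasCompactSupport hφ.continuous hs
  have i2 : Integrable (fun x => φ x • expInt h x) volume :=
    l1.integrable_smul_left_of_hasCompactSupport hφ.continuous hs
  have i3 : Integrable (fun x => expIntR φ x • h x) volume := by
    rw [← memLp_one_iff_integrable]
    exact hh.smul (memLp_expIntR m1)
  simp only [expIntR_deriv hφ hs, sub_smul] at e1
  rw [integral_sub i3 i1, ← e2] at e1
  rw [e1]
  simp only [Pi.sub_apply, smul_sub]
  rw [integral_sub i1 i2, neg_sub]

theorem HasWeakDeriv.comp_neg {u u' : ℝ → E} (h : HasWeakDeriv u u') :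
    HasWeakDeriv (fun x => u (-x)) (fun x => -u' (-x)) := by
  have key : ∀ {v : ℝ → E}, LocallyIntegrable v volume →
      LocallyIntegrable (fun x => v (-x)) volume := fun {v} hv => by
    rw [locallyIntegrable_iff] at hv ⊢
    intro K hK
    have h2 := (Measure.measurePreserving_neg (volume : Measure ℝ)).integrableOn_comp_preimage
      (Homeomorph.neg ℝ).measurableEmbedding (f := v) (s := -K)
    have h3 := h2.2 (hv _ hK.neg)
    simpa [Function.comp_def] using h3
  refine ⟨key h.1, (key h.2.1).neg, fun φ hφ hs => ?_⟩
  have hφ' : ContDiff ℝ ∞ (fun x => φ (-x)) := hφ.comp contDiff_neg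
  have hs' : HasCompactSupport (fun x => φ (-x)) := hs.comp_homeomorph (Homeomorph.neg ℝ)
  have e := h.2.2 _ hφ' hs'
  simp only [deriv_comp_neg] at e
  rw [← integral_neg_eq_self (fun x => deriv φ x • u (-x)),
    ← integral_neg_eq_self (fun x => φ x • -u' (-x))]
  simp only [neg_neg, smul_neg, neg_smul, integral_neg] at e ⊢
  exact (neg_eq_iff_eq_neg.1 e).trans (by simp)

theorem hasWeakDeriv_expIntR {h : ℝ → E} (hh : MemLp h 2 volume) :
    HasWeakDeriv (expIntR h) (expIntR h - h) := by
  have := (hasWeakDeriv_expInt (memLp_comp_neg hh)).comp_neg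
  refine this.congr (ae_eq_refl _) (ae_of_all _ fun x => ?_)
  simp [expIntR]

/-- Both sides solve Y' + Y = y + y', and their difference is an L² solution of w' = -w. -/
theorem HasWeakDeriv.eq_expInt {y y' : ℝ → E} (h : HasWeakDeriv y y') (hy : MemLp y 2 volume)
    (hy' : MemLp y' 2 volume) : y =ᵐ[volume] expInt (y + y') := by
  have h1 := h.sub (hasWeakDeriv_expInt (hy.add hy'))
  have h2 : y' - (y + y' - expInt (y + y')) = -(y - expInt (y + y')) := by abel
  rw [h2] at h1
  have h3 := h1.ae_eq_zero_of_neg_self (hy.sub (memLp_expInt (hy.add hy')))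
  filter_upwards [h3] with x hx
  exact sub_eq_zero.1 hx

end WeakExp

/-! ### The resolvent operators on `L²` -/

theorem expInt_add {E : Type*} [NormedAddCommGroup E] [NormedSpace ℝ E] {h k : ℝ → E}
    (hh : MemLp h 2 volume) (hk : MemLp k 2 volume) :
    expInt (h + k) = expInt h + expInt k := by
  funext x
  simp only [expInt, Pi.add_apply, smul_add]
  exact integral_add (integrableOn_expKernel hh x) (integrableOn_expKernel hk x)

theorem expInt_const_smul (c : ℂ) (h : ℝ → C2) : expInt (c • h) = c • expInt h := by
  funext x
  simp only [expInt, Pi.smul_apply, smul_comm _ c]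
  exact integral_smul c _

theorem norm_toLp_expInt_le (h : L2) :
    ‖(memLp_expInt (Lp.memLp h)).toLp (expInt (h : ℝ → C2))‖ ≤ ‖h‖ := by
  rw [Lp.norm_toLp, Lp.norm_def]
  exact ENNReal.toReal_mono (Lp.eLpNorm_ne_top h) (eLpNorm_expInt_le (Lp.aestronglyMeasurable h))

theorem toLp_expInt_add (h k : L2) :
    (memLp_expInt (Lp.memLp (h + k))).toLp (expInt ((h + k : L2) : ℝ → C2))
      = (memLp_expInt (Lp.memLp h)).toLp (expInt (h : ℝ → C2))
        + (memLp_expInt (Lp.memLp k)).toLp (expInt (k : ℝ → C2)) := by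
  rw [← MemLp.toLp_add]
  refine MemLp.toLp_congr _ _ (ae_of_all _ fun x => ?_)
  rw [expInt_congr (Lp.coeFn_add h k), expInt_add (Lp.memLp h) (Lp.memLp k)]

theorem toLp_expInt_smul (c : ℂ) (h : L2) :
    (memLp_expInt (Lp.memLp (c • h))).toLp (expInt ((c • h : L2) : ℝ → C2))
      = c • (memLp_expInt (Lp.memLp h)).toLp (expInt (h : ℝ → C2)) := by
  rw [← MemLp.toLp_const_smul]
  refine MemLp.toLp_congr _ _ (ae_of_all _ fun x => ?_)
  rw [expInt_congr (Lp.coeFn_smul c h), expInt_const_smul]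

/-- `(1 + ∂)⁻¹` on `L²`. -/
def opR : L2 →L[ℂ] L2 :=
  LinearMap.mkContinuous
    { toFun := fun h => (memLp_expInt (Lp.memLp h)).toLp _
      map_add' := toLp_expInt_add
      map_smul' := toLp_expInt_smul } 1 fun h => by
    rw [one_mul]
    exact norm_toLp_expInt_le h

theorem coeFn_opR (h : L2) : (opR h : ℝ → C2) =ᵐ[volume] expInt h :=
  MemLp.coeFn_toLp (memLp_expInt (Lp.memLp h))

/-- Reflection on `L²`. -/
def reflL : L2 →L[ℂ] L2 :=
  (Lp.compMeasurePreservingₗᵢ ℂ (fun x : ℝ => -x)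
    (Measure.measurePreserving_neg volume)).toContinuousLinearMap

theorem coeFn_reflL (h : L2) : (reflL h : ℝ → C2) =ᵐ[volume] fun x => h (-x) :=
  Lp.coeFn_compMeasurePreserving h (Measure.measurePreserving_neg volume)

theorem reflL_reflL (h : L2) : reflL (reflL h) = h := by
  refine Lp.ext ?_
  filter_upwards [coeFn_reflL (reflL h),
    ae_comp_neg (p := fun x => reflL h x = h (-x)) (coeFn_reflL h)] with x h1 h2
  rw [h1, h2, neg_neg]

/-- `(1 - ∂)⁻¹` on `L²`. -/
def opRm : L2 →L[ℂ] L2 := reflL ∘L opR ∘L reflL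

theorem opRm_apply (h : L2) : opRm h = reflL (opR (reflL h)) := rfl

theorem coeFn_opRm (h : L2) : (opRm h : ℝ → C2) =ᵐ[volume] expIntR h := by
  have e : ∀ᵐ x : ℝ, opR (reflL h) (-x) = expInt (reflL h) (-x) :=
    ae_comp_neg (p := fun x => opR (reflL h) x = expInt (reflL h) x) (coeFn_opR (reflL h))
  filter_upwards [coeFn_reflL (opR (reflL h)), e] with x h1 h2
  rw [opRm_apply, h1, h2, expInt_congr (coeFn_reflL h), expIntR]

theorem inner_opR (k h : L2) : inner ℂ k (opR h) = inner ℂ (opRm k) h := by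
  rw [L2.inner_def, L2.inner_def]
  have hb := (isBoundedBilinearMap_inner (𝕜 := ℂ) (E := C2))
  have := integral_bilin_expInt hb.toContinuousLinearMap (Lp.memLp k) (Lp.memLp h)
  calc ∫ x, inner ℂ (k x) (opR h x) = ∫ x, inner ℂ (k x) (expInt h x) :=
        integral_congr_ae ((coeFn_opR h).mono fun x hx => by simp only [hx])
    _ = ∫ x, inner ℂ (expIntR k x) (h x) := this
    _ = _ := integral_congr_ae ((coeFn_opRm k).mono fun x hx => by simp only [hx])

theorem inner_opRm (k h : L2) : inner ℂ k (opRm h) = inner ℂ (opR k) h := by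
  rw [← inner_conj_symm, ← inner_opR, inner_conj_symm]

theorem hasWeakDeriv_opR (h : L2) : HasWeakDeriv (opR h : ℝ → C2) ((h - opR h : L2) : ℝ → C2) := by
  refine (hasWeakDeriv_expInt (Lp.memLp h)).congr (coeFn_opR h).symm ?_
  filter_upwards [Lp.coeFn_sub h (opR h), coeFn_opR h] with x h1 h2
  rw [h1, Pi.sub_apply, Pi.sub_apply, h2]

theorem hasWeakDeriv_opRm (h : L2) : HasWeakDeriv (opRm h : ℝ → C2) ((opRm h - h : L2) : ℝ → C2) := by
  refine (hasWeakDeriv_expIntR (Lp.memLp h)).congr (coeFn_opRm h).symm ?_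
  filter_upwards [Lp.coeFn_sub (opRm h) h, coeFn_opRm h] with x h1 h2
  rw [h1, Pi.sub_apply, Pi.sub_apply, h2]

theorem eq_opR_of_hasWeakDeriv {y y' : L2} (h : HasWeakDeriv (y : ℝ → C2) y') :
    y = opR (y + y') := by
  refine Lp.ext ?_
  filter_upwards [h.eq_expInt (Lp.memLp y) (Lp.memLp y'), coeFn_opR (y + y')] with x h1 h2
  rw [h2, expInt_congr (Lp.coeFn_add y y'), h1]

/-- The partial fraction 2/((1+∂)(1-∂)) = 1/(1+∂) + 1/(1-∂), read off from the equation y' = y - h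
of y = `opRm h`. -/
theorem opR_opRm (h : L2) : (2 : ℂ) • opR (opRm h) = opR h + opRm h := by
  have := eq_opR_of_hasWeakDeriv (hasWeakDeriv_opRm h)
  rw [← add_sub_assoc, map_sub, map_add, eq_sub_iff_add_eq] at this
  rw [two_smul, ← this, add_comm]

theorem opRm_opR (h : L2) : (2 : ℂ) • opRm (opR h) = opR h + opRm h := by
  have := congrArg reflL (opR_opRm (reflL h))
  simp only [map_smul, map_add, opRm_apply, reflL_reflL] at this
  rw [opRm_apply, this, add_comm, opRm_apply]

theorem opR_opRm_comm (h : L2) : opR (opRm h) = opRm (opR h) := by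
  have := (opR_opRm h).trans (opRm_opR h).symm
  exact smul_right_injective _ (two_ne_zero (α := ℂ)) this

/-- `(1 - ∂²)⁻¹` on `L²`. -/
def opG : L2 →L[ℂ] L2 := opR ∘L opRm

/-- `∂ (1 - ∂²)⁻¹` on `L²`. -/
def opDG : L2 →L[ℂ] L2 := opRm - opG

theorem opG_apply (h : L2) : opG h = opR (opRm h) := rfl

theorem opDG_apply (h : L2) : opDG h = opRm h - opG h := rfl

theorem hasWeakDeriv_opG (h : L2) : HasWeakDeriv (opG h : ℝ → C2) (opDG h : ℝ → C2) :=
  hasWeakDeriv_opR (opRm h)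

theorem hasWeakDeriv_opDG (h : L2) : HasWeakDeriv (opDG h : ℝ → C2) ((opG h - h : L2) : ℝ → C2) := by
  have h1 := (hasWeakDeriv_opRm h).sub (hasWeakDeriv_opR (opRm h))
  refine h1.congr (Lp.coeFn_sub _ _).symm ?_
  filter_upwards [Lp.coeFn_sub (opRm h) h, Lp.coeFn_sub (opRm h) (opR (opRm h)),
    Lp.coeFn_sub (opG h) h] with x h1 h2 h3
  rw [h3, Pi.sub_apply, h1, h2, Pi.sub_apply, Pi.sub_apply, Pi.sub_apply, opG_apply]
  abel

theorem memH2_opG (h : L2) : MemH2 (opG h : ℝ → C2) :=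
  ⟨Lp.memLp _, _, _, hasWeakDeriv_opG h, hasWeakDeriv_opDG h, Lp.memLp _, Lp.memLp _⟩

/-- Factor 1 - ∂² = (1 - ∂)(1 + ∂) with the intermediate function k = y + y'. This shows that `opG`
maps onto H². -/
theorem eq_opG_of_hasWeakDeriv {y y₁ y₂ : L2} (h : HasWeakDeriv (y : ℝ → C2) y₁)
    (h' : HasWeakDeriv (y₁ : ℝ → C2) y₂) : opG (y - y₂) = y := by
  have e1 := eq_opR_of_hasWeakDeriv h
  have h2 : HasWeakDeriv ((y + y₁ : L2) : ℝ → C2) ((y₁ + y₂ : L2) : ℝ → C2) :=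
    (h.add h').congr (Lp.coeFn_add _ _).symm (Lp.coeFn_add _ _).symm
  have e2 := eq_opR_of_hasWeakDeriv h2
  obtain ⟨k, hk⟩ : ∃ k, k = y + y₁ := ⟨_, rfl⟩
  rw [← hk] at e1 e2
  have e3 : opRm (y - y₂) = k := by
    -- With k' = y₁ + y₂ and X = k + k' one has k = `opR X`, and partial fractions give 2 `opRm k` =
    -- k + `opRm X`. Since k - k' = 2k - X, the claim follows.
    have e4 : y - y₂ = k - (y₁ + y₂) := by rw [hk]; abel
    have e6 := opRm_opR (k + (y₁ + y₂))
    rw [← e2] at e6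
    have : opRm (k - (y₁ + y₂)) = (2 : ℂ) • opRm k - opRm (k + (y₁ + y₂)) := by
      rw [two_smul, map_sub, map_add opRm k]; abel
    rw [e4, this, e6]
    abel
  rw [opG_apply, e3, ← e1]

theorem exists_opG_eq_of_memH2 {y : L2} (h : MemH2 (y : ℝ → C2)) : ∃ k, opG k = y := by
  obtain ⟨-, y1, y2, a, b, m1, m2⟩ := h
  have a' : HasWeakDeriv (y : ℝ → C2) (m1.toLp y1) :=
    a.congr (ae_eq_refl _) (MemLp.coeFn_toLp m1).symm
  have b' : HasWeakDeriv (m1.toLp y1 : ℝ → C2) (m2.toLp y2) :=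
    b.congr (MemLp.coeFn_toLp m1).symm (MemLp.coeFn_toLp m2).symm
  exact ⟨_, eq_opG_of_hasWeakDeriv a' b'⟩

/-- If G h = 0, then both weak derivatives of G h vanish, and h = G h - (G h)''. -/
theorem opG_injective : Function.Injective opG := by
  rw [injective_iff_map_eq_zero]
  intro h hh
  have h0 : HasWeakDeriv (opG h : ℝ → C2) ((0 : L2) : ℝ → C2) := by
    rw [hh]
    exact HasWeakDeriv.zero.congr (Lp.coeFn_zero _ _ _).symm (Lp.coeFn_zero _ _ _).symm
  have h1 : opDG h = 0 := Lp.ext ((hasWeakDeriv_opG h).ae_unique h0)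
  have h2 : HasWeakDeriv (opDG h : ℝ → C2) ((0 : L2) : ℝ → C2) := by
    rw [h1]
    exact HasWeakDeriv.zero.congr (Lp.coeFn_zero _ _ _).symm (Lp.coeFn_zero _ _ _).symm
  have h3 : opG h - h = 0 := Lp.ext ((hasWeakDeriv_opDG h).ae_unique h2)
  rw [hh, zero_sub, neg_eq_zero] at h3
  exact h3

theorem inner_opG (k h : L2) : inner ℂ k (opG h) = inner ℂ (opG k) h := by
  rw [opG_apply, inner_opR, inner_opRm, opG_apply]

/-- `opR` and `opRm` are mutually adjoint, so G has the form R*R. This gives positivity of G and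
later the sign in the resolvent estimate. -/
theorem inner_opG_eq (k h : L2) : inner ℂ k (opG h) = inner ℂ (opRm k) (opRm h) := by
  rw [opG_apply, inner_opR]

/-! ### Continuous representatives -/

theorem norm_expInt_le (h : L2) (x : ℝ) : ‖expInt (h : ℝ → C2) x‖ ≤ ‖h‖ := by
  have := enorm_expInt_le_eLpNorm (Lp.aestronglyMeasurable h) x
  rw [Lp.norm_def, ← toReal_enorm]
  exact ENNReal.toReal_mono (Lp.eLpNorm_ne_top h) this

/-- The continuous representative of `opR h`. -/
def evR : L2 →L[ℂ] BoundedContinuousFunction ℝ C2 :=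
  LinearMap.mkContinuous
    { toFun := fun h => BoundedContinuousFunction.ofNormedAddCommGroup (expInt (h : ℝ → C2))
        (continuous_expInt (Lp.memLp h)) ‖h‖ (norm_expInt_le h)
      map_add' := fun h k => by
        ext1 x
        exact congrFun ((expInt_congr (Lp.coeFn_add h k)).trans
          (expInt_add (Lp.memLp h) (Lp.memLp k))) x
      map_smul' := fun c h => by
        ext1 x
        exact congrFun ((expInt_congr (Lp.coeFn_smul c h)).trans (expInt_const_smul c h)) x } 1 fun h => by
    rw [one_mul]
    exact BoundedContinuousFunction.norm_ofNormedAddCommGroup_le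
      (hfc := continuous_expInt (Lp.memLp h)) (norm_nonneg _) (norm_expInt_le h)

theorem evR_apply (h : L2) (x : ℝ) : evR h x = expInt (h : ℝ → C2) x := rfl

/-- Reflection of bounded continuous functions. -/
def reflB (E : Type*) [NormedAddCommGroup E] [NormedSpace ℂ E] :
    BoundedContinuousFunction ℝ E →L[ℂ] BoundedContinuousFunction ℝ E :=
  LinearMap.mkContinuous
    { toFun := fun k => k.compContinuous ⟨fun x => -x, continuous_neg⟩
      map_add' := fun _ _ => rfl
      map_smul' := fun _ _ => rfl } 1 fun k => by
    rw [one_mul]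
    exact (BoundedContinuousFunction.norm_le (norm_nonneg k)).2 fun x => k.norm_coe_le_norm _

@[simp] theorem reflB_apply {E : Type*} [NormedAddCommGroup E] [NormedSpace ℂ E]
    (k : BoundedContinuousFunction ℝ E) (x : ℝ) : reflB E k x = k (-x) := rfl

/-- The continuous representative of `opRm h`. -/
def evRm : L2 →L[ℂ] BoundedContinuousFunction ℝ C2 := reflB C2 ∘L evR ∘L reflL

theorem evRm_apply (h : L2) (x : ℝ) : evRm h x = expIntR (h : ℝ → C2) x := by
  simp only [evRm, ContinuousLinearMap.comp_apply, reflB_apply, evR_apply,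
    expInt_congr (coeFn_reflL h)]
  rfl

/-- The continuous representative of `opG h`. -/
def evG : L2 →L[ℂ] BoundedContinuousFunction ℝ C2 := evR ∘L opRm

/-- The continuous representative of `opDG h`. -/
def evDG : L2 →L[ℂ] BoundedContinuousFunction ℝ C2 := evRm - evG

theorem evDG_apply (h : L2) (x : ℝ) : evDG h x = evRm h x - evG h x := rfl

theorem evG_apply (h : L2) (x : ℝ) : evG h x = expInt (expIntR (h : ℝ → C2)) x := by
  simp only [evG, ContinuousLinearMap.comp_apply, evR_apply, expInt_congr (coeFn_opRm h)]

theorem coeFn_opG (h : L2) : (opG h : ℝ → C2) =ᵐ[volume] evG h := coeFn_opR (opRm h)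

theorem coeFn_opDG (h : L2) : (opDG h : ℝ → C2) =ᵐ[volume] evDG h := by
  filter_upwards [Lp.coeFn_sub (opRm h) (opG h), coeFn_opRm h, coeFn_opG h] with x h1 h2 h3
  rw [opDG_apply, h1, Pi.sub_apply, h2, h3, evDG_apply, evRm_apply]

theorem hasDerivAt_evG (h : L2) (x : ℝ) : HasDerivAt (evG h) (evDG h x) x := by
  have := hasDerivAt_expInt (memLp_expIntR (Lp.memLp h)) (continuous_expIntR (Lp.memLp h)) x
  have e : (evG h : ℝ → C2) = expInt (expIntR (h : ℝ → C2)) := funext fun x => evG_apply h x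
  rw [evDG_apply, e, evRm_apply]
  exact this

/-- A continuous representative of h upgrades the second weak derivative G h - h to a classical one.
-/
theorem hasDerivAt_evDG {h : L2} {c : ℝ → C2} (hc : Continuous c)
    (e : (h : ℝ → C2) =ᵐ[volume] c) (x : ℝ) : HasDerivAt (evDG h) (evG h x - c x) x := by
  have hm : MemLp c 2 volume := (memLp_congr_ae e).1 (Lp.memLp h)
  have e1 : (evRm h : ℝ → C2) = expIntR c := funext fun x => by
    rw [evRm_apply, expIntR_congr e]
  have d1 : HasDerivAt (evRm h) (evRm h x - c x) x := by
    rw [e1]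
    exact hasDerivAt_expIntR hm hc x
  refine (d1.sub (hasDerivAt_evG h x)).congr_deriv ?_
  rw [evDG_apply]
  abel


/-! ### Resolvent operators on bounded continuous functions -/

section BoundedResolvent

open scoped BoundedContinuousFunction

variable {E : Type*} [NormedAddCommGroup E] [NormedSpace ℂ E]

theorem norm_cexp_mul_smul (μ : ℂ) (s : ℝ) (v : E) :
    ‖Complex.exp (μ * s) • v‖ = Real.exp (μ.re * s) * ‖v‖ := by
  rw [norm_smul, Complex.norm_exp]
  simp

theorem integrableOn_exp_mul_sub_Iic {r : ℝ} (hr : 0 < r) (x : ℝ) :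
    IntegrableOn (fun t => Real.exp (r * (t - x))) (Iic x) := by
  simp only [sub_eq_add_neg, mul_add, Real.exp_add]
  exact (integrableOn_exp_mul_Iic hr x).mul_const _

theorem integral_exp_mul_sub_Iic {r : ℝ} (hr : 0 < r) (x : ℝ) :
    ∫ t in Iic x, Real.exp (r * (t - x)) = 1 / r := by
  simp only [sub_eq_add_neg, mul_add, Real.exp_add]
  rw [integral_mul_const, integral_exp_mul_Iic hr, div_mul_eq_mul_div, ← Real.exp_add]
  simp

theorem integrableOn_cexp_smul {μ : ℂ} (hμ : 0 < μ.re) (h : ℝ →ᵇ E) (x : ℝ) :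
    IntegrableOn (fun t : ℝ => Complex.exp (μ * (t - x : ℝ)) • h t) (Iic x) := by
  refine Integrable.mono' ((integrableOn_exp_mul_sub_Iic hμ x).mul_const ‖h‖) ?_ ?_
  · exact ((by fun_prop : Continuous fun t : ℝ => Complex.exp (μ * (t - x : ℝ))).smul
      h.continuous).aestronglyMeasurable
  · refine ae_of_all _ fun t => ?_
    rw [norm_cexp_mul_smul]
    gcongr
    exact h.norm_coe_le_norm t

/-- The bounded solution of `y' + μ y = h`. -/
def cexpInt (μ : ℂ) (h : ℝ →ᵇ E) (x : ℝ) : E :=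
  ∫ t in Iic x, Complex.exp (μ * (t - x : ℝ)) • h t

theorem norm_cexpInt_le {μ : ℂ} (hμ : 0 < μ.re) (h : ℝ →ᵇ E) (x : ℝ) :
    ‖cexpInt μ h x‖ ≤ 1 / μ.re * ‖h‖ := by
  rw [← integral_exp_mul_sub_Iic hμ x, ← integral_mul_const]
  refine norm_integral_le_of_norm_le ((integrableOn_exp_mul_sub_Iic hμ x).mul_const ‖h‖)
    (ae_of_all _ fun t => ?_)
  rw [norm_cexp_mul_smul]
  gcongr
  exact h.norm_coe_le_norm t

variable [CompleteSpace E]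

theorem hasDerivAt_cexpInt {μ : ℂ} (hμ : 0 < μ.re) (h : ℝ →ᵇ E) (x : ℝ) :
    HasDerivAt (cexpInt μ h) (h x - μ • cexpInt μ h x) x := by
  have e : ∀ x : ℝ, cexpInt μ h x
      = Complex.exp (-(μ * x)) • ∫ t in Iic x, Complex.exp (μ * t) • h t := fun x => by
    rw [cexpInt, ← integral_smul]
    refine integral_congr_ae (ae_of_all _ fun t => ?_)
    simp only [smul_smul, ← Complex.exp_add]
    congr 2
    push_cast
    ring
  have hi : ∀ x : ℝ, IntegrableOn (fun t : ℝ => Complex.exp (μ * t) • h t) (Iic x) := fun x => by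
    refine ((integrableOn_cexp_smul hμ h x).smul (Complex.exp (μ * x))).congr
      (ae_of_all _ fun t => ?_)
    simp only [Pi.smul_apply, smul_smul, ← Complex.exp_add]
    congr 2
    push_cast
    ring
  have d1 := hasDerivAt_integral_Iic hi
    ((by fun_prop : Continuous fun t : ℝ => Complex.exp (μ * t)).smul h.continuous) x
  have d2 : HasDerivAt (fun x : ℝ => Complex.exp (-(μ * x))) (Complex.exp (-(μ * x)) * -μ) x := by
    have : HasDerivAt (fun x : ℝ => -(μ * (x : ℂ))) (-μ) x := by
      simpa using ((Complex.ofRealCLM.hasDerivAt (x := x)).const_mul μ).fun_neg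
    exact this.cexp
  rw [e x, show cexpInt μ h = _ from funext e]
  refine (d2.smul d1).congr_deriv ?_
  simp only [smul_smul, ← Complex.exp_add]
  simp only [neg_add_cancel, Complex.exp_zero, one_smul, sub_eq_add_neg]
  rw [← neg_smul]
  congr 2
  ring

theorem continuous_cexpInt {μ : ℂ} (hμ : 0 < μ.re) (h : ℝ →ᵇ E) : Continuous (cexpInt μ h) :=
  continuous_iff_continuousAt.2 fun x => (hasDerivAt_cexpInt hμ h x).continuousAt

/-- `(μ + ∂)⁻¹` on bounded continuous functions. -/
def bdR (E : Type*) [NormedAddCommGroup E] [NormedSpace ℂ E] [CompleteSpace E] {μ : ℂ}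
    (hμ : 0 < μ.re) : (ℝ →ᵇ E) →L[ℂ] (ℝ →ᵇ E) :=
  LinearMap.mkContinuous
    { toFun := fun h => BoundedContinuousFunction.ofNormedAddCommGroup (cexpInt μ h) (continuous_cexpInt hμ h)
        (1 / μ.re * ‖h‖) (norm_cexpInt_le hμ h)
      map_add' := fun h k => by
        ext1 x
        change cexpInt μ (h + k) x = cexpInt μ h x + cexpInt μ k x
        simp only [cexpInt, BoundedContinuousFunction.add_apply, smul_add]
        exact integral_add (integrableOn_cexp_smul hμ h x) (integrableOn_cexp_smul hμ k x)
      map_smul' := fun c h => by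
        ext1 x
        change cexpInt μ (c • h) x = c • cexpInt μ h x
        simp only [cexpInt, BoundedContinuousFunction.smul_apply, smul_comm _ c]
        exact integral_smul c _ } (1 / μ.re) fun h =>
    BoundedContinuousFunction.norm_ofNormedAddCommGroup_le (continuous_cexpInt hμ h) (by positivity) (norm_cexpInt_le hμ h)

theorem hasDerivAt_bdR {μ : ℂ} (hμ : 0 < μ.re) (h : ℝ →ᵇ E) (x : ℝ) :
    HasDerivAt (bdR E hμ h) (h x - μ • bdR E hμ h x) x := hasDerivAt_cexpInt hμ h x

/-- `(μ - ∂)⁻¹` on bounded continuous functions. -/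
def bdRm (E : Type*) [NormedAddCommGroup E] [NormedSpace ℂ E] [CompleteSpace E] {μ : ℂ}
    (hμ : 0 < μ.re) : (ℝ →ᵇ E) →L[ℂ] (ℝ →ᵇ E) := reflB E ∘L bdR E hμ ∘L reflB E

theorem hasDerivAt_bdRm {μ : ℂ} (hμ : 0 < μ.re) (h : ℝ →ᵇ E) (x : ℝ) :
    HasDerivAt (bdRm E hμ h) (μ • bdRm E hμ h x - h x) x := by
  have := (hasDerivAt_bdR hμ (reflB E h) (-x)).scomp x (hasDerivAt_neg x)
  refine this.congr_deriv ?_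
  simp [bdRm]

/-- `(μ² - ∂²)⁻¹` on bounded continuous functions. -/
def bdG (E : Type*) [NormedAddCommGroup E] [NormedSpace ℂ E] [CompleteSpace E] {μ : ℂ}
    (hμ : 0 < μ.re) : (ℝ →ᵇ E) →L[ℂ] (ℝ →ᵇ E) := (2 * μ)⁻¹ • (bdR E hμ + bdRm E hμ)

/-- `∂ (μ² - ∂²)⁻¹` on bounded continuous functions. -/
def bdDG (E : Type*) [NormedAddCommGroup E] [NormedSpace ℂ E] [CompleteSpace E] {μ : ℂ}
    (hμ : 0 < μ.re) : (ℝ →ᵇ E) →L[ℂ] (ℝ →ᵇ E) := (2 : ℂ)⁻¹ • (bdRm E hμ - bdR E hμ)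

theorem ne_zero_of_re_pos {μ : ℂ} (hμ : 0 < μ.re) : μ ≠ 0 := by
  rintro rfl
  simp at hμ

theorem hasDerivAt_bdG {μ : ℂ} (hμ : 0 < μ.re) (h : ℝ →ᵇ E) (x : ℝ) :
    HasDerivAt (bdG E hμ h) (bdDG E hμ h x) x := by
  have h0 := ne_zero_of_re_pos hμ
  refine (((hasDerivAt_bdR hμ h x).add (hasDerivAt_bdRm hμ h x)).const_smul
    ((2 * μ)⁻¹)).congr_deriv ?_
  change _ = (2 : ℂ)⁻¹ • (bdRm E hμ h x - bdR E hμ h x)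
  match_scalars <;> field_simp
  ring

theorem hasDerivAt_bdDG {μ : ℂ} (hμ : 0 < μ.re) (h : ℝ →ᵇ E) (x : ℝ) :
    HasDerivAt (bdDG E hμ h) (μ ^ 2 • bdG E hμ h x - h x) x := by
  have h0 := ne_zero_of_re_pos hμ
  refine (((hasDerivAt_bdRm hμ h x).sub (hasDerivAt_bdR hμ h x)).const_smul
    ((2 : ℂ)⁻¹)).congr_deriv ?_
  change _ = μ ^ 2 • ((2 * μ)⁻¹ • (bdR E hμ h x + bdRm E hμ h x)) - h x
  match_scalars <;> field_simp
  norm_num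

-- The equation forces w(x) = e^{-νt} w(x + t). With t = s / Re ν the factor has modulus e⁻ˢ, so
-- boundedness and s → ∞ give w = 0.
omit [CompleteSpace E] in
theorem eq_zero_of_bounded_of_hasDerivAt {ν : ℂ} (hν : ν.re ≠ 0) (w : ℝ →ᵇ E)
    (hw : ∀ x, HasDerivAt w (ν • w x) x) : w = 0 := by
  have hconst : ∀ x : ℝ, HasDerivAt (fun x : ℝ => Complex.exp (-(ν * x)) • w x) 0 x := fun x => by
    have : HasDerivAt (fun x : ℝ => -(ν * (x : ℂ))) (-ν) x := by
      simpa using ((Complex.ofRealCLM.hasDerivAt (x := x)).const_mul ν).fun_neg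
    refine (this.cexp.smul (hw x)).congr_deriv ?_
    module
  have h1 : ∀ x y : ℝ, Complex.exp (-(ν * x)) • w x = Complex.exp (-(ν * y)) • w y :=
    is_const_of_deriv_eq_zero (fun x => (hconst x).differentiableAt) fun x => (hconst x).deriv
  ext1 x
  have h2 : ∀ s : ℝ, ‖w x‖ ≤ Real.exp (-s) * ‖w‖ := fun s => by
    have := h1 x (x + s / ν.re)
    have h3 : w x = Complex.exp (-ν * (s / ν.re : ℝ)) • w (x + s / ν.re) := by
      have h4 := congrArg (fun v => Complex.exp (ν * x) • v) this
      simp only [smul_smul, ← Complex.exp_add] at h4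
      rw [add_neg_cancel, Complex.exp_zero, one_smul] at h4
      rw [h4]
      congr 2
      push_cast
      ring
    rw [h3, norm_cexp_mul_smul]
    have h5 : (-ν).re * (s / ν.re) = -s := by
      rw [Complex.neg_re]
      field_simp
    rw [h5]
    gcongr
    exact w.norm_coe_le_norm _
  have h6 : Tendsto (fun s : ℝ => Real.exp (-s) * ‖w‖) atTop (𝓝 0) := by
    simpa using (Real.tendsto_exp_neg_atTop_nhds_zero).mul_const ‖w‖
  have h7 := ge_of_tendsto' h6 h2
  exact norm_le_zero_iff.1 h7

/-- The difference z satisfies z'' = μ²z. The combination z' + μz is a bounded solution of w' = μw,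
hence zero, and then z' = -μz forces z = 0. This uniqueness yields the resolvent identity and all
symmetries on bounded functions. -/
theorem eq_bdG {μ : ℂ} (hμ : 0 < μ.re) {h y y' : ℝ →ᵇ E} (hy : ∀ x, HasDerivAt y (y' x) x)
    (hy' : ∀ x, HasDerivAt y' (μ ^ 2 • y x - h x) x) : y = bdG E hμ h := by
  set z := y - bdG E hμ h with hz
  set z' := y' - bdDG E hμ h with hz'
  have d1 : ∀ x, HasDerivAt z (z' x) x := fun x => (hy x).sub (hasDerivAt_bdG hμ h x)
  have d2 : ∀ x, HasDerivAt z' (μ ^ 2 • z x) x := fun x => by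
    refine ((hy' x).sub (hasDerivAt_bdDG hμ h x)).congr_deriv ?_
    rw [hz, BoundedContinuousFunction.sub_apply, smul_sub]
    abel
  have w1 : z' + μ • z = 0 := by
    refine eq_zero_of_bounded_of_hasDerivAt (ν := μ) hμ.ne' _ fun x => ?_
    refine ((d2 x).add ((d1 x).const_smul μ)).congr_deriv ?_
    simp only [BoundedContinuousFunction.add_apply, BoundedContinuousFunction.smul_apply]
    module
  have w2 : z = 0 := by
    refine eq_zero_of_bounded_of_hasDerivAt (ν := -μ) (by simpa using hμ.ne') _ fun x => ?_
    refine (d1 x).congr_deriv ?_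
    have := congrArg (fun k : ℝ →ᵇ E => k x) w1
    simp only [BoundedContinuousFunction.add_apply, BoundedContinuousFunction.smul_apply,
      BoundedContinuousFunction.coe_zero, Pi.zero_apply] at this
    rw [neg_smul]
    exact eq_neg_of_add_eq_zero_left this
  exact sub_eq_zero.1 w2

theorem bdG_sub_bdG {μ ν : ℂ} (hμ : 0 < μ.re) (hν : 0 < ν.re) (h : ℝ →ᵇ E) :
    bdG E hμ h - bdG E hν h = (ν ^ 2 - μ ^ 2) • bdG E hμ (bdG E hν h) := by
  rw [← map_smul]
  refine eq_bdG hμ (y' := bdDG E hμ h - bdDG E hν h)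
    (fun x => (hasDerivAt_bdG hμ h x).sub (hasDerivAt_bdG hν h x)) fun x => ?_
  refine ((hasDerivAt_bdDG hμ h x).sub (hasDerivAt_bdDG hν h x)).congr_deriv ?_
  simp only [BoundedContinuousFunction.sub_apply, BoundedContinuousFunction.smul_apply]
  module

theorem re_exp_half_log_pos {s : ℂ} (hs : s ∈ Complex.slitPlane) :
    0 < (Complex.exp (Complex.log s / 2)).re := by
  rw [Complex.exp_re]
  refine mul_pos (Real.exp_pos _) (Real.cos_pos_of_mem_Ioo ?_)
  have h1 := Complex.neg_pi_lt_arg s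
  have h2 := Complex.arg_le_pi s
  have h3 := (Complex.mem_slitPlane_iff_arg.1 hs).1
  have h4 : s.arg < Real.pi := lt_of_le_of_ne h2 h3
  have h5 : (Complex.log s / 2).im = s.arg / 2 := by
    rw [show Complex.log s / 2 = Complex.log s / (2 : ℝ) by norm_num, Complex.div_ofReal_im,
      Complex.log_im]
  rw [h5]
  constructor <;> linarith

theorem one_re_pos : 0 < (1 : ℂ).re := by simp

/-- On bounded functions no self-adjointness is at hand, so t - G is inverted explicitly: with μ² =
1 - 1/t its inverse is t⁻¹(1 + (1 - μ²)(μ² - ∂²)⁻¹). A root with Re μ > 0 exists unless 1 - 1/t ∈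
(-∞, 0], that is, unless t ∈ (0, 1]. -/
theorem spectrum_bdG_subset :
    spectrum ℂ (bdG E one_re_pos) ⊆ (fun r : ℝ => (r : ℂ)) '' Icc 0 1 := by
  intro t ht
  by_contra hnot
  refine ht ?_
  have h0 : t ≠ 0 := by
    rintro rfl
    exact hnot ⟨0, by simp, by simp⟩
  set s : ℂ := 1 - t⁻¹ with hs
  have hslit : s ∈ Complex.slitPlane := by
    rw [Complex.mem_slitPlane_iff]
    by_contra! hc
    have hst : t⁻¹ = ((1 - s.re : ℝ) : ℂ) := by
      apply Complex.ext
      · simp [hs]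
      · have := hc.2
        simp only [hs, Complex.sub_im, Complex.one_im, zero_sub, neg_eq_zero] at this
        simpa using this
    have hts : t = (((1 - s.re)⁻¹ : ℝ) : ℂ) := by
      rw [Complex.ofReal_inv, ← hst, inv_inv]
    have : (1 : ℝ) ≤ 1 - s.re := by linarith [hc.1]
    exact hnot ⟨(1 - s.re)⁻¹, ⟨by positivity, inv_le_one_of_one_le₀ this⟩, hts.symm⟩
  have hμ := re_exp_half_log_pos hslit
  set μ := Complex.exp (Complex.log s / 2) with hμdef
  have hμ2 : μ ^ 2 = s := by
    rw [hμdef, ← Complex.exp_nat_mul]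
    rw [show ((2 : ℕ) : ℂ) * (Complex.log s / 2) = Complex.log s by push_cast; ring]
    exact Complex.exp_log (Complex.slitPlane_ne_zero hslit)
  have hts : t * (1 - μ ^ 2) = 1 := by
    rw [hμ2, hs]
    field_simp
    ring
  have r1 : bdG E one_re_pos - bdG E hμ = (μ ^ 2 - 1) • (bdG E one_re_pos * bdG E hμ) := by
    ext1 h
    simpa using bdG_sub_bdG one_re_pos hμ h
  have r2 : bdG E hμ - bdG E one_re_pos = (1 - μ ^ 2) • (bdG E hμ * bdG E one_re_pos) := by
    ext1 h
    simpa using bdG_sub_bdG hμ one_re_pos h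
  have hcomm : bdG E hμ * bdG E one_re_pos = bdG E one_re_pos * bdG E hμ := by
    by_cases h1 : 1 - μ ^ 2 = 0
    · rw [h1, mul_zero] at hts
      exact absurd hts zero_ne_one
    · refine smul_right_injective _ h1 ?_
      simp only
      rw [← r2, ← neg_sub, r1]
      module
  set G := bdG E one_re_pos
  set K := bdG E hμ
  have hA : (algebraMap ℂ ((ℝ →ᵇ E) →L[ℂ] (ℝ →ᵇ E)) t - G) * (t⁻¹ • (1 + (1 - μ ^ 2) • K)) = 1 := by
    have e1 : (1 - μ ^ 2) • (G * K) = K - G := by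
      rw [← hcomm, ← r2]
    rw [mul_smul_comm, sub_mul, mul_add, mul_add, Algebra.algebraMap_eq_smul_one, mul_one, mul_one,
      mul_smul_comm, mul_smul_comm, e1, smul_mul_assoc, one_mul, smul_smul, mul_comm _ t, hts,
      one_smul]
    rw [add_sub_cancel, add_sub_cancel_right, smul_smul, inv_mul_cancel₀ h0, one_smul]
  have hB : (t⁻¹ • (1 + (1 - μ ^ 2) • K)) * (algebraMap ℂ ((ℝ →ᵇ E) →L[ℂ] (ℝ →ᵇ E)) t - G) = 1 := by
    have hc : Commute (t⁻¹ • (1 + (1 - μ ^ 2) • K)) (algebraMap ℂ ((ℝ →ᵇ E) →L[ℂ] (ℝ →ᵇ E)) t - G) := by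
      refine Commute.smul_left ?_ _
      refine Commute.sub_right (Algebra.commutes t _).symm ?_
      exact Commute.add_left (Commute.one_left G) (Commute.smul_left hcomm _)
    rw [hc.eq, hA]
  exact ⟨⟨_, _, hA, hB⟩, rfl⟩

end BoundedResolvent

/-! ### Spectrum of the second-order resolvent on L² -/

theorem norm_opR_le (h : L2) : ‖opR h‖ ≤ ‖h‖ := by
  exact norm_toLp_expInt_le h

theorem norm_opRm_le (h : L2) : ‖opRm h‖ ≤ ‖h‖ := by
  rw [opRm_apply]
  have : ∀ k, ‖reflL k‖ = ‖k‖ := fun k => (Lp.compMeasurePreservingₗᵢ ℂ (fun x : ℝ => -x)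
    (Measure.measurePreserving_neg volume)).norm_map k
  rw [this]
  exact (norm_opR_le _).trans (this h).le

theorem norm_opG_le (h : L2) : ‖opG h‖ ≤ ‖h‖ := (norm_opR_le _).trans (norm_opRm_le h)

theorem isSelfAdjoint_opG : IsSelfAdjoint opG := by
  rw [ContinuousLinearMap.isSelfAdjoint_iff_isSymmetric]
  exact fun x y => (inner_opG x y).symm

-- `opG` is a positive self-adjoint contraction.
open scoped ComplexOrder in
theorem spectrum_opG_subset : spectrum ℂ opG ⊆ (fun r : ℝ => (r : ℂ)) '' Icc 0 1 := by
  have hpos : 0 ≤ opG := by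
    rw [ContinuousLinearMap.nonneg_iff_isPositive]
    refine ⟨isSelfAdjoint_opG.isSymmetric, fun x => ?_⟩
    rw [ContinuousLinearMap.reApplyInnerSelf_apply]
    have : inner ℂ (opG x) x = inner ℂ (opRm x) (opRm x) := by
      rw [← inner_opG, inner_opG_eq]
    rw [this]
    exact inner_self_nonneg
  intro t ht
  have h1 : t = t.re := isSelfAdjoint_opG.mem_spectrum_eq_re ht
  have h2 : 0 ≤ t := spectrum_nonneg_of_nonneg hpos ht
  have h3 : ‖t‖ ≤ ‖opG‖ * ‖(1 : L2 →L[ℂ] L2)‖ :=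
    spectrum.norm_le_norm_mul_of_mem ht
  have h4 : ‖opG‖ ≤ 1 := ContinuousLinearMap.opNorm_le_bound _ zero_le_one fun x => by
    simpa using norm_opG_le x
  refine ⟨t.re, ⟨(Complex.nonneg_iff.1 h2).1, ?_⟩, h1.symm⟩
  exact (Complex.re_le_norm t).trans (h3.trans (mul_le_one₀ h4 (norm_nonneg _)
    ContinuousLinearMap.norm_id_le))

/-! ### Matrix symbols -/

section Symbol

variable {𝒜 : Type*} [Ring 𝒜] [Algebra ℂ 𝒜]

/-- Spectral mapping: zero would have to be the value of p at a spectral point of G. Constant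
polynomials are treated apart because the mapping theorem invoked asks for positive degree. -/
theorem isUnit_aeval_of_spectrum_subset {G : 𝒜} {s : Set ℂ} (hG : spectrum ℂ G ⊆ s)
    {p : Polynomial ℂ} (hp : ∀ t ∈ s, p.eval t ≠ 0) (hp0 : p ≠ 0) :
    IsUnit (Polynomial.aeval G p) := by
  by_cases hd : 0 < p.degree
  · by_contra hn
    have h0 : (0 : ℂ) ∈ spectrum ℂ (Polynomial.aeval G p) := spectrum.zero_mem ℂ hn
    rw [spectrum.map_polynomial_aeval_of_degree_pos G p hd] at h0
    obtain ⟨t, ht, hte⟩ := h0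
    exact hp t (hG ht) hte
  · rw [Polynomial.eq_C_of_degree_le_zero (not_lt.1 hd)] at hp0 ⊢
    rw [Polynomial.aeval_C]
    refine IsUnit.map _ (isUnit_iff_ne_zero.2 fun h => hp0 ?_)
    rw [h, Polynomial.C_0]

/-- Matrices commute with G, so multiplying by the adjugate pencil on either side gives the scalar
polynomial t ↦ det(A₀ + tA₁) evaluated at G. Working in an abstract algebra serves L² and bounded
continuous functions at once. -/
theorem isUnit_symbol {G : 𝒜} (hG : spectrum ℂ G ⊆ (fun r : ℝ => (r : ℂ)) '' Icc 0 1)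
    (ι : Matrix (Fin 2) (Fin 2) ℂ →ₐ[ℂ] 𝒜) (hι : ∀ M, Commute (ι M) G)
    (A₀ A₁ : Matrix (Fin 2) (Fin 2) ℂ)
    (hdet : ∀ t : ℝ, t ∈ Icc (0 : ℝ) 1 → (A₀ + (t : ℂ) • A₁).det ≠ 0) :
    IsUnit (ι A₀ + ι A₁ * G) := by
  -- The coefficient of t in det(A₀ + tA₁), which is also the scalar in A₀ adj A₁ + A₁ adj A₀.
  set b : ℂ := A₀ 0 0 * A₁ 1 1 + A₁ 0 0 * A₀ 1 1 - A₀ 0 1 * A₁ 1 0 - A₁ 0 1 * A₀ 1 0 with hb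
  set p : Polynomial ℂ := Polynomial.C A₀.det + Polynomial.C b * Polynomial.X
    + Polynomial.C A₁.det * Polynomial.X ^ 2 with hp
  have hev : ∀ t : ℂ, p.eval t = (A₀ + t • A₁).det := fun t => by
    simp [hp, hb, Matrix.det_fin_two]
    ring
  have hu : IsUnit (Polynomial.aeval G p) := by
    refine isUnit_aeval_of_spectrum_subset hG ?_ ?_
    · rintro _ ⟨t, ht, rfl⟩
      rw [hev]
      exact hdet t ht
    · intro h
      have := hdet 0 (by simp)
      rw [← hev, h] at this
      simp at this
  have haev : Polynomial.aeval G p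
      = algebraMap ℂ 𝒜 A₀.det + b • G + A₁.det • (G * G) := by
    simp [hp, Algebra.smul_def, pow_two]
  have key : ∀ X₀ X₁ Y₀ Y₁ : Matrix (Fin 2) (Fin 2) ℂ, (ι X₀ + ι X₁ * G) * (ι Y₀ + ι Y₁ * G)
      = ι (X₀ * Y₀) + ι (X₀ * Y₁ + X₁ * Y₀) * G + ι (X₁ * Y₁) * (G * G) := by
    intro X₀ X₁ Y₀ Y₁
    have c0 := (hι Y₀).eq
    have c1 := (hι Y₁).eq
    simp only [map_add, map_mul, mul_add, add_mul, mul_assoc]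
    rw [← c0, ← mul_assoc G, ← c1]
    simp only [mul_assoc]
    abel
  have hs : ∀ c : ℂ, ι (c • 1) = algebraMap ℂ 𝒜 c := fun c => by
    rw [map_smul, map_one, Algebra.algebraMap_eq_smul_one]
  have e1 : (ι A₀ + ι A₁ * G) * (ι A₀.adjugate + ι A₁.adjugate * G) = Polynomial.aeval G p := by
    rw [key, Matrix.mul_adjugate, Matrix.mul_adjugate, haev]
    have : A₀ * A₁.adjugate + A₁ * A₀.adjugate = b • 1 := by
      ext i j
      fin_cases i <;> fin_cases j <;>
        simp [Matrix.adjugate_fin_two, Matrix.mul_apply, Fin.sum_univ_two] <;> (try rw [hb]) <;> ring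
    rw [this, hs, hs, hs, Algebra.smul_def, Algebra.smul_def]
  have e2 : (ι A₀.adjugate + ι A₁.adjugate * G) * (ι A₀ + ι A₁ * G) = Polynomial.aeval G p := by
    rw [key, Matrix.adjugate_mul, Matrix.adjugate_mul, haev]
    have : A₀.adjugate * A₁ + A₁.adjugate * A₀ = b • 1 := by
      ext i j
      fin_cases i <;> fin_cases j <;>
        simp [Matrix.adjugate_fin_two, Matrix.mul_apply, Matrix.vecMul, dotProduct, Fin.sum_univ_two] <;>
        (try rw [hb]) <;> ring
    rw [this, hs, hs, hs, Algebra.smul_def, Algebra.smul_def]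
  have hc : Commute (ι A₀ + ι A₁ * G) (ι A₀.adjugate + ι A₁.adjugate * G) := e1.trans e2.symm
  exact (hc.isUnit_mul_iff.1 (e1 ▸ hu)).1

end Symbol


/-- Scalar bounded continuous coefficients. -/
abbrev B : Type := BoundedContinuousFunction ℝ ℂ

/-- Bounded continuous profiles. -/
abbrev B2 : Type := BoundedContinuousFunction ℝ C2

/-! ### Multiplication operators -/

theorem memLp_bdd_smul (c : B) (y : L2) : MemLp (fun x => c x • y x) 2 volume :=
  (Lp.memLp y).of_le_mul (c := ‖c‖)
    (c.continuous.aestronglyMeasurable.smul (Lp.aestronglyMeasurable y))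
    (ae_of_all _ fun x => by
      rw [norm_smul]
      gcongr
      exact c.norm_coe_le_norm x)

/-- Multiplication of an `L²` function by a bounded continuous function. -/
def mulL : B →L[ℂ] L2 →L[ℂ] L2 :=
  LinearMap.mkContinuous₂
    (LinearMap.mk₂ ℂ (fun (c : B) (y : L2) => (memLp_bdd_smul c y).toLp _)
      (fun c₁ c₂ y => by
        rw [← MemLp.toLp_add]
        refine MemLp.toLp_congr _ _ (ae_of_all _ fun x => ?_)
        simp [add_smul])
      (fun a c y => by
        rw [← MemLp.toLp_const_smul]
        refine MemLp.toLp_congr _ _ (ae_of_all _ fun x => ?_)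
        simp [smul_smul])
      (fun c y₁ y₂ => by
        rw [← MemLp.toLp_add]
        refine MemLp.toLp_congr _ _ ?_
        filter_upwards [Lp.coeFn_add y₁ y₂] with x hx
        rw [hx, Pi.add_apply, smul_add, Pi.add_apply])
      (fun a c y => by
        rw [← MemLp.toLp_const_smul]
        refine MemLp.toLp_congr _ _ ?_
        filter_upwards [Lp.coeFn_smul a y] with x hx
        rw [hx, Pi.smul_apply, smul_comm, Pi.smul_apply])) 1 fun c y => by
    rw [one_mul]
    refine Lp.norm_le_mul_norm_of_ae_le_mul ?_
    filter_upwards [MemLp.coeFn_toLp (memLp_bdd_smul c y)] with x hx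
    simp only [LinearMap.mk₂_apply]
    rw [hx, norm_smul]
    gcongr
    exact c.norm_coe_le_norm x

theorem coeFn_mulL (c : B) (y : L2) : (mulL c y : ℝ → C2) =ᵐ[volume] fun x => c x • y x :=
  MemLp.coeFn_toLp (memLp_bdd_smul c y)

/-- Pointwise application of an endomorphism of `ℂ²` on `L²`. -/
def pointwiseL : (C2 →L[ℂ] C2) →ₐ[ℂ] (L2 →L[ℂ] L2) :=
  AlgHom.ofLinearMap
    { toFun := fun L => L.compLpL 2 volume
      map_add' := fun L L' => ContinuousLinearMap.add_compLpL L L'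
      map_smul' := fun c L => ContinuousLinearMap.smul_compLpL c L }
    (by
      ext1 y
      refine Lp.ext ?_
      filter_upwards [ContinuousLinearMap.coeFn_compLpL (p := 2) (μ := volume)
        (1 : C2 →L[ℂ] C2) y] with x hx
      exact hx)
    (fun L L' => by
      ext1 y
      refine Lp.ext ?_
      filter_upwards [ContinuousLinearMap.coeFn_compLpL (p := 2) (μ := volume) (L * L') y,
        ContinuousLinearMap.coeFn_compLpL (p := 2) (μ := volume) L' y,
        ContinuousLinearMap.coeFn_compLpL (p := 2) (μ := volume) L (L'.compLpL 2 volume y)]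
        with x h1 h2 h3
      exact h1.trans ((congrArg L h2).symm.trans h3.symm))

/-- Constant matrices as endomorphisms of `ℂ²`. -/
def matC : Matrix (Fin 2) (Fin 2) ℂ →ₐ[ℂ] (C2 →L[ℂ] C2) :=
  ((Matrix.toEuclideanCLM (n := Fin 2) (𝕜 := ℂ)).toAlgEquiv : _ ≃ₐ[ℂ] _).toAlgHom

theorem matC_apply (A : Matrix (Fin 2) (Fin 2) ℂ) (v : C2) (i : Fin 2) :
    matC A v i = A i 0 * v 0 + A i 1 * v 1 := by
  change (Matrix.toEuclideanCLM (𝕜 := ℂ) A v) i = _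
  simp [Matrix.ofLp_toEuclideanCLM, Matrix.mulVec, dotProduct, Fin.sum_univ_two]

/-- Constant matrices acting on `L²`. -/
def matL : Matrix (Fin 2) (Fin 2) ℂ →ₐ[ℂ] (L2 →L[ℂ] L2) := pointwiseL.comp matC

theorem coeFn_matL (A : Matrix (Fin 2) (Fin 2) ℂ) (y : L2) :
    (matL A y : ℝ → C2) =ᵐ[volume] fun x => matC A (y x) :=
  ContinuousLinearMap.coeFn_compLpL _ y

/-- Pointwise application of an endomorphism of `ℂ²` on bounded continuous functions. -/
def pointwiseB : (C2 →L[ℂ] C2) →ₐ[ℂ] (B2 →L[ℂ] B2) :=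
  AlgHom.ofLinearMap
    { toFun := fun L => L.compLeftContinuousBounded ℝ
      map_add' := fun L L' => by
        ext1 y
        refine BoundedContinuousFunction.ext fun x => ?_
        exact add_apply L L' (y x)
      map_smul' := fun c L => by
        ext1 y
        refine BoundedContinuousFunction.ext fun x => ?_
        rfl }
    (by
      ext1 y
      refine BoundedContinuousFunction.ext fun x => ?_
      exact one_apply_eq_self (F := C2 →L[ℂ] C2) (y x))
    (fun L L' => by
      ext1 y
      refine BoundedContinuousFunction.ext fun x => ?_
      exact mul_apply_eq_comp L L' (y x))

/-- Constant matrices acting on bounded continuous functions. -/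
def matB : Matrix (Fin 2) (Fin 2) ℂ →ₐ[ℂ] (B2 →L[ℂ] B2) := pointwiseB.comp matC

theorem matB_apply (A : Matrix (Fin 2) (Fin 2) ℂ) (y : B2) (x : ℝ) :
    matB A y x = matC A (y x) := rfl

/-- The components of a bounded continuous profile. -/
def comp (i : Fin 2) : B2 →L[ℂ] B :=
  (EuclideanSpace.proj (𝕜 := ℂ) i : C2 →L[ℂ] ℂ).compLeftContinuousBounded ℝ

@[simp] theorem comp_apply (i : Fin 2) (y : B2) (x : ℝ) : comp i y x = y x i := rfl

theorem matL_reflL (A : Matrix (Fin 2) (Fin 2) ℂ) (y : L2) :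
    matL A (reflL y) = reflL (matL A y) := by
  refine Lp.ext ?_
  filter_upwards [coeFn_matL A (reflL y), coeFn_reflL y, coeFn_reflL (matL A y),
    ae_comp_neg (p := fun x => matL A y x = matC A (y x)) (coeFn_matL A y)] with x h1 h2 h3 h4
  rw [h1, h2, h3, h4]

theorem matL_opR (A : Matrix (Fin 2) (Fin 2) ℂ) (y : L2) :
    matL A (opR y) = opR (matL A y) := by
  refine Lp.ext ?_
  filter_upwards [coeFn_matL A (opR y), coeFn_opR y, coeFn_opR (matL A y)] with x h1 h2 h3
  rw [h1, h2, h3, expInt_congr (coeFn_matL A y), expInt, expInt]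
  have := ((matC A).restrictScalars ℝ).integral_comp_comm (integrableOn_expKernel (Lp.memLp y) x)
  simp only [ContinuousLinearMap.coe_restrictScalars'] at this
  rw [← this]
  refine integral_congr_ae (ae_of_all _ fun t => ?_)
  exact ((matC A).restrictScalars ℝ).map_smul _ _

theorem matL_opRm (A : Matrix (Fin 2) (Fin 2) ℂ) (y : L2) :
    matL A (opRm y) = opRm (matL A y) := by
  rw [opRm_apply, matL_reflL, matL_opR, matL_reflL, opRm_apply]

theorem matL_opG (A : Matrix (Fin 2) (Fin 2) ℂ) (y : L2) :
    matL A (opG y) = opG (matL A y) := by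
  rw [opG_apply, matL_opR, matL_opRm, opG_apply]

theorem commute_matL_opG (A : Matrix (Fin 2) (Fin 2) ℂ) : Commute (matL A) opG := by
  ext1 y
  exact matL_opG A y

theorem commute_matB_bdG (A : Matrix (Fin 2) (Fin 2) ℂ) :
    Commute (matB A) (bdG C2 one_re_pos) := by
  ext1 y
  change matB A (bdG C2 one_re_pos y) = bdG C2 one_re_pos (matB A y)
  refine eq_bdG one_re_pos (y' := matB A (bdDG C2 one_re_pos y)) (fun x => ?_) fun x => ?_
  · exact ((matC A).restrictScalars ℝ).hasFDerivAt.comp_hasDerivAt x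
      (hasDerivAt_bdG one_re_pos y x)
  · have := ((matC A).restrictScalars ℝ).hasFDerivAt.comp_hasDerivAt x
      (hasDerivAt_bdDG one_re_pos y x)
    refine this.congr_deriv ?_
    simp [matB_apply]

/-! ### The linearization in terms of bounded operators -/

/-- Diffusion matrix. -/
def matD (d : ℝ) : Matrix (Fin 2) (Fin 2) ℂ := !![1, 0; 0, (d : ℂ) ^ 2]

/-- Linear part of the reaction terms. -/
def matN (m : ℝ) : Matrix (Fin 2) (Fin 2) ℂ := !![-1, 0; 0, -(m : ℂ)]

/-- Coupling of the cubic term to the first component. -/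
def matT0 : Matrix (Fin 2) (Fin 2) ℂ := !![-1, 0; 1, 0]

/-- Coupling of the cubic term to the second component. -/
def matT1 : Matrix (Fin 2) (Fin 2) ℂ := !![0, -1; 0, 1]

/-- Projection to the first component. -/
def matE : Matrix (Fin 2) (Fin 2) ℂ := !![1, 0; 0, 0]

/-- The composition of the linearization at `U` with `(1 - ∂²)⁻¹`. -/
def linS (d m : ℝ) (f g : B) (ε : ℂ) (U : B2) : L2 →L[ℂ] L2 :=
  matL (matD d) * (opG - 1)
    + ε • (mulL f * matL matE * opDG + mulL g * matL matE * opG)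
    + matL (matN m) * opG + mulL (comp 1 U ^ 2) * matL matT0 * opG
    + mulL (2 * comp 0 U * comp 1 U) * matL matT1 * opG

/-- Insert (G h)' = `opDG h` and (G h)'' = G h - h into the differential expression. This is the
passage from the unbounded to the bounded formulation. -/
theorem linExpr_opG_ae (d m ε : ℝ) {f g : ℝ → ℝ} {fB gB : B} {u : ℝ → R2} {U : B2}
    (hf : ∀ x, fB x = (f x : ℂ)) (hg : ∀ x, gB x = (g x : ℂ))
    (hU : ∀ᵐ x : ℝ, ∀ i, U x i = ((u x i : ℝ) : ℂ)) {y : L2} (h : L2) (hy : opG h = y) :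
    linExpr d m ε f g u y =ᵐ[volume] linS d m fB gB ε U h := by
  subst hy
  have e1 := (hasWeakDeriv_opG h).weakDeriv_ae
  have e2 := (hasWeakDeriv_opG h).weakDeriv_weakDeriv_ae (hasWeakDeriv_opDG h)
  have a1 : linS d m fB gB ε U h = matL (matD d) (opG h - h)
    + (ε : ℂ) • (mulL fB (matL matE (opDG h)) + mulL gB (matL matE (opG h)))
    + matL (matN m) (opG h) + mulL (comp 1 U ^ 2) (matL matT0 (opG h))
    + mulL (2 * comp 0 U * comp 1 U) (matL matT1 (opG h)) := rfl
  rw [a1]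
  filter_upwards [hU, e1, e2, Lp.coeFn_sub (opG h) h, coeFn_matL (matD d) (opG h - h),
    coeFn_matL matE (opDG h), coeFn_matL matE (opG h), coeFn_matL (matN m) (opG h),
    coeFn_matL matT0 (opG h), coeFn_matL matT1 (opG h),
    coeFn_mulL fB (matL matE (opDG h)), coeFn_mulL gB (matL matE (opG h)),
    coeFn_mulL (comp 1 U ^ 2) (matL matT0 (opG h)),
    coeFn_mulL (2 * comp 0 U * comp 1 U) (matL matT1 (opG h)),
    Lp.coeFn_add (mulL fB (matL matE (opDG h))) (mulL gB (matL matE (opG h))),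
    Lp.coeFn_smul (ε : ℂ) (mulL fB (matL matE (opDG h)) + mulL gB (matL matE (opG h))),
    Lp.coeFn_add (matL (matD d) (opG h - h)) ((ε : ℂ) • (mulL fB (matL matE (opDG h))
      + mulL gB (matL matE (opG h)))),
    Lp.coeFn_add (matL (matD d) (opG h - h) + (ε : ℂ) • (mulL fB (matL matE (opDG h))
      + mulL gB (matL matE (opG h)))) (matL (matN m) (opG h)),
    Lp.coeFn_add (matL (matD d) (opG h - h) + (ε : ℂ) • (mulL fB (matL matE (opDG h))
      + mulL gB (matL matE (opG h))) + matL (matN m) (opG h))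
      (mulL (comp 1 U ^ 2) (matL matT0 (opG h))),
    Lp.coeFn_add (matL (matD d) (opG h - h) + (ε : ℂ) • (mulL fB (matL matE (opDG h))
      + mulL gB (matL matE (opG h))) + matL (matN m) (opG h)
      + mulL (comp 1 U ^ 2) (matL matT0 (opG h)))
      (mulL (2 * comp 0 U * comp 1 U) (matL matT1 (opG h)))]
    with x hu h1 h2 h3 h4 h5 h6 h7 h8 h9 h10 h11 h12 h13 h14 h15 h16 h17 h18 h19
  rw [h19, Pi.add_apply, h18, Pi.add_apply, h17, Pi.add_apply, h16, Pi.add_apply, h15,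
    Pi.smul_apply, h14, Pi.add_apply, h13, h12, h11, h10, h9, h8, h7, h6, h5, h4]
  have h20 := h2.trans h3
  have u0 := hu 0
  have u1 := hu 1
  ext i
  fin_cases i
  · simp [linExpr, reactionJacobian, matC_apply, matD, matN, matE, matT0, matT1, h1, h2, h3, hf, hg,
      u0, u1]
    ring
  · simp [linExpr, reactionJacobian, matC_apply, matD, matN, matE, matT0, matT1, h1, h2, h3, hf, hg,
      u0, u1]
    ring

theorem mem_linearization_domain_iff (d m ε : ℝ) {f g : ℝ → ℝ} {fB gB : B} {u : ℝ → R2} {U : B2}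
    (hf : ∀ x, fB x = (f x : ℂ)) (hg : ∀ x, gB x = (g x : ℂ))
    (hU : ∀ᵐ x : ℝ, ∀ i, U x i = ((u x i : ℝ) : ℂ)) (y : L2) :
    y ∈ (linearization d m ε f g u).domain ↔ ∃ h, opG h = y := by
  refine ⟨fun h => exists_opG_eq_of_memH2 h.1, ?_⟩
  rintro ⟨h, rfl⟩
  exact ⟨memH2_opG h, (memLp_congr_ae (linExpr_opG_ae d m ε hf hg hU h rfl)).2 (Lp.memLp _)⟩

theorem linearization_opG (d m ε : ℝ) {f g : ℝ → ℝ} {fB gB : B} {u : ℝ → R2} {U : B2}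
    (hf : ∀ x, fB x = (f x : ℂ)) (hg : ∀ x, gB x = (g x : ℂ))
    (hU : ∀ᵐ x : ℝ, ∀ i, U x i = ((u x i : ℝ) : ℂ)) (h : L2)
    (hy : opG h ∈ (linearization d m ε f g u).domain) :
    linearization d m ε f g u ⟨opG h, hy⟩ = linS d m fB gB ε U h := by
  refine Lp.ext ?_
  exact (MemLp.coeFn_toLp hy.2).trans (linExpr_opG_ae d m ε hf hg hU h rfl)

/-! ### Unbounded operators of the form `S ∘ G⁻¹` -/

section Factored

variable {H : Type*} [NormedAddCommGroup H] [NormedSpace ℂ H] [CompleteSpace H]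
  {A : H →ₗ.[ℂ] H} {G S : H →L[ℂ] H}

/-- Formally A - μ = (S - μG)G⁻¹, so the resolvent is G(S - μG)⁻¹. In the other direction
bijectivity of S - μG suffices, by the open mapping theorem. -/
theorem isInResolventSet_iff_isUnit (hG : Function.Injective G)
    (hdom : ∀ y, y ∈ A.domain ↔ ∃ h, G h = y)
    (hA : ∀ h (hy : G h ∈ A.domain), A ⟨G h, hy⟩ = S h) (μ : ℂ) :
    IsInResolventSet A μ ↔ IsUnit (S - μ • G) := by
  constructor
  · rintro ⟨R, h1, h2⟩
    rw [ContinuousLinearMap.isUnit_iff_bijective]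
    constructor
    · rw [injective_iff_map_eq_zero]
      intro h hh
      have hd : G h ∈ A.domain := (hdom _).2 ⟨h, rfl⟩
      have := h2 ⟨G h, hd⟩
      rw [hA] at this
      have e : S h - μ • (G h) = 0 := hh
      rw [e, map_zero] at this
      exact hG (by rw [map_zero]; exact this.symm)
    · intro y
      obtain ⟨hd, e⟩ := h1 y
      obtain ⟨h, hh⟩ := (hdom _).1 hd
      refine ⟨h, ?_⟩
      have e2 : A ⟨R y, hd⟩ = S h := by
        have := hA h (hh ▸ hd)
        rw [← this]
        congr 1
        exact Subtype.ext hh.symm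
      rw [e2, ← hh] at e
      exact e
  · intro hu
    obtain ⟨u, hu⟩ := hu
    have i1 : ∀ y, S ((↑u⁻¹ : H →L[ℂ] H) y) - μ • G ((↑u⁻¹ : H →L[ℂ] H) y) = y := fun y => by
      have := congrArg (fun T : H →L[ℂ] H => T y) u.mul_inv
      rw [hu] at this
      exact this
    have i2 : ∀ y, (↑u⁻¹ : H →L[ℂ] H) (S y - μ • G y) = y := fun y => by
      have := congrArg (fun T : H →L[ℂ] H => T y) u.inv_mul
      rw [hu] at this
      exact this
    refine ⟨G * ↑u⁻¹, fun y => ⟨(hdom _).2 ⟨_, rfl⟩, ?_⟩, ?_⟩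
    · exact (congrArg (· - μ • G ((↑u⁻¹ : H →L[ℂ] H) y))
        (hA ((↑u⁻¹ : H →L[ℂ] H) y) ((hdom _).2 ⟨_, rfl⟩))).trans (i1 y)
    · rintro ⟨y, hy⟩
      obtain ⟨h, rfl⟩ := (hdom _).1 hy
      rw [hA]
      change G ((↑u⁻¹ : H →L[ℂ] H) (S h - μ • G h)) = G h
      rw [i2]

theorem mem_kerPow_succ (hdom : ∀ y, y ∈ A.domain ↔ ∃ h, G h = y)
    (hA : ∀ h (hy : G h ∈ A.domain), A ⟨G h, hy⟩ = S h) (μ : ℂ) (n : ℕ) (y : H) :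
    y ∈ kerPow A μ (n + 1) ↔ ∃ h, G h = y ∧ S h - μ • G h ∈ kerPow A μ n := by
  rw [kerPow, Submodule.mem_map]
  constructor
  · rintro ⟨⟨y, hy⟩, h1, rfl⟩
    obtain ⟨h, rfl⟩ := (hdom _).1 hy
    refine ⟨h, rfl, ?_⟩
    rw [Submodule.mem_comap] at h1
    rw [← hA h hy]
    exact h1
  · rintro ⟨h, rfl, h1⟩
    have hy : G h ∈ A.domain := (hdom _).2 ⟨h, rfl⟩
    refine ⟨⟨G h, hy⟩, ?_, rfl⟩
    rw [Submodule.mem_comap]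
    rw [← hA h hy] at h1
    exact h1

/-- The chain of kernels stops at the first step: a vector in ker (A - μ)² outside ker (A - μ)
would, after scaling, give a solution of (S - μG)h = Gη, which `hgen` excludes. -/
theorem isSimpleEigenvalue_of_factored (hG : Function.Injective G)
    (hdom : ∀ y, y ∈ A.domain ↔ ∃ h, G h = y)
    (hA : ∀ h (hy : G h ∈ A.domain), A ⟨G h, hy⟩ = S h) {μ : ℂ} {η : H} (hη0 : η ≠ 0)
    (hη : S η - μ • G η = 0) (hker : ∀ h, S h - μ • G h = 0 → ∃ c : ℂ, h = c • η)
    (hgen : ∀ h, S h - μ • G h ≠ G η) : IsSimpleEigenvalue A μ := by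
  have h1 : ∀ y, y ∈ kerPow A μ 1 ↔ ∃ c : ℂ, y = c • G η := fun y => by
    rw [mem_kerPow_succ hdom hA]
    constructor
    · rintro ⟨h, rfl, hh⟩
      obtain ⟨c, rfl⟩ := hker h ((Submodule.mem_bot ℂ).1 hh)
      exact ⟨c, map_smul _ _ _⟩
    · rintro ⟨c, rfl⟩
      refine ⟨c • η, map_smul _ _ _, (Submodule.mem_bot ℂ).2 ?_⟩
      rw [map_smul, map_smul, smul_comm, ← smul_sub, hη, smul_zero]
  have h2 : ∀ n, kerPow A μ (n + 1) = kerPow A μ 1 := by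
    intro n
    induction n with
    | zero => rfl
    | succ n ih =>
      ext y
      rw [mem_kerPow_succ hdom hA, ih]
      constructor
      · rintro ⟨h, rfl, hh⟩
        obtain ⟨c, hc⟩ := (h1 _).1 hh
        by_cases hc0 : c = 0
        · rw [hc0, zero_smul] at hc
          obtain ⟨c', rfl⟩ := hker h hc
          exact (h1 _).2 ⟨c', map_smul _ _ _⟩
        · refine absurd ?_ (hgen (c⁻¹ • h))
          rw [map_smul, map_smul, smul_comm, ← smul_sub, hc, smul_smul, inv_mul_cancel₀ hc0,
            one_smul]
      · intro hy
        obtain ⟨h, rfl, hh⟩ := (mem_kerPow_succ hdom hA μ 0 y).1 hy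
        refine ⟨h, rfl, ?_⟩
        rw [(Submodule.mem_bot ℂ).1 hh]
        exact Submodule.zero_mem _
  have h3 : (⨆ n, kerPow A μ n) = kerPow A μ 1 := by
    refine le_antisymm (iSup_le fun n => ?_) (le_iSup (kerPow A μ) 1)
    cases n with
    | zero => exact bot_le
    | succ n => exact (h2 n).le
  have hη' : G η ≠ 0 := fun h => hη0 (hG (by rw [h, map_zero]))
  rw [IsSimpleEigenvalue, h3]
  refine finrank_eq_one_iff'.2 ⟨⟨G η, (h1 _).2 ⟨1, (one_smul _ _).symm⟩⟩, ?_, ?_⟩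
  · intro h
    exact hη' (congrArg Subtype.val h)
  · rintro ⟨y, hy⟩
    obtain ⟨c, rfl⟩ := (h1 _).1 hy
    exact ⟨c, rfl⟩

/-- Only one-dimensionality of the kernel is extracted here; absence of a Jordan block will be
encoded by ⟨Ψ, Gη⟩ = 1. -/
theorem IsSimpleEigenvalue.exists_smul_eq {μ : ℂ} (hs : IsSimpleEigenvalue A μ)
    (hG : Function.Injective G) (hdom : ∀ y, y ∈ A.domain ↔ ∃ h, G h = y)
    (hA : ∀ h (hy : G h ∈ A.domain), A ⟨G h, hy⟩ = S h) {η : H} (hη0 : η ≠ 0)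
    (hη : S η - μ • G η = 0) {h : H} (hh : S h - μ • G h = 0) : ∃ c : ℂ, h = c • η := by
  have h1 : ∀ k, S k - μ • G k = 0 → G k ∈ ⨆ n, kerPow A μ n := fun k hk => by
    refine (le_iSup (kerPow A μ) 1) ?_
    rw [mem_kerPow_succ hdom hA]
    exact ⟨k, rfl, (Submodule.mem_bot ℂ).2 hk⟩
  have hη' : (⟨G η, h1 η hη⟩ : (⨆ n, kerPow A μ n : Submodule ℂ H)) ≠ 0 := fun h =>
    hη0 (hG (by rw [map_zero]; exact congrArg Subtype.val h))
  obtain ⟨c, hc⟩ := (finrank_eq_one_iff_of_nonzero' _ hη').1 hs ⟨G h, h1 h hh⟩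
  refine ⟨c, hG ?_⟩
  rw [map_smul]
  exact (congrArg Subtype.val hc).symm

end Factored


/-! ### Wave packets -/

theorem norm_le_of_ae_le_indicator {f : L2} {a b K : ℝ} (hab : a ≤ b) (hK : 0 ≤ K)
    (h : ∀ᵐ x, ‖f x‖ ≤ (Icc a b).indicator (fun _ => K) x) : ‖f‖ ≤ K * Real.sqrt (b - a) := by
  have hm : volume (Icc a b) ≠ ⊤ := by simp
  have := Lp.norm_le_norm_of_ae_le (f := f)
    (g := indicatorConstLp 2 (measurableSet_Icc (a := a) (b := b)) hm K) (by
      filter_upwards [h, indicatorConstLp_coeFn (p := 2) (hs := measurableSet_Icc (a := a) (b := b))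
        (hμs := hm) (c := K)] with x hx hx'
      rw [hx']
      exact hx.trans (le_abs_self _))
  refine this.trans_eq ?_
  rw [norm_indicatorConstLp (by norm_num) (by norm_num), Real.norm_of_nonneg hK, Measure.real,
    Real.volume_Icc, ENNReal.toReal_ofReal (by linarith), Real.sqrt_eq_rpow]
  norm_num

theorem le_norm_of_ae_indicator_le {f : L2} {a b K : ℝ} (hab : a ≤ b) (hK : 0 ≤ K)
    (h : ∀ᵐ x, x ∈ Icc a b → K ≤ ‖f x‖) : K * Real.sqrt (b - a) ≤ ‖f‖ := by
  have hm : volume (Icc a b) ≠ ⊤ := by simp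
  have := Lp.norm_le_norm_of_ae_le (g := f)
    (f := indicatorConstLp 2 (measurableSet_Icc (a := a) (b := b)) hm K) (by
      filter_upwards [h, indicatorConstLp_coeFn (p := 2) (hs := measurableSet_Icc (a := a) (b := b))
        (hμs := hm) (c := K)] with x hx hx'
      rw [hx']
      by_cases hxm : x ∈ Icc a b
      · rw [indicator_of_mem hxm, Real.norm_of_nonneg hK]
        exact hx hxm
      · rw [indicator_of_notMem hxm, norm_zero]
        exact norm_nonneg _)
  refine le_trans (Eq.le ?_) this
  rw [norm_indicatorConstLp (by norm_num) (by norm_num), Real.norm_of_nonneg hK, Measure.real,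
    Real.volume_Icc, ENNReal.toReal_ofReal (by linarith), Real.sqrt_eq_rpow]
  norm_num

/-- The packet is G h = ψ((x - c)/n) e^{ikx} ξ with a bump ψ. Each derivative falling on the
envelope costs 1/n, so h = (1 - ∂²)G h is (1 + k²)G h up to C/n. The constant does not depend on the
centre c. -/
theorem exists_wavePacket (k : ℝ) (ξ : C2) : ∃ C : ℝ, 0 ≤ C ∧ ∀ n : ℝ, 1 ≤ n → ∀ c : ℝ, ∃ h : L2,
    (∀ᵐ x, ‖h x - (1 + (k : ℂ) ^ 2) • opG h x‖ ≤ C / n) ∧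
    (∀ᵐ x, x ∉ Icc (c - 2 * n) (c + 2 * n) → h x = 0 ∧ opG h x = 0) ∧
    (∀ᵐ x, ‖opG h x‖ ≤ ‖ξ‖) ∧ (∀ᵐ x, x ∈ Icc (c - n) (c + n) → ‖ξ‖ ≤ ‖opG h x‖) ∧
    ∀ᵐ x, ∃ s : ℂ, opG h x = s • ξ := by
  let ψ : ContDiffBump (0 : ℝ) := ⟨1, 2, by norm_num, by norm_num⟩
  have hψ : ContDiff ℝ 2 ψ := ψ.contDiff
  have hψ1 : ContDiff ℝ 1 (deriv ψ) := by
    have : ContDiff ℝ (1 + 1) ψ := by convert hψ using 1; norm_num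
    exact (contDiff_succ_iff_deriv.1 this).2.2
  have hψ2 : Continuous (deriv (deriv ψ)) := hψ1.continuous_deriv le_rfl
  have d0 : ∀ x, HasDerivAt ψ (deriv ψ x) x := fun x =>
    (hψ.differentiable (by norm_num) x).hasDerivAt
  have d1 : ∀ x, HasDerivAt (deriv ψ) (deriv (deriv ψ) x) x := fun x =>
    (hψ1.differentiable (by norm_num) x).hasDerivAt
  have s0 : HasCompactSupport ψ := ψ.hasCompactSupport
  obtain ⟨C1, hC1⟩ := s0.deriv.exists_bound_of_continuous (hψ1.continuous)
  obtain ⟨C2', hC2⟩ := s0.deriv.deriv.exists_bound_of_continuous hψ2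
  have hC1' : 0 ≤ C1 := (norm_nonneg _).trans (hC1 0)
  have hC2'' : 0 ≤ C2' := (norm_nonneg _).trans (hC2 0)
  -- The error is ψ''/n² + 2ikψ'/n, and n⁻² ≤ n⁻¹ for n ≥ 1.
  refine ⟨(C2' + 2 * |k| * C1) * ‖ξ‖, by positivity, fun n hn c => ?_⟩
  have hn0 : 0 < n := by linarith
  let t : ℝ → ℝ := fun x => (x - c) / n
  have ht : ∀ x, HasDerivAt t (1 / n) x := fun x => ((hasDerivAt_id x).sub_const c).div_const n
  have htc : Continuous t := by fun_prop
  let e : ℝ → ℂ := fun x => Complex.exp (Complex.I * k * x)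
  have he : ∀ x, HasDerivAt e (Complex.I * k * e x) x := fun x => by
    have h1 : HasDerivAt (fun x : ℝ => Complex.I * k * (x : ℂ)) (Complex.I * k * 1) x :=
      (Complex.ofRealCLM.hasDerivAt (x := x)).const_mul _
    refine h1.cexp.congr_deriv ?_
    simp only [e]
    ring
  have hec : Continuous e := by fun_prop
  have hen : ∀ x, ‖e x‖ = 1 := fun x => by
    have : Complex.I * k * x = (k * x : ℝ) * Complex.I := by push_cast; ring
    simp only [e]
    rw [this, Complex.norm_exp_ofReal_mul_I]
  let y : ℝ → C2 := fun x => ((ψ (t x) : ℂ) * e x) • ξ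
  let y1 : ℝ → C2 := fun x =>
    (((deriv ψ (t x) / n : ℝ) : ℂ) * e x + Complex.I * k * (ψ (t x) : ℂ) * e x) • ξ
  let y2 : ℝ → C2 := fun x =>
    (((deriv (deriv ψ) (t x) / n ^ 2 : ℝ) : ℂ) * e x
      + 2 * Complex.I * k * ((deriv ψ (t x) / n : ℝ) : ℂ) * e x
      - (k : ℂ) ^ 2 * (ψ (t x) : ℂ) * e x) • ξ
  have a0 : ∀ x, HasDerivAt (fun x => (ψ (t x) : ℂ)) ((deriv ψ (t x) / n : ℝ) : ℂ) x := fun x => by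
    refine (((d0 (t x)).comp x (ht x)).ofReal_comp).congr_deriv ?_
    rw [mul_one_div]
  have a1 : ∀ x, HasDerivAt (fun x => ((deriv ψ (t x) / n : ℝ) : ℂ))
      ((deriv (deriv ψ) (t x) / n ^ 2 : ℝ) : ℂ) x := fun x => by
    refine ((((d1 (t x)).comp x (ht x)).div_const n).ofReal_comp).congr_deriv ?_
    congr 1
    field_simp
  have b0 : ∀ x, HasDerivAt y (y1 x) x := fun x => by
    refine (((a0 x).mul (he x)).smul_const ξ).congr_deriv ?_
    simp only [y1]
    congr 1
    ring
  have b1 : ∀ x, HasDerivAt y1 (y2 x) x := fun x => by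
    refine ((((a1 x).mul (he x)).add ((((a0 x).const_mul (Complex.I * k))).mul (he x))).smul_const
      ξ).congr_deriv ?_
    simp only [y2]
    congr 1
    linear_combination ((k : ℂ) ^ 2 * (ψ (t x) : ℂ) * e x) * Complex.I_sq
  have c0 : Continuous y := continuous_iff_continuousAt.2 fun x => (b0 x).continuousAt
  have c1 : Continuous y1 := continuous_iff_continuousAt.2 fun x => (b1 x).continuousAt
  have c2 : Continuous y2 := by
    have := hψ1.continuous
    have := hψ.continuous
    fun_prop
  have hout : ∀ x, x ∉ Icc (c - 2 * n) (c + 2 * n) → t x ∉ Metric.closedBall (0 : ℝ) 2 := by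
    intro x hx hx'
    refine hx ?_
    rw [Metric.mem_closedBall, dist_zero_right, Real.norm_eq_abs, abs_le] at hx'
    simp only [t] at hx'
    rw [le_div_iff₀ hn0, div_le_iff₀ hn0] at hx'
    constructor <;> linarith [hx'.1, hx'.2]
  have z0 : ∀ s, s ∉ Metric.closedBall (0 : ℝ) 2 → ψ s = 0 := fun s hs => by
    have : s ∉ tsupport ψ := by rwa [ψ.tsupport_eq]
    exact image_eq_zero_of_notMem_tsupport this
  have z1 : ∀ s, s ∉ Metric.closedBall (0 : ℝ) 2 → deriv ψ s = 0 := fun s hs => by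
    have : s ∉ tsupport ψ := by rwa [ψ.tsupport_eq]
    exact image_eq_zero_of_notMem_tsupport fun h => this (tsupport_deriv_subset h)
  have z2 : ∀ s, s ∉ Metric.closedBall (0 : ℝ) 2 → deriv (deriv ψ) s = 0 := fun s hs => by
    have : s ∉ tsupport ψ := by rwa [ψ.tsupport_eq]
    exact image_eq_zero_of_notMem_tsupport fun h =>
      this (tsupport_deriv_subset (tsupport_deriv_subset h))
  have o0 : ∀ x, x ∉ Icc (c - 2 * n) (c + 2 * n) → y x = 0 := fun x hx => by
    simp [y, z0 _ (hout x hx)]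
  have o1 : ∀ x, x ∉ Icc (c - 2 * n) (c + 2 * n) → y1 x = 0 := fun x hx => by
    simp [y1, z0 _ (hout x hx), z1 _ (hout x hx)]
  have o2 : ∀ x, x ∉ Icc (c - 2 * n) (c + 2 * n) → y2 x = 0 := fun x hx => by
    simp [y2, z0 _ (hout x hx), z1 _ (hout x hx), z2 _ (hout x hx)]
  have m0 : MemLp y 2 volume :=
    c0.memLp_of_hasCompactSupport (HasCompactSupport.intro isCompact_Icc o0)
  have m1 : MemLp y1 2 volume :=
    c1.memLp_of_hasCompactSupport (HasCompactSupport.intro isCompact_Icc o1)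
  have m2 : MemLp y2 2 volume :=
    c2.memLp_of_hasCompactSupport (HasCompactSupport.intro isCompact_Icc o2)
  have w0 := (hasWeakDeriv_of_hasDerivAt b0 c1).congr m0.coeFn_toLp.symm m1.coeFn_toLp.symm
  have w1 := (hasWeakDeriv_of_hasDerivAt b1 c2).congr m1.coeFn_toLp.symm m2.coeFn_toLp.symm
  have hG := eq_opG_of_hasWeakDeriv w0 w1
  refine ⟨m0.toLp y - m2.toLp y2, ?_⟩
  rw [hG]
  have hh : ∀ᵐ x, (m0.toLp y - m2.toLp y2 : L2) x = y x - y2 x := by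
    filter_upwards [Lp.coeFn_sub (m0.toLp y) (m2.toLp y2), m0.coeFn_toLp, m2.coeFn_toLp]
      with x h1 h2 h3
    rw [h1, Pi.sub_apply, h2, h3]
  have hψn : ∀ s, |ψ s| ≤ 1 := fun s => by rw [abs_of_nonneg ψ.nonneg]; exact ψ.le_one
  refine ⟨?_, ?_, ?_, ?_, ?_⟩
  · filter_upwards [hh, m0.coeFn_toLp] with x h1 h2
    rw [h1, h2]
    have : y x - y2 x - (1 + (k : ℂ) ^ 2) • y x
        = (-(((deriv (deriv ψ) (t x) / n ^ 2 : ℝ) : ℂ)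
          + 2 * Complex.I * k * ((deriv ψ (t x) / n : ℝ) : ℂ)) * e x) • ξ := by
      simp only [y, y2, smul_smul, ← sub_smul]
      congr 1
      ring
    rw [this, norm_smul, norm_mul, hen, mul_one, norm_neg]
    have q1 : ‖((deriv (deriv ψ) (t x) / n ^ 2 : ℝ) : ℂ)‖ ≤ C2' / n := by
      rw [Complex.norm_real, norm_div, Real.norm_of_nonneg (by positivity : (0:ℝ) ≤ n ^ 2)]
      refine div_le_div₀ hC2'' (hC2 _) hn0 (by nlinarith)
    have q2 : ‖2 * Complex.I * k * ((deriv ψ (t x) / n : ℝ) : ℂ)‖ ≤ 2 * |k| * (C1 / n) := by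
      rw [norm_mul, norm_mul, norm_mul, Complex.norm_I, Complex.norm_real, Complex.norm_real,
        norm_div, Real.norm_of_nonneg hn0.le, Real.norm_eq_abs, Complex.norm_ofNat, mul_one]
      gcongr
      exact hC1 _
    calc _ ≤ (C2' / n + 2 * |k| * (C1 / n)) * ‖ξ‖ := by
          gcongr
          exact (norm_add_le _ _).trans (add_le_add q1 q2)
      _ = _ := by ring
  · filter_upwards [hh, m0.coeFn_toLp] with x h1 h2 hx
    rw [h1, h2, o0 x hx, o2 x hx, sub_zero]
    exact ⟨rfl, rfl⟩
  · filter_upwards [m0.coeFn_toLp] with x h2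
    rw [h2]
    simp only [y]
    rw [norm_smul, norm_mul, hen, mul_one, Complex.norm_real]
    exact mul_le_of_le_one_left (norm_nonneg _) (hψn _)
  · filter_upwards [m0.coeFn_toLp] with x h2 hx
    rw [h2]
    have : ψ (t x) = 1 := by
      refine ψ.one_of_mem_closedBall ?_
      rw [Metric.mem_closedBall, dist_zero_right, Real.norm_eq_abs, abs_le]
      simp only [t]
      change -1 ≤ _ ∧ _ ≤ (1 : ℝ)
      rw [le_div_iff₀ hn0, div_le_iff₀ hn0]
      constructor <;> linarith [hx.1, hx.2]
    simp only [y]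
    rw [norm_smul, norm_mul, hen, this]
    simp
  · filter_upwards [m0.coeFn_toLp] with x h2
    exact ⟨_, h2⟩

/-! ### The symbol of an invertible asymptotically constant operator -/

/-- A second order operator, composed with `(1 - ∂²)⁻¹`, with constant part `A₀ + A₁ G` and
variable zeroth order coefficients. -/
def asymptS (A₀ A₁ : Matrix (Fin 2) (Fin 2) ℂ) (q₀ q₁ : B) : L2 →L[ℂ] L2 :=
  matL A₀ + matL A₁ * opG + mulL q₀ * matL matT0 * opG + mulL q₁ * matL matT1 * opG

theorem asymptS_ae (A₀ A₁ : Matrix (Fin 2) (Fin 2) ℂ) (q₀ q₁ : B) (h : L2) :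
    ∀ᵐ x, asymptS A₀ A₁ q₀ q₁ h x = matC A₀ (h x) + matC A₁ (opG h x)
      + q₀ x • matC matT0 (opG h x) + q₁ x • matC matT1 (opG h x) := by
  have a1 : asymptS A₀ A₁ q₀ q₁ h = matL A₀ h + matL A₁ (opG h) + mulL q₀ (matL matT0 (opG h))
    + mulL q₁ (matL matT1 (opG h)) := rfl
  rw [a1]
  filter_upwards [coeFn_matL A₀ h, coeFn_matL A₁ (opG h), coeFn_matL matT0 (opG h),
    coeFn_matL matT1 (opG h), coeFn_mulL q₀ (matL matT0 (opG h)),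
    coeFn_mulL q₁ (matL matT1 (opG h)), Lp.coeFn_add (matL A₀ h) (matL A₁ (opG h)),
    Lp.coeFn_add (matL A₀ h + matL A₁ (opG h)) (mulL q₀ (matL matT0 (opG h))),
    Lp.coeFn_add (matL A₀ h + matL A₁ (opG h) + mulL q₀ (matL matT0 (opG h)))
      (mulL q₁ (matL matT1 (opG h)))] with x h1 h2 h3 h4 h5 h6 h7 h8 h9
  rw [h9, Pi.add_apply, h8, Pi.add_apply, h7, Pi.add_apply, h6, h5, h4, h3, h2, h1]

/-- If ξ were in the kernel of the symbol at frequency k, wave packets far to the right would be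
approximate null vectors: the image has norm at most (M/n)√(4n), whereas the packet has norm at
least ‖ξ‖√(2n). A bounded inverse forbids this for large n. -/
theorem det_ne_zero_of_isUnit {A₀ A₁ : Matrix (Fin 2) (Fin 2) ℂ} {q₀ q₁ : B}
    (h₀ : Tendsto q₀ atTop (𝓝 0)) (h₁ : Tendsto q₁ atTop (𝓝 0))
    (hu : IsUnit (asymptS A₀ A₁ q₀ q₁)) (k : ℝ) :
    ((1 + (k : ℂ) ^ 2) • A₀ + A₁).det ≠ 0 := by
  intro hdet
  obtain ⟨v, hv0, hv⟩ := Matrix.exists_mulVec_eq_zero_iff.2 hdet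
  let ξ : C2 := WithLp.toLp 2 v
  have hξ0 : ξ ≠ 0 := fun h => hv0 (congrArg WithLp.ofLp h)
  have hξ : matC ((1 + (k : ℂ) ^ 2) • A₀ + A₁) ξ = 0 := by
    ext i
    rw [matC_apply]
    have := congrFun hv i
    simpa [Matrix.mulVec, dotProduct, Fin.sum_univ_two] using this
  obtain ⟨u, hu⟩ := hu
  set T := asymptS A₀ A₁ q₀ q₁ with hT
  have hb : ∀ h : L2, ‖h‖ ≤ ‖(↑u⁻¹ : L2 →L[ℂ] L2)‖ * ‖T h‖ := fun h => by
    have e : (↑u⁻¹ : L2 →L[ℂ] L2) (T h) = h := by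
      have := congrArg (fun T : L2 →L[ℂ] L2 => T h) u.inv_mul
      rw [hu] at this
      exact this
    calc ‖h‖ = ‖(↑u⁻¹ : L2 →L[ℂ] L2) (T h)‖ := by rw [e]
      _ ≤ _ := ContinuousLinearMap.le_opNorm _ _
  set K := ‖(↑u⁻¹ : L2 →L[ℂ] L2)‖
  obtain ⟨C, hC0, hC⟩ := exists_wavePacket k ξ
  set M := ‖matC A₀‖ * C + (‖matC matT0‖ + ‖matC matT1‖) * ‖ξ‖ with hM
  have hM0 : 0 ≤ M := by positivity
  have hK0 : 0 ≤ K := norm_nonneg _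
  have key : ∀ n : ℝ, 1 ≤ n → ‖ξ‖ * Real.sqrt (2 * n) ≤ K * (M / n * Real.sqrt (4 * n)) := by
    intro n hn
    have hn0 : 0 < n := by linarith
    have e0 : ∀ᶠ x in atTop, ‖q₀ x‖ ≤ 1 / n := by
      have hl := h₀.norm
      rw [norm_zero] at hl
      exact hl.eventually (ge_mem_nhds (by positivity))
    have e1 : ∀ᶠ x in atTop, ‖q₁ x‖ ≤ 1 / n := by
      have hl := h₁.norm
      rw [norm_zero] at hl
      exact hl.eventually (ge_mem_nhds (by positivity))
    obtain ⟨x₀, hx₀⟩ := eventually_atTop.1 (e0.and e1)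
    -- Centred here, the packet lives on [x₀, ∞), where both variable coefficients are at most 1/n.
    obtain ⟨h, p1, p2, p3, p4, p5⟩ := hC n hn (x₀ + 2 * n)
    have lo := le_norm_of_ae_indicator_le (by linarith) (norm_nonneg ξ) p4
    have up : ‖T h‖ ≤ M / n * Real.sqrt ((x₀ + 2 * n + 2 * n) - (x₀ + 2 * n - 2 * n)) := by
      refine norm_le_of_ae_le_indicator (by linarith) (by positivity) ?_
      filter_upwards [asymptS_ae A₀ A₁ q₀ q₁ h, p1, p2, p3, p5] with x hx r1 r2 r3 ⟨s, r5⟩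
      rw [hx]
      by_cases hxm : x ∈ Icc (x₀ + 2 * n - 2 * n) (x₀ + 2 * n + 2 * n)
      · rw [indicator_of_mem hxm]
        have hx0 := hx₀ x (by linarith [hxm.1])
        have : matC A₀ (h x) + matC A₁ (opG h x)
            = matC A₀ (h x - (1 + (k : ℂ) ^ 2) • opG h x) := by
          have : matC ((1 + (k : ℂ) ^ 2) • A₀ + A₁) (opG h x) = 0 := by
            rw [r5, map_smul, hξ, smul_zero]
          rw [map_add, map_smul] at this
          have h3 : (1 + (k : ℂ) ^ 2) • matC A₀ (opG h x) + matC A₁ (opG h x) = 0 := this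
          rw [map_sub, map_smul, eq_neg_of_add_eq_zero_right h3, sub_eq_add_neg]
        rw [this]
        calc _ ≤ ‖matC A₀‖ * (C / n) + 1 / n * (‖matC matT0‖ * ‖ξ‖)
              + 1 / n * (‖matC matT1‖ * ‖ξ‖) := by
              refine (norm_add₃_le).trans (add_le_add_three ?_ ?_ ?_)
              · exact ((matC A₀).le_opNorm _).trans (by gcongr)
              · rw [norm_smul]
                exact mul_le_mul hx0.1 (((matC matT0).le_opNorm _).trans (by gcongr))
                  (norm_nonneg _) (by positivity)
              · rw [norm_smul]
                exact mul_le_mul hx0.2 (((matC matT1).le_opNorm _).trans (by gcongr))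
                  (norm_nonneg _) (by positivity)
          _ = M / n := by rw [hM]; ring
      · rw [indicator_of_notMem hxm, (r2 hxm).1, (r2 hxm).2]
        simp
    calc ‖ξ‖ * Real.sqrt (2 * n) ≤ ‖opG h‖ := by
          convert lo using 3
          ring
      _ ≤ ‖h‖ := norm_opG_le h
      _ ≤ K * ‖T h‖ := hb h
      _ ≤ _ := by
        refine mul_le_mul_of_nonneg_left (up.trans_eq ?_) hK0
        congr 2
        ring
  have hξn : 0 < ‖ξ‖ := norm_pos_iff.2 hξ0
  obtain ⟨n, hn1, hn2⟩ : ∃ n : ℝ, 1 ≤ n ∧ 2 * K * M / ‖ξ‖ < n :=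
    ⟨max 1 (2 * K * M / ‖ξ‖ + 1), le_max_left _ _, (lt_add_one _).trans_le (le_max_right _ _)⟩
  have hn0 : 0 < n := by linarith
  have h3 := key n hn1
  have h4 : Real.sqrt (4 * n) ≤ 2 * Real.sqrt (2 * n) := by
    refine Real.sqrt_le_iff.2 ⟨by positivity, ?_⟩
    rw [mul_pow, Real.sq_sqrt (by linarith)]
    linarith
  have hs : 0 < Real.sqrt (2 * n) := Real.sqrt_pos.2 (by linarith)
  rw [div_lt_iff₀ hξn] at hn2
  have h5 : ‖ξ‖ * Real.sqrt (2 * n) ≤ K * (M / n) * (2 * Real.sqrt (2 * n)) := by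
    refine h3.trans ?_
    rw [← mul_assoc]
    gcongr
  have h6 : ‖ξ‖ ≤ 2 * K * M / n := by
    have := le_of_mul_le_mul_right (h5.trans_eq
      (by ring : _ = (2 * K * M / n) * Real.sqrt (2 * n))) hs
    exact this
  rw [le_div_iff₀ hn0] at h6
  linarith

/-- The hypothesis does not cover μ = 0. Every nonzero eigenvalue of the symbol has real part at
most -ϱ, so at each κ the determinant, a product of two eigenvalues, is either 0 or at least ϱ² in
modulus. By continuity a zero would spread over an interval, but the determinant is quadratic in κ
with leading coefficient d². -/
theorem symbol_det_ne_zero {d ϱ : ℝ} (hd : 0 < d) (hϱ : 0 < ϱ) (J : Matrix (Fin 2) (Fin 2) ℂ)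
    (h : ∀ μ : ℂ, μ ≠ 0 → -ϱ < μ.re → ∀ κ : ℝ, 0 ≤ κ →
      (-(κ : ℂ) • matD d + J - μ • 1).det ≠ 0) {κ : ℝ} (hκ : 0 ≤ κ) :
    (-(κ : ℂ) • matD d + J).det ≠ 0 := by
  intro h0
  set δ : ℝ → ℂ := fun κ => (-(κ : ℂ) • matD d + J).det with hδ
  have hform : ∀ κ, δ κ = (-κ + J 0 0) * (-κ * d ^ 2 + J 1 1) - J 0 1 * J 1 0 := fun κ => by
    simp [δ, Matrix.det_fin_two, matD]
  have hroot : ∀ κ, 0 ≤ κ → δ κ ≠ 0 → ϱ ^ 2 ≤ ‖δ κ‖ := by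
    intro κ hκ hne
    set τ : ℂ := (-κ + J 0 0) + (-κ * d ^ 2 + J 1 1) with hτ
    -- A root of the characteristic polynomial; the other root is τ - μ, and their product is the
    -- determinant.
    obtain ⟨μ, hμ⟩ := IsAlgClosed.exists_eval₂_eq_zero (RingHom.id ℂ)
      (Polynomial.X ^ 2 - Polynomial.C τ * Polynomial.X + Polynomial.C (δ κ)) (by
        have : (Polynomial.X ^ 2 - Polynomial.C τ * Polynomial.X + Polynomial.C (δ κ)).degree
            = 2 := by compute_degree!
        rw [this]
        norm_num)
    simp only [Polynomial.eval₂_add, Polynomial.eval₂_sub, Polynomial.eval₂_mul,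
      Polynomial.eval₂_pow, Polynomial.eval₂_X, Polynomial.eval₂_C, RingHom.id_apply] at hμ
    have hprod : μ * (τ - μ) = δ κ := by linear_combination -hμ
    have hdet : ∀ ν : ℂ, (-(κ : ℂ) • matD d + J - ν • 1).det = ν ^ 2 - τ * ν + δ κ := fun ν => by
      rw [hform]
      simp [Matrix.det_fin_two, matD, hτ]
      ring
    have hb : ∀ ν : ℂ, ν ^ 2 - τ * ν + δ κ = 0 → ϱ ≤ ‖ν‖ := fun ν hν => by
      have hν0 : ν ≠ 0 := by
        rintro rfl
        exact hne (by simpa using hν)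
      have : ¬ (-ϱ < ν.re) := fun hre => h ν hν0 hre κ hκ (by rw [hdet, hν])
      have h2 := Complex.abs_re_le_norm ν
      rw [abs_le] at h2
      linarith [h2.1]
    rw [← hprod, norm_mul, sq]
    exact mul_le_mul (hb μ hμ) (hb (τ - μ) (by linear_combination hμ)) hϱ.le (norm_nonneg _)
  have hcont : Continuous δ := by
    have : δ = fun κ : ℝ => (-(κ : ℂ) + J 0 0) * (-κ * d ^ 2 + J 1 1) - J 0 1 * J 1 0 :=
      funext hform
    rw [this]
    fun_prop
  have hnear : ∀ᶠ s in 𝓝 κ, ‖δ s‖ < ϱ ^ 2 := by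
    refine hcont.norm.continuousAt.eventually (gt_mem_nhds ?_)
    change ‖δ κ‖ < _
    rw [show δ κ = 0 from h0, norm_zero]
    positivity
  obtain ⟨r, hr0, hr⟩ := Metric.eventually_nhds_iff.1 hnear
  have hz : ∀ s, 0 ≤ s → s < r → δ (κ + s) = 0 := fun s hs0 hs => by
    by_contra hne
    have := hroot (κ + s) (by linarith) hne
    have h2 := hr (y := κ + s) (by
      rw [Real.dist_eq, add_sub_cancel_left, abs_of_nonneg hs0]
      exact hs)
    linarith
  have e0 := hz 0 le_rfl hr0
  have e1 := hz (r / 4) (by positivity) (by linarith)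
  have e2 := hz (r / 2) (by positivity) (by linarith)
  rw [hform] at e0 e1 e2
  -- The second difference with step r/4 isolates the leading coefficient: it equals d²r²/8.
  have : (d : ℂ) ^ 2 * (r : ℂ) ^ 2 = 0 := by
    push_cast at e0 e1 e2
    linear_combination 8 * e0 - 16 * e1 + 8 * e2
  have hd' : (d : ℂ) ≠ 0 := by exact_mod_cast hd.ne'
  have hr' : (r : ℂ) ≠ 0 := by exact_mod_cast hr0.ne'
  exact mul_ne_zero (pow_ne_zero 2 hd') (pow_ne_zero 2 hr') this

/-- Nonvanishing of the symbol on the real line gives nonvanishing on the spectrum of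
`(1 - ∂²)⁻¹`. -/
theorem det_add_smul_ne_zero {d : ℝ} (hd : 0 < d) {J : Matrix (Fin 2) (Fin 2) ℂ}
    (h : ∀ κ : ℝ, 0 ≤ κ → (-(κ : ℂ) • matD d + J).det ≠ 0) {t : ℝ} (ht : t ∈ Icc (0 : ℝ) 1) :
    (-matD d + (t : ℂ) • (matD d + J)).det ≠ 0 := by
  rcases ht.1.eq_or_lt with rfl | ht0
  · have hd' : (d : ℂ) ≠ 0 := by exact_mod_cast hd.ne'
    simpa [Matrix.det_fin_two, matD] using hd'
  · have ht' : (t : ℂ) ≠ 0 := by exact_mod_cast ht0.ne'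
    -- The substitution t = 1/(1 + κ) takes κ ∈ [0, ∞) to (0, 1]; the endpoint t = 0 stands for
    -- infinite frequency, where only the diffusion matrix remains.
    have e : -matD d + (t : ℂ) • (matD d + J)
        = (t : ℂ) • (-(((1 - t) / t : ℝ) : ℂ) • matD d + J) := by
      push_cast
      rw [smul_add, smul_add, smul_smul, ← add_assoc]
      congr 1
      have : (t : ℂ) * -((1 - t) / t) = t - 1 := by field_simp; ring
      rw [this, sub_smul, one_smul]
      abel
    rw [e, Matrix.det_smul]
    exact mul_ne_zero (pow_ne_zero _ ht') (h _ (div_nonneg (by linarith [ht.2]) ht0.le))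


/-! ### Compactness of decaying multiplication operators -/

theorem lipschitzWith_evG (h : L2) : LipschitzWith ‖evDG h‖₊ (evG h) := by
  refine lipschitzWith_of_nnnorm_deriv_le (fun x => (hasDerivAt_evG h x).differentiableAt)
    fun x => ?_
  rw [(hasDerivAt_evG h x).deriv]
  exact (evDG h).norm_coe_le_norm x

theorem memLp_smul_bdd {q : ℝ → ℂ} (hq : MemLp q 2 volume) (y : B2) :
    MemLp (fun x => q x • y x) 2 volume :=
  hq.of_le_mul (c := ‖y‖) (hq.1.smul y.continuous.aestronglyMeasurable)
    (ae_of_all _ fun x => by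
      rw [norm_smul, mul_comm]
      gcongr
      exact y.norm_coe_le_norm x)

/-- Multiplication of a bounded continuous profile by a square integrable weight. -/
def weightL {q : ℝ → ℂ} (hq : MemLp q 2 volume) : B2 →L[ℂ] L2 :=
  LinearMap.mkContinuous
    { toFun := fun y => (memLp_smul_bdd hq y).toLp _
      map_add' := fun y z => by
        rw [← MemLp.toLp_add]
        exact MemLp.toLp_congr _ _ (ae_of_all _ fun x => smul_add _ _ _)
      map_smul' := fun c y => by
        rw [RingHom.id_apply, ← MemLp.toLp_const_smul]
        exact MemLp.toLp_congr _ _ (ae_of_all _ fun x => smul_comm (q x) c (y x)) } ‖hq.toLp q‖ fun y => by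
    rw [mul_comm]
    refine Lp.norm_le_mul_norm_of_ae_le_mul ?_
    filter_upwards [(memLp_smul_bdd hq y).coeFn_toLp, hq.coeFn_toLp] with x h1 h2
    simp only [LinearMap.coe_mk, AddHom.coe_mk]
    rw [h1, h2, norm_smul, mul_comm]
    gcongr
    exact y.norm_coe_le_norm x

theorem coeFn_weightL {q : ℝ → ℂ} (hq : MemLp q 2 volume) (y : B2) :
    (weightL hq y : ℝ → C2) =ᵐ[volume] fun x => q x • y x :=
  (memLp_smul_bdd hq y).coeFn_toLp

/-- Restricted to the support interval, `evG` maps the unit ball to a bounded equi-Lipschitz family,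
so Arzelà–Ascoli applies. Extending by `projIcc` and multiplying by q is continuous into L², and q
erases the values of the extension outside. -/
theorem isCompactOperator_mulL_opG_of_support {q : B} {r : ℝ} (hr : 0 ≤ r)
    (hq : ∀ x, x ∉ Icc (-r) r → q x = 0) : IsCompactOperator (mulL q * opG) := by
  have hq2 : MemLp q 2 volume :=
    q.continuous.memLp_of_hasCompactSupport (HasCompactSupport.intro isCompact_Icc hq)
  let I := Icc (-r) r
  have hI : -r ≤ r := by linarith
  let res : C(I, ℝ) := ⟨Subtype.val, continuous_subtype_val⟩
  let prj : C(ℝ, I) := ⟨projIcc (-r) r hI, continuous_projIcc⟩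
  let S : Set (BoundedContinuousFunction I C2) :=
    (fun h : L2 => (evG h).compContinuous res) '' Metric.closedBall 0 1
  have hS : IsCompact (closure S) := by
    refine BoundedContinuousFunction.arzela_ascoli (Metric.closedBall 0 ‖evG‖)
      (isCompact_closedBall _ _) S ?_ ?_
    · rintro _ x ⟨h, hh, rfl⟩
      rw [mem_closedBall_zero_iff] at hh ⊢
      calc ‖evG h x‖ ≤ ‖evG h‖ := (evG h).norm_coe_le_norm x
        _ ≤ ‖evG‖ * ‖h‖ := evG.le_opNorm h
        _ ≤ ‖evG‖ * 1 := by gcongr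
        _ = _ := mul_one _
    · refine (LipschitzWith.uniformEquicontinuous _ ‖evDG‖₊ ?_).equicontinuous
      rintro ⟨_, h, hh, rfl⟩
      rw [mem_closedBall_zero_iff] at hh
      have h1 : LipschitzWith (‖evDG h‖₊ * 1) (evG h ∘ (Subtype.val : I → ℝ)) :=
        (lipschitzWith_evG h).comp (LipschitzWith.subtype_val _)
      refine h1.weaken ?_
      rw [mul_one]
      change ‖evDG h‖ ≤ ‖evDG‖
      exact (evDG.le_opNorm h).trans (mul_le_of_le_one_right (norm_nonneg _) hh)
  let E : BoundedContinuousFunction I C2 → L2 := fun y => weightL hq2 (y.compContinuous prj)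
  have hE : Continuous E :=
    (weightL hq2).continuous.comp (BoundedContinuousFunction.continuous_compContinuous prj)
  refine ⟨E '' closure S, hS.image hE, mem_of_superset (Metric.closedBall_mem_nhds 0 one_pos) ?_⟩
  intro h hh
  refine ⟨_, subset_closure ⟨h, hh, rfl⟩, ?_⟩
  refine Lp.ext ?_
  refine (coeFn_weightL hq2 _).trans ?_
  filter_upwards [coeFn_mulL q (opG h), coeFn_opG h] with x h1 h2
  have h3 : (mulL q * opG) h = mulL q (opG h) := rfl
  rw [h3, h1, h2]
  by_cases hx : x ∈ Icc (-r) r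
  · have h4 : ((prj x : I) : ℝ) = x := by
      change ((projIcc (-r) r hI x : I) : ℝ) = x
      rw [projIcc_of_mem hI hx]
    change q x • evG h (prj x : I) = q x • evG h x
    rw [h4]
  · rw [hq x hx, zero_smul, zero_smul]

theorem exists_cutoff (q : B) (hq : Tendsto q (cocompact ℝ) (𝓝 0)) {δ : ℝ} (hδ : 0 < δ) :
    ∃ q' : B, ∃ r : ℝ, 0 ≤ r ∧ (∀ x, x ∉ Icc (-r) r → q' x = 0) ∧ ‖q - q'‖ ≤ δ := by
  have h1 : ∀ᶠ x in cocompact ℝ, ‖q x‖ ≤ δ := by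
    have := hq.norm
    rw [norm_zero] at this
    exact this.eventually (ge_mem_nhds hδ)
  obtain ⟨K, hK, hKq⟩ := (hasBasis_cocompact.eventually_iff).1 h1
  obtain ⟨r, hr0, hr⟩ := hK.isBounded.subset_closedBall_lt 0 0
  let ψ : ContDiffBump (0 : ℝ) := ⟨r, r + 1, hr0, by linarith⟩
  have hψ : ∀ x, |ψ x| ≤ 1 := fun x => by rw [abs_of_nonneg ψ.nonneg]; exact ψ.le_one
  let q' : B := BoundedContinuousFunction.ofNormedAddCommGroup (fun x => (ψ x : ℂ) * q x)
    ((Complex.continuous_ofReal.comp ψ.continuous).mul q.continuous) ‖q‖ fun x => by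
      rw [norm_mul, Complex.norm_real]
      exact (mul_le_of_le_one_left (norm_nonneg _) (hψ x)).trans (q.norm_coe_le_norm x)
  refine ⟨q', r + 1, by linarith, fun x hx => ?_, ?_⟩
  · have : ψ x = 0 := ψ.zero_of_le_dist (by
      change r + 1 ≤ _
      rw [dist_zero_right, Real.norm_eq_abs]
      by_contra! h
      exact hx (abs_le.1 h.le))
    change (ψ x : ℂ) * q x = 0
    rw [this]
    simp
  · rw [BoundedContinuousFunction.norm_le hδ.le]
    intro x
    change ‖q x - (ψ x : ℂ) * q x‖ ≤ δ
    by_cases hx : x ∈ K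
    · have : ψ x = 1 := ψ.one_of_mem_closedBall (hr hx)
      rw [this]
      simpa using hδ.le
    · have : q x - (ψ x : ℂ) * q x = ((1 - ψ x : ℝ) : ℂ) * q x := by push_cast; ring
      rw [this, norm_mul, Complex.norm_real]
      refine (mul_le_of_le_one_left (norm_nonneg _) ?_).trans (hKq hx)
      rw [Real.norm_of_nonneg (by linarith [ψ.le_one (x := x)])]
      linarith [ψ.nonneg (x := x)]

/-- A decaying coefficient is a uniform limit of compactly supported ones, and compact operators are
closed under norm limits. -/
theorem isCompactOperator_mulL_opG {q : B} (hq : Tendsto q (cocompact ℝ) (𝓝 0)) :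
    IsCompactOperator (mulL q * opG) := by
  have hn : ∀ n : ℕ, (0 : ℝ) < 1 / (n + 1) := fun n => Nat.one_div_pos_of_nat
  choose q' r hr hr' hd using fun n : ℕ => exists_cutoff q hq (hn n)
  refine isCompactOperator_of_tendsto (F := fun n => mulL (q' n) * opG) (l := atTop) ?_
    (Eventually.of_forall fun n => isCompactOperator_mulL_opG_of_support (hr n) (hr' n))
  have h1 : Tendsto q' atTop (𝓝 q) := by
    rw [tendsto_iff_norm_sub_tendsto_zero]
    refine squeeze_zero (fun _ => norm_nonneg _) (fun n => ?_)
      (tendsto_one_div_add_atTop_nhds_zero_nat (𝕜 := ℝ))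
    rw [norm_sub_rev]
    exact hd n
  have h2 : Tendsto (fun n => mulL (q' n)) atTop (𝓝 (mulL q)) := (mulL.continuous.tendsto q).comp h1
  exact h2.mul_const opG

theorem isCompactOperator_mulL_matL_opG {q : B} (hq : Tendsto q (cocompact ℝ) (𝓝 0))
    (A : Matrix (Fin 2) (Fin 2) ℂ) : IsCompactOperator (mulL q * matL A * opG) := by
  rw [mul_assoc, (commute_matL_opG A).eq, ← mul_assoc]
  exact (isCompactOperator_mulL_opG hq).comp_clm (matL A)

/-! ### Compact perturbations of invertible operators -/

section Fredholm

variable {X : Type*} [NormedAddCommGroup X] [NormedSpace ℂ X] [CompleteSpace X]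

/-- The Fredholm alternative for A + K = A(1 + A⁻¹K): if 1 were a spectral value of the compact
operator -A⁻¹K, it would be an eigenvalue. -/
theorem isUnit_add_of_isCompactOperator {A K : X →L[ℂ] X} (hA : IsUnit A)
    (hK : IsCompactOperator K) (hinj : ∀ x, (A + K) x = 0 → x = 0) : IsUnit (A + K) := by
  obtain ⟨u, rfl⟩ := hA
  have hc : IsCompactOperator (-((↑u⁻¹ : X →L[ℂ] X) * K) : X →L[ℂ] X) :=
    (hK.clm_comp (↑u⁻¹ : X →L[ℂ] X)).neg
  have e : (↑u + K : X →L[ℂ] X) = ↑u * (1 - -((↑u⁻¹ : X →L[ℂ] X) * K)) := by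
    rw [sub_neg_eq_add, mul_add, ← mul_assoc, u.mul_inv, one_mul, mul_one]
  rw [e]
  refine u.isUnit.mul ?_
  rcases hc.hasEigenvalue_or_mem_resolventSet (one_ne_zero (α := ℂ)) with h | h
  · obtain ⟨x, hx⟩ := h.exists_hasEigenvector
    refine absurd (hinj x ?_) hx.2
    have h1 : (-((↑u⁻¹ : X →L[ℂ] X) * K)) x = (1 : ℂ) • x := hx.apply_eq_smul
    rw [e]
    change (u : X →L[ℂ] X) (x - (-((↑u⁻¹ : X →L[ℂ] X) * K)) x) = 0
    rw [h1, one_smul, sub_self, map_zero]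
  · rw [spectrum.mem_resolventSet_iff, map_one] at h
    exact h

/-- The bordered operator `(h, α) ↦ (S h + α φ, ℓ h)`. -/
def bordered (S : X →L[ℂ] X) (φ : X) (ℓ : X →L[ℂ] ℂ) : X × ℂ →L[ℂ] X × ℂ :=
  (S.coprod (ContinuousLinearMap.toSpanSingleton ℂ φ)).prod
    (ℓ ∘L ContinuousLinearMap.fst ℂ X ℂ)

@[simp] theorem bordered_apply (S : X →L[ℂ] X) (φ : X) (ℓ : X →L[ℂ] ℂ) (h : X) (α : ℂ) :
    bordered S φ ℓ (h, α) = (S h + α • φ, ℓ h) := by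
  simp [bordered]

/-- Bordering changes A ⊕ id only by compact terms, so injectivity is enough. -/
theorem isUnit_bordered {A K : X →L[ℂ] X} (hA : IsUnit A) (hK : IsCompactOperator K) (φ : X)
    (ℓ : X →L[ℂ] ℂ) (hinj : ∀ (h : X) (α : ℂ), (A + K) h + α • φ = 0 → ℓ h = 0 → h = 0 ∧ α = 0) :
    IsUnit (bordered (A + K) φ ℓ) := by
  let A' : X × ℂ →L[ℂ] X × ℂ := A.prodMap (ContinuousLinearMap.id ℂ ℂ)
  -- K, the column φ, the row ℓ, and minus the identity on ℂ that was added in `A'`.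
  let K' : X × ℂ →L[ℂ] X × ℂ := ContinuousLinearMap.inl ℂ X ℂ ∘L K ∘L ContinuousLinearMap.fst ℂ X ℂ
    + ((ContinuousLinearMap.inl ℂ X ℂ ∘L ContinuousLinearMap.toSpanSingleton ℂ φ)
        ∘L ContinuousLinearMap.snd ℂ X ℂ
      + ContinuousLinearMap.inr ℂ X ℂ ∘L (ℓ ∘L ContinuousLinearMap.fst ℂ X ℂ
        - ContinuousLinearMap.snd ℂ X ℂ))
  have e : bordered (A + K) φ ℓ = A' + K' := by
    refine ContinuousLinearMap.ext fun ⟨h, α⟩ => ?_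
    simp [A', K', add_assoc]
  rw [e]
  refine isUnit_add_of_isCompactOperator ?_ ?_ ?_
  · rw [ContinuousLinearMap.isUnit_iff_bijective] at hA ⊢
    exact hA.prodMap Function.bijective_id
  · refine IsCompactOperator.add ((hK.clm_comp (ContinuousLinearMap.inl ℂ X ℂ)).comp_clm
      (ContinuousLinearMap.fst ℂ X ℂ)) (IsCompactOperator.add ?_ ?_)
    · exact (isCompactOperator_of_locallyCompactSpace_rng (ContinuousLinearMap.inl ℂ X ℂ ∘L
        ContinuousLinearMap.toSpanSingleton ℂ φ)).comp_clm (ContinuousLinearMap.snd ℂ X ℂ)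
    · exact (isCompactOperator_of_locallyCompactSpace_dom (ℓ ∘L ContinuousLinearMap.fst ℂ X ℂ
        - ContinuousLinearMap.snd ℂ X ℂ)).clm_comp (ContinuousLinearMap.inr ℂ X ℂ)
  · rintro ⟨h, α⟩ hh
    rw [← e, bordered_apply, Prod.mk_eq_zero] at hh
    obtain ⟨rfl, rfl⟩ := hinj h α hh.1 hh.2
    rfl

theorem continuous_bordered (φ : X) (ℓ : X →L[ℂ] ℂ) :
    Continuous fun S : X →L[ℂ] X => bordered S φ ℓ := by
  have : (fun S : X →L[ℂ] X => bordered S φ ℓ) = fun S =>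
      ContinuousLinearMap.inl ℂ X ℂ ∘L S ∘L ContinuousLinearMap.fst ℂ X ℂ + bordered 0 φ ℓ := by
    funext S
    refine ContinuousLinearMap.ext fun ⟨h, α⟩ => ?_
    simp
  rw [this]
  fun_prop

end Fredholm

/-! ### The asymptotic form of the linearization -/

/-- Jacobian of the reaction terms at a constant state. -/
def matJ (m : ℝ) (v : C2) : Matrix (Fin 2) (Fin 2) ℂ :=
  matN m + v 1 ^ 2 • matT0 + (2 * v 0 * v 1) • matT1

theorem mulL_const (c : ℂ) : mulL (BoundedContinuousFunction.const ℝ c) = c • 1 := by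
  refine ContinuousLinearMap.ext fun y => Lp.ext ?_
  filter_upwards [coeFn_mulL (BoundedContinuousFunction.const ℝ c) y, Lp.coeFn_smul c y]
    with x h1 h2
  rw [h1]
  exact h2.symm

/-- Separates the constant coefficients at the limit state v from remainders that decay when U tends
to v. -/
theorem linS_sub_eq_asymptS (d m : ℝ) (f g : B) (U : B2) (v : C2) (μ : ℂ) :
    linS d m f g 0 U - μ • opG = asymptS (-matD d) (matD d + (matJ m v - μ • 1))
      (comp 1 U ^ 2 - BoundedContinuousFunction.const ℝ (v 1 ^ 2))
      (2 * comp 0 U * comp 1 U - BoundedContinuousFunction.const ℝ (2 * v 0 * v 1)) := by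
  rw [linS, asymptS, map_sub mulL, map_sub mulL, mulL_const, mulL_const, matJ]
  simp only [map_add, map_sub, map_neg, map_smul, map_one, zero_smul, add_zero, mul_sub, mul_one,
    sub_mul, add_mul, smul_mul_assoc, one_mul]
  abel

theorem isCompactOperator_asymptS_sub (A₀ A₁ : Matrix (Fin 2) (Fin 2) ℂ) {q₀ q₁ : B}
    (h₀ : Tendsto q₀ (cocompact ℝ) (𝓝 0)) (h₁ : Tendsto q₁ (cocompact ℝ) (𝓝 0)) :
    ∃ K : L2 →L[ℂ] L2, IsCompactOperator K ∧
      asymptS A₀ A₁ q₀ q₁ = (matL A₀ + matL A₁ * opG) + K :=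
  ⟨mulL q₀ * matL matT0 * opG + mulL q₁ * matL matT1 * opG,
    (isCompactOperator_mulL_matL_opG h₀ _).add (isCompactOperator_mulL_matL_opG h₁ _),
    add_assoc _ _ _⟩


/-! ### Reflection -/

theorem reflL_opR (h : L2) : reflL (opR h) = opRm (reflL h) := by
  rw [opRm_apply, reflL_reflL]

theorem reflL_opRm (h : L2) : reflL (opRm h) = opR (reflL h) := by
  rw [opRm_apply, reflL_reflL]

theorem reflL_opG (h : L2) : reflL (opG h) = opG (reflL h) := by
  rw [opG_apply, reflL_opR, reflL_opRm, ← opR_opRm_comm, opG_apply]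

theorem two_smul_opG (h : L2) : (2 : ℂ) • opG h = opR h + opRm h := opR_opRm h

theorem reflL_opDG (h : L2) : reflL (opDG h) = -opDG (reflL h) := by
  rw [opDG_apply, opDG_apply, map_sub, reflL_opRm, reflL_opG]
  have := two_smul_opG (reflL h)
  rw [two_smul] at this
  have h2 : opR (reflL h) = opG (reflL h) + opG (reflL h) - opRm (reflL h) := by
    rw [this, add_sub_cancel_right]
  rw [h2]
  abel

theorem reflL_mulL (q : B) (y : L2) : reflL (mulL q y) = mulL (reflB ℂ q) (reflL y) := by
  refine Lp.ext ?_
  filter_upwards [coeFn_reflL (mulL q y), coeFn_mulL (reflB ℂ q) (reflL y), coeFn_reflL y,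
    ae_comp_neg (p := fun x => mulL q y x = q x • y x) (coeFn_mulL q y)] with x h1 h2 h3 h4
  rw [h1, h4, h2, h3, reflB_apply]

theorem inner_reflL (k h : L2) : inner ℂ k (reflL h) = inner ℂ (reflL k) h := by
  have hi : ∀ y z : L2, inner ℂ (reflL y) (reflL z) = inner ℂ y z := fun y z =>
    (Lp.compMeasurePreservingₗᵢ ℂ (fun x : ℝ => -x)
      (Measure.measurePreserving_neg volume)).inner_map_map y z
  rw [← hi, reflL_reflL]

theorem evG_eq_of_ae {h : L2} {y : B2} (hy : (opG h : ℝ → C2) =ᵐ[volume] y) : evG h = y :=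
  BoundedContinuousFunction.ext fun x =>
    congrFun ((Continuous.ae_eq_iff_eq volume (evG h).continuous y.continuous).1
      ((coeFn_opG h).symm.trans hy)) x

theorem evG_reflL (h : L2) : evG (reflL h) = reflB C2 (evG h) := by
  refine evG_eq_of_ae ?_
  rw [← reflL_opG]
  filter_upwards [coeFn_reflL (opG h),
    ae_comp_neg (p := fun x => opG h x = evG h x) (coeFn_opG h)] with x h1 h2
  rw [h1, h2, reflB_apply]

/-! ### Complex conjugation -/

/-- Complex conjugation on `ℂ²`. -/
def conjC : C2 →L[ℝ] C2 :=
  LinearMap.toContinuousLinearMap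
    { toFun := fun v => WithLp.toLp 2 fun i => star (v i)
      map_add' := fun v w => by
        ext i
        exact star_add (v i) (w i)
      map_smul' := fun c v => by
        ext i
        simp }

@[simp] theorem conjC_apply (v : C2) (i : Fin 2) : conjC v i = star (v i) := rfl

theorem conjC_smul (c : ℂ) (v : C2) : conjC (c • v) = star c • conjC v := by
  ext i
  simp

theorem conjC_matC {A : Matrix (Fin 2) (Fin 2) ℂ} (hA : ∀ i j, star (A i j) = A i j) (v : C2) :
    conjC (matC A v) = matC A (conjC v) := by
  ext i
  rw [conjC_apply, matC_apply, matC_apply, star_add, star_mul', star_mul', hA, hA, conjC_apply,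
    conjC_apply]

/-- Complex conjugation on `L²`. -/
def conjL : L2 →L[ℝ] L2 := conjC.compLpL 2 volume

theorem coeFn_conjL (h : L2) : (conjL h : ℝ → C2) =ᵐ[volume] fun x => conjC (h x) :=
  ContinuousLinearMap.coeFn_compLpL _ h

/-- Complex conjugation of bounded continuous profiles. -/
def conjB : B2 →L[ℝ] B2 := conjC.compLeftContinuousBounded ℝ

@[simp] theorem conjB_apply (y : B2) (x : ℝ) : conjB y x = conjC (y x) := rfl

theorem conjL_smul (c : ℂ) (h : L2) : conjL (c • h) = star c • conjL h := by
  refine Lp.ext ?_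
  filter_upwards [coeFn_conjL (c • h), Lp.coeFn_smul c h, Lp.coeFn_smul (star c) (conjL h),
    coeFn_conjL h] with x h1 h2 h3 h4
  rw [h1, h2, h3, Pi.smul_apply, Pi.smul_apply, h4, conjC_smul]

theorem conjL_matL {A : Matrix (Fin 2) (Fin 2) ℂ} (hA : ∀ i j, star (A i j) = A i j) (h : L2) :
    conjL (matL A h) = matL A (conjL h) := by
  refine Lp.ext ?_
  filter_upwards [coeFn_conjL (matL A h), coeFn_matL A h, coeFn_matL A (conjL h),
    coeFn_conjL h] with x h1 h2 h3 h4
  rw [h1, h2, h3, h4, conjC_matC hA]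

theorem conjL_mulL (q : B) (h : L2) : conjL (mulL q h) = mulL (star q) (conjL h) := by
  refine Lp.ext ?_
  filter_upwards [coeFn_conjL (mulL q h), coeFn_mulL q h, coeFn_mulL (star q) (conjL h),
    coeFn_conjL h] with x h1 h2 h3 h4
  rw [h1, h2, h3, h4, conjC_smul]
  rfl

theorem conjL_reflL (h : L2) : conjL (reflL h) = reflL (conjL h) := by
  refine Lp.ext ?_
  filter_upwards [coeFn_conjL (reflL h), coeFn_reflL h, coeFn_reflL (conjL h),
    ae_comp_neg (p := fun x => conjL h x = conjC (h x)) (coeFn_conjL h)] with x h1 h2 h3 h4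
  rw [h1, h2, h3, h4]

theorem conjL_opR (h : L2) : conjL (opR h) = opR (conjL h) := by
  refine Lp.ext ?_
  filter_upwards [coeFn_conjL (opR h), coeFn_opR h, coeFn_opR (conjL h)] with x h1 h2 h3
  rw [h1, h2, h3, expInt_congr (coeFn_conjL h), expInt, expInt]
  rw [← conjC.integral_comp_comm (integrableOn_expKernel (Lp.memLp h) x)]
  exact integral_congr_ae (ae_of_all _ fun t => conjC.map_smul _ _)

theorem conjL_opRm (h : L2) : conjL (opRm h) = opRm (conjL h) := by
  rw [opRm_apply, conjL_reflL, conjL_opR, conjL_reflL, opRm_apply]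

theorem conjL_opG (h : L2) : conjL (opG h) = opG (conjL h) := by
  rw [opG_apply, conjL_opR, conjL_opRm, opG_apply]

theorem conjL_opDG (h : L2) : conjL (opDG h) = opDG (conjL h) := by
  rw [opDG_apply, map_sub, conjL_opRm, conjL_opG, opDG_apply]

theorem evG_conjL (h : L2) : evG (conjL h) = conjB (evG h) := by
  refine evG_eq_of_ae ?_
  rw [← conjL_opG]
  filter_upwards [coeFn_conjL (opG h), coeFn_opG h] with x h1 h2
  rw [h1, h2, conjB_apply]

theorem inner_conjL (k h : L2) : inner ℂ (conjL k) (conjL h) = star (inner ℂ k h) := by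
  rw [L2.inner_def, L2.inner_def]
  have : star (∫ x, inner ℂ (k x) (h x)) = ∫ x, star (inner ℂ (k x) (h x)) :=
    integral_conj.symm
  rw [this]
  refine integral_congr_ae ?_
  filter_upwards [coeFn_conjL k, coeFn_conjL h] with x h1 h2
  simp only [h1, h2]
  simp [PiLp.inner_apply]

/-! ### Symmetries of the resolvent on bounded continuous functions -/

/-- A map that commutes with ∂ up to the sign s commutes with ∂², hence with its resolvent by
uniqueness of bounded solutions. Reflection has s = -1; conjugation and translation have s = 1. -/
theorem bdG_symmetry {σ : B2 → B2} {s : ℝ} (hs : s * s = 1)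
    (hsub : ∀ y z, σ (y - z) = σ y - σ z)
    (hσ : ∀ y y' : B2, (∀ x, HasDerivAt y (y' x) x) → ∀ x, HasDerivAt (σ y) (s • σ y' x) x)
    (k : B2) : bdG C2 one_re_pos (σ k) = σ (bdG C2 one_re_pos k) ∧
      bdDG C2 one_re_pos (σ k) = s • σ (bdDG C2 one_re_pos k) := by
  have e2 : ∀ x, HasDerivAt (bdDG C2 one_re_pos k) ((bdG C2 one_re_pos k - k) x) x := fun x => by
    refine (hasDerivAt_bdDG one_re_pos k x).congr_deriv ?_
    simp
  have e1 : σ (bdG C2 one_re_pos k) = bdG C2 one_re_pos (σ k) := by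
    refine eq_bdG one_re_pos (y' := s • σ (bdDG C2 one_re_pos k))
      (fun x => hσ _ _ (hasDerivAt_bdG one_re_pos k) x) fun x => ?_
    have := (hσ _ _ e2 x).const_smul s
    refine this.congr_deriv ?_
    rw [hsub, smul_smul, hs]
    simp
  refine ⟨e1.symm, BoundedContinuousFunction.ext fun x => ?_⟩
  have h1 := hasDerivAt_bdG one_re_pos (σ k) x
  rw [← e1] at h1
  exact h1.unique (hσ _ _ (hasDerivAt_bdG one_re_pos k) x)

theorem conjB_hasDerivAt {y y' : B2} (h : ∀ x, HasDerivAt y (y' x) x) (x : ℝ) :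
    HasDerivAt (conjB y) ((1 : ℝ) • conjB y' x) x := by
  rw [one_smul]
  exact conjC.hasFDerivAt.comp_hasDerivAt x (h x)

theorem reflB_hasDerivAt {y y' : B2} (h : ∀ x, HasDerivAt y (y' x) x) (x : ℝ) :
    HasDerivAt (reflB C2 y) ((-1 : ℝ) • reflB C2 y' x) x :=
  (h (-x)).scomp x (hasDerivAt_neg x)

/-- Translation of bounded continuous profiles. -/
def shiftB (T : ℝ) (y : B2) : B2 := y.compContinuous ⟨fun x => x + T, by fun_prop⟩

@[simp] theorem shiftB_apply (T : ℝ) (y : B2) (x : ℝ) : shiftB T y x = y (x + T) := rfl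

theorem continuous_shiftB (T : ℝ) : Continuous (shiftB T) :=
  BoundedContinuousFunction.continuous_compContinuous _

theorem shiftB_hasDerivAt {T : ℝ} {y y' : B2} (h : ∀ x, HasDerivAt y (y' x) x) (x : ℝ) :
    HasDerivAt (shiftB T y) ((1 : ℝ) • shiftB T y' x) x := by
  rw [one_smul]
  exact (h (x + T)).comp_add_const x T

/-! ### The implicit function theorem for curves -/

section Implicit

variable {X Y : Type*} [NormedAddCommGroup X] [NormedSpace ℂ X] [CompleteSpace X]
  [NormedAddCommGroup Y] [NormedSpace ℂ Y] [CompleteSpace Y]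

/-- Local uniqueness is recorded along with the curve, because it carries the symmetry arguments and
the description of the spectrum near zero. -/
theorem exists_implicit_curve {F : ℂ × X → Y} {x₀ : X} {n : ℕ∞ω} (hn : n ≠ 0)
    (hF : ContDiffAt ℂ n F (0, x₀)) (h₀ : F (0, x₀) = 0) {F' : X →L[ℂ] Y}
    (hF' : HasFDerivAt (fun x => F (0, x)) F' x₀) (hb : Function.Bijective F') :
    ∃ ψ : ℂ → X, ψ 0 = x₀ ∧ ContDiffAt ℂ n ψ 0 ∧ (∀ᶠ ε in 𝓝 0, F (ε, ψ ε) = 0) ∧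
      ∀ᶠ p in 𝓝 ((0, x₀) : ℂ × X), F p = 0 → p.2 = ψ p.1 := by
  have hd : fderiv ℂ F (0, x₀) ∘L ContinuousLinearMap.inr ℂ ℂ X = F' := by
    have h1 : HasFDerivAt F (fderiv ℂ F (0, x₀)) (0, x₀) := (hF.differentiableAt hn).hasFDerivAt
    have h2 : HasFDerivAt (fun x : X => ((0 : ℂ), x)) (ContinuousLinearMap.inr ℂ ℂ X) x₀ :=
      hasFDerivAt_prodMk_right 0 x₀
    exact (HasFDerivAt.comp (g := F) x₀ h1 h2).unique hF'
  have hi : (fderiv ℂ F (0, x₀) ∘L ContinuousLinearMap.inr ℂ ℂ X).IsInvertible := by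
    rw [hd]
    exact ⟨ContinuousLinearEquiv.ofBijective F' (LinearMap.ker_eq_bot.2 hb.1)
      (LinearMap.range_eq_top.2 hb.2), ContinuousLinearEquiv.coe_ofBijective _ _ _⟩
  refine ⟨hF.implicitFunction hn hi, hF.implicitFunction_apply_self hn hi,
    hF.contDiffAt_implicitFunction hn hi, ?_, ?_⟩
  · filter_upwards [hF.eventually_apply_implicitFunction hn hi] with ε hε
    rw [hε, h₀]
  · filter_upwards [hF.eventually_apply_eq_iff_implicitFunction hn hi] with p hp h
    exact (hp.1 (h.trans h₀.symm)).symm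

/-- σ maps the zero on the curve to another zero close to x₀, which must be the same one. The filter
`l` allows for symmetries that hold only for real ε, such as conjugation. -/
theorem implicit_curve_symm {F : ℂ × X → Y} {x₀ : X} {ψ : ℂ → X} (hψ₀ : ψ 0 = x₀)
    (hψ : ContinuousAt ψ 0) (hF : ∀ᶠ ε in 𝓝 (0 : ℂ), F (ε, ψ ε) = 0)
    (hu : ∀ᶠ p in 𝓝 ((0, x₀) : ℂ × X), F p = 0 → p.2 = ψ p.1) {σ : X → X} (hσ : Continuous σ)
    (hσ₀ : σ x₀ = x₀)
    {l : Filter ℂ} (hl : l ≤ 𝓝 0) (hs : ∀ᶠ ε in l, ∀ x, F (ε, x) = 0 → F (ε, σ x) = 0) :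
    ∀ᶠ ε in l, σ (ψ ε) = ψ ε := by
  have h1 : Tendsto (fun ε : ℂ => (ε, σ (ψ ε))) (𝓝 0) (𝓝 (0, x₀)) := by
    refine Tendsto.prodMk_nhds tendsto_id ?_
    have h2 := (hσ.tendsto (ψ 0)).comp hψ
    rwa [hψ₀, hσ₀] at h2
  filter_upwards [hl (h1.eventually hu), hl hF, hs] with ε a1 a2 a3
  exact a1 (a3 _ a2)

theorem map_ofReal_le : map (fun ε : ℝ => (ε : ℂ)) (𝓝 0) ≤ 𝓝 0 := by
  have := Complex.continuous_ofReal.tendsto 0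
  rwa [Complex.ofReal_zero] at this

end Implicit


/-! ### Decay of `H²` profiles -/

/-- With y and y' in L², both |y|² and its derivative are integrable, so |y|² tends to zero. -/
theorem tendsto_evG_atTop (h : L2) : Tendsto (evG h) atTop (𝓝 0) := by
  have hy : MemLp (evG h) 2 volume := (memLp_congr_ae (coeFn_opG h)).1 (Lp.memLp _)
  have hy' : MemLp (evDG h) 2 volume := (memLp_congr_ae (coeFn_opDG h)).1 (Lp.memLp _)
  have hint : ∀ {p q : ℝ → C2}, MemLp p 2 volume → MemLp q 2 volume →
      Integrable (fun x => inner ℂ (p x) (q x)) volume := fun {p q} hp hq => by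
    refine (L2.integrable_inner (𝕜 := ℂ) (hp.toLp p) (hq.toLp q)).congr ?_
    filter_upwards [hp.coeFn_toLp, hq.coeFn_toLp] with x h1 h2
    rw [h1, h2]
  have hd : ∀ x, HasDerivAt (fun x => inner ℂ (evG h x) (evG h x))
      (inner ℂ (evG h x) (evDG h x) + inner ℂ (evDG h x) (evG h x)) x := fun x =>
    (hasDerivAt_evG h x).inner ℂ (hasDerivAt_evG h x)
  have h0 := tendsto_zero_of_hasDerivAt_of_integrableOn_Ioi (a := 0) (fun x _ => hd x)
    ((hint hy hy').add (hint hy' hy)).integrableOn (hint hy hy).integrableOn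
  have h1 : Tendsto (fun x => ‖evG h x‖ ^ 2) atTop (𝓝 0) := by
    have h2 := h0.norm
    rw [norm_zero] at h2
    refine h2.congr fun x => ?_
    rw [inner_self_eq_norm_sq_to_K, norm_pow]
    simp
  rw [tendsto_zero_iff_norm_tendsto_zero]
  have h2 := h1.sqrt
  rw [Real.sqrt_zero] at h2
  exact h2.congr fun x => Real.sqrt_sq (norm_nonneg _)

theorem tendsto_evG_cocompact (h : L2) : Tendsto (evG h) (cocompact ℝ) (𝓝 0) := by
  rw [cocompact_eq_atBot_atTop]
  refine Tendsto.sup ?_ (tendsto_evG_atTop h)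
  have h1 := (tendsto_evG_atTop (reflL h)).comp tendsto_neg_atBot_atTop
  refine h1.congr fun x => ?_
  rw [evG_reflL]
  simp

/-! ### Standing waves with a simple zero eigenvalue -/

/-- The profile equation for `z = G h` on the background `V` reads `profS d m f g ε V z h = 0`. -/
def profS (d m : ℝ) (f g : B) (ε : ℂ) (V ζ : B2) : L2 →L[ℂ] L2 :=
  matL (matD d) * (opG - 1)
    + ε • (mulL f * matL matE * opDG + mulL g * matL matE * opG)
    -- The cubic terms come from (V₀ + ζ₀)(V₁ + ζ₁)² - V₀V₁² = (V₁ + ζ₁)²ζ₀ + V₀(2V₁ + ζ₁)ζ₁ with ζ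
    -- = G h.
    + matL (matN m) * opG + mulL ((comp 1 V + comp 1 ζ) ^ 2) * matL matT0 * opG
    + mulL (comp 0 V * (2 * comp 1 V + comp 1 ζ)) * matL matT1 * opG

theorem linS_zero (d m : ℝ) (f g : B) (U : B2) : linS d m f g 0 U = linS d m 0 0 0 U := by
  rw [linS, linS, zero_smul, zero_smul]

theorem profS_zero (d m : ℝ) (f g : B) (V ζ : B2) : profS d m f g 0 V ζ = profS d m 0 0 0 V ζ := by
  rw [profS, profS, zero_smul, zero_smul]

/-- A spectrally stable even standing wave of the unperturbed system, on the constant background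
`v` and with profile `G h`. The translational mode is `G η`, and `Ψ` is the normalized adjoint
zero mode. -/
structure Wave (d a m : ℝ) where
  v : C2
  h : L2
  η : L2
  Ψ : L2
  ϱ : ℝ
  d_pos : 0 < d
  ϱ_pos : 0 < ϱ
  conj_v : conjC v = v
  react_zero : -v 0 - v 0 * v 1 ^ 2 + a = 0
  react_one : -m * v 1 + v 0 * v 1 ^ 2 = 0
  profile : profS d m 0 0 0 (BoundedContinuousFunction.const ℝ v) (evG h) h = 0
  conj_h : conjL h = h
  refl_h : reflL h = h
  opG_η : opG η = opDG h
  η_ne_zero : η ≠ 0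
  S_η : linS d m 0 0 0 (BoundedContinuousFunction.const ℝ v + evG h) η = 0
  kernel : ∀ k, linS d m 0 0 0 (BoundedContinuousFunction.const ℝ v + evG h) k = 0 →
    ∃ c : ℂ, k = c • η
  inner_S : ∀ k, inner ℂ Ψ (linS d m 0 0 0 (BoundedContinuousFunction.const ℝ v + evG h) k) = 0
  inner_η : inner ℂ Ψ (opG η) = 1
  isUnit : ∀ μ : ℂ, μ ≠ 0 → -ϱ < μ.re →
    IsUnit (linS d m 0 0 0 (BoundedContinuousFunction.const ℝ v + evG h) - μ • opG)

namespace Wave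

variable {d a m : ℝ} (W : Wave d a m)

/-- The full state of the wave. -/
def U : B2 := BoundedContinuousFunction.const ℝ W.v + evG W.h

/-- The linearization about the wave, composed with `(1 - ∂²)⁻¹`. -/
def S : L2 →L[ℂ] L2 := linS d m 0 0 0 W.U

/-- The translational mode. -/
def Φ : L2 := opG W.η

/-- The phase functional `h ↦ ⟨Φ, G h⟩`. -/
def ℓ : L2 →L[ℂ] ℂ := innerSL ℂ W.Φ ∘L opG

theorem ℓ_apply (k : L2) : W.ℓ k = inner ℂ W.Φ (opG k) := rfl

theorem Φ_ne_zero : W.Φ ≠ 0 := fun h => W.η_ne_zero (opG_injective (by rw [map_zero]; exact h))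

theorem ℓ_η_ne_zero : W.ℓ W.η ≠ 0 := by
  rw [ℓ_apply]
  exact inner_self_ne_zero.2 W.Φ_ne_zero

theorem conj_Φ : conjL W.Φ = W.Φ := by
  rw [Φ, W.opG_η, conjL_opDG, W.conj_h]

theorem refl_Φ : reflL W.Φ = -W.Φ := by
  rw [Φ, W.opG_η, reflL_opDG, W.refl_h]

theorem conj_η : conjL W.η = W.η :=
  opG_injective (by rw [← conjL_opG]; exact W.conj_Φ)

theorem tendsto_coeff_zero : Tendsto (comp 1 W.U ^ 2
    - BoundedContinuousFunction.const ℝ (W.v 1 ^ 2) : B) (cocompact ℝ) (𝓝 0) := by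
  have h1 : Tendsto (fun x => (W.v + evG W.h x)) (cocompact ℝ) (𝓝 (W.v + 0)) :=
    tendsto_const_nhds.add (tendsto_evG_cocompact W.h)
  have hc : Continuous fun y : C2 => y 1 ^ 2 - W.v 1 ^ 2 := by fun_prop
  have := (hc.tendsto _).comp h1
  simp only [add_zero, sub_self] at this
  exact this

theorem tendsto_coeff_one : Tendsto (2 * comp 0 W.U * comp 1 W.U
    - BoundedContinuousFunction.const ℝ (2 * W.v 0 * W.v 1) : B) (cocompact ℝ) (𝓝 0) := by
  have h1 : Tendsto (fun x => (W.v + evG W.h x)) (cocompact ℝ) (𝓝 (W.v + 0)) :=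
    tendsto_const_nhds.add (tendsto_evG_cocompact W.h)
  have hc : Continuous fun y : C2 => 2 * y 0 * y 1 - 2 * W.v 0 * W.v 1 := by fun_prop
  have := (hc.tendsto _).comp h1
  simp only [add_zero, sub_self] at this
  exact this

/-- Wave packets of frequency √κ handle the nonzero μ to the right of -ϱ, and the determinant gap
transfers the conclusion to μ = 0. -/
theorem symbol_ne_zero (t : ℝ) (ht : t ∈ Icc (0 : ℝ) 1) :
    (-matD d + (t : ℂ) • (matD d + matJ m W.v)).det ≠ 0 := by
  refine det_add_smul_ne_zero W.d_pos (fun κ hκ => ?_) ht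
  refine symbol_det_ne_zero W.d_pos W.ϱ_pos _ (fun μ hμ hre κ hκ => ?_) hκ
  have hu := W.isUnit μ hμ hre
  rw [linS_sub_eq_asymptS d m 0 0 _ W.v μ] at hu
  have := det_ne_zero_of_isUnit (W.tendsto_coeff_zero.mono_left atTop_le_cocompact)
    (W.tendsto_coeff_one.mono_left atTop_le_cocompact) hu (Real.sqrt κ)
  convert this using 2
  rw [← Complex.ofReal_pow, Real.sq_sqrt hκ]
  module

theorem isUnit_constL :
    IsUnit (matL (-matD d) + matL (matD d + matJ m W.v) * opG) :=
  isUnit_symbol spectrum_opG_subset matL commute_matL_opG _ _ W.symbol_ne_zero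

/-- The same symbol governs bounded functions; this is the invertibility needed to perturb the
constant state into a periodic background. -/
theorem isUnit_constB :
    IsUnit (matB (-matD d) + matB (matD d + matJ m W.v) * bdG C2 one_re_pos) :=
  isUnit_symbol spectrum_bdG_subset matB commute_matB_bdG _ _ W.symbol_ne_zero

/-- For injectivity, pairing S k + αΦ = 0 with Ψ gives α = 0, because Ψ annihilates the range of S
and ⟨Ψ, Φ⟩ = 1. Then k = cη, and ℓ(η) = ‖Φ‖² ≠ 0 gives c = 0. -/
theorem isUnit_bordered : IsUnit (bordered W.S W.Φ W.ℓ) := by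
  obtain ⟨K, hK, e⟩ := isCompactOperator_asymptS_sub (-matD d) (matD d + matJ m W.v)
    W.tendsto_coeff_zero W.tendsto_coeff_one
  have eS : W.S = (matL (-matD d) + matL (matD d + matJ m W.v) * opG) + K := by
    have := linS_sub_eq_asymptS d m 0 0 W.U W.v 0
    rw [zero_smul, sub_zero, zero_smul, sub_zero, e] at this
    exact this
  rw [eS]
  refine Klausmeier.isUnit_bordered W.isUnit_constL hK W.Φ W.ℓ fun k α h1 h2 => ?_
  rw [← eS] at h1
  have hα : α = 0 := by
    have h3 := congrArg (fun y => inner ℂ W.Ψ y) h1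
    simp only [inner_add_right, inner_smul_right, inner_zero_right] at h3
    have h4 : inner ℂ W.Ψ (W.S k) = 0 := W.inner_S k
    have h5 : inner ℂ W.Ψ W.Φ = 1 := W.inner_η
    rw [h4, h5, zero_add, mul_one] at h3
    exact h3
  refine ⟨?_, hα⟩
  rw [hα, zero_smul, add_zero] at h1
  obtain ⟨c, rfl⟩ := W.kernel k h1
  rw [map_smul, smul_eq_mul] at h2
  rw [(mul_eq_zero.1 h2).resolve_right W.ℓ_η_ne_zero, zero_smul]

end Wave


/-! ### The periodic background -/

/-- Embedding of scalar functions as the `i`-th component. -/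
def incl (i : Fin 2) : B →L[ℂ] B2 :=
  (ContinuousLinearMap.toSpanSingleton ℂ
    (EuclideanSpace.single i (1 : ℂ) : C2)).compLeftContinuousBounded ℝ

theorem incl_apply (i : Fin 2) (c : B) (x : ℝ) :
    incl i c x = c x • (EuclideanSpace.single i (1 : ℂ) : C2) := rfl

theorem matB_apply_apply (A : Matrix (Fin 2) (Fin 2) ℂ) (y : B2) (x : ℝ) (i : Fin 2) :
    matB A y x i = A i 0 * y x 0 + A i 1 * y x 1 := by
  rw [matB_apply, matC_apply]

/-- The background `v + (1 - ∂²)⁻¹ k`. -/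
def background (v : C2) (k : B2) : B2 := BoundedContinuousFunction.const ℝ v + bdG C2 one_re_pos k

/-- The stationary equation for the background. -/
def bgEq (d a m : ℝ) (f g : B) (v : C2) (p : ℂ × B2) : B2 :=
  matB (matD d) (bdG C2 one_re_pos p.2 - p.2)
    + p.1 • incl 0 (f * comp 0 (bdDG C2 one_re_pos p.2) + g * comp 0 (background v p.2))
    + matB (matN m) (background v p.2)
    + (incl 1 - incl 0) (comp 0 (background v p.2) * comp 1 (background v p.2) ^ 2)
    + BoundedContinuousFunction.const ℝ (EuclideanSpace.single 0 (a : ℂ))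

theorem bgEq_apply_zero (d a m : ℝ) (f g : B) (v : C2) (ε : ℂ) (k : B2) (x : ℝ) :
    bgEq d a m f g v (ε, k) x 0 = bdG C2 one_re_pos k x 0 - k x 0
      + ε * (f x * bdDG C2 one_re_pos k x 0 + g x * (v 0 + bdG C2 one_re_pos k x 0))
      - (v 0 + bdG C2 one_re_pos k x 0)
      - (v 0 + bdG C2 one_re_pos k x 0) * (v 1 + bdG C2 one_re_pos k x 1) ^ 2 + a := by
  simp [bgEq, background, matB_apply_apply, incl_apply, matD, matN]
  ring

theorem bgEq_apply_one (d a m : ℝ) (f g : B) (v : C2) (ε : ℂ) (k : B2) (x : ℝ) :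
    bgEq d a m f g v (ε, k) x 1 = d ^ 2 * (bdG C2 one_re_pos k x 1 - k x 1)
      - m * (v 1 + bdG C2 one_re_pos k x 1)
      + (v 0 + bdG C2 one_re_pos k x 0) * (v 1 + bdG C2 one_re_pos k x 1) ^ 2 := by
  simp [bgEq, background, matB_apply_apply, incl_apply, matD, matN]
  ring

theorem contDiff_bgEq (d a m : ℝ) (f g : B) (v : C2) {n : ℕ∞ω} :
    ContDiff ℂ n (bgEq d a m f g v) := by
  unfold bgEq background
  fun_prop

theorem bgEq_conj {d a m : ℝ} {f g : B} {v : C2} (hf : star f = f) (hg : star g = g)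
    (hv : conjC v = v) (ε : ℝ) (k : B2) :
    bgEq d a m f g v (ε, conjB k) = conjB (bgEq d a m f g v (ε, k)) := by
  obtain ⟨e1, e2⟩ := bdG_symmetry (σ := conjB) (s := 1) (one_mul 1) (map_sub conjB)
    (fun _ _ h => conjB_hasDerivAt h) k
  have hf' : ∀ x, star (f x) = f x := fun x => congrArg (fun q : B => q x) hf
  have hg' : ∀ x, star (g x) = g x := fun x => congrArg (fun q : B => q x) hg
  have hv' : ∀ i, star (v i) = v i := fun i => congrArg (fun q : C2 => q i) hv
  refine BoundedContinuousFunction.ext fun x => ?_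
  ext i
  fin_cases i
  · simp only [Fin.zero_eta, conjB_apply, conjC_apply]
    rw [bgEq_apply_zero, bgEq_apply_zero, e1, e2, one_smul]
    simp only [conjB_apply, conjC_apply, star_add, star_sub, star_mul', star_pow, hf', hg', hv']
    simp
  · simp only [Fin.mk_one, conjB_apply, conjC_apply]
    rw [bgEq_apply_one, bgEq_apply_one, e1]
    simp only [conjB_apply, conjC_apply, star_add, star_sub, star_mul', star_pow, hv']
    simp

/-- Since ∂ changes sign under reflection, oddness of f is what makes the advection term f∂
invariant. -/
theorem bgEq_refl {d a m : ℝ} {f g : B} {v : C2} (hf : reflB ℂ f = -f) (hg : reflB ℂ g = g)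
    (ε : ℂ) (k : B2) :
    bgEq d a m f g v (ε, reflB C2 k) = reflB C2 (bgEq d a m f g v (ε, k)) := by
  obtain ⟨e1, e2⟩ := bdG_symmetry (σ := reflB C2) (s := -1) (by norm_num) (map_sub (reflB C2))
    (fun _ _ h => reflB_hasDerivAt h) k
  have hf' : ∀ x, f (-x) = -f x := fun x => congrArg (fun q : B => q x) hf
  have hg' : ∀ x, g (-x) = g x := fun x => congrArg (fun q : B => q x) hg
  refine BoundedContinuousFunction.ext fun x => ?_
  ext i
  fin_cases i
  · simp only [Fin.zero_eta, reflB_apply]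
    rw [bgEq_apply_zero, bgEq_apply_zero, e1, e2, hf', hg']
    simp
  · simp only [Fin.mk_one, reflB_apply]
    rw [bgEq_apply_one, bgEq_apply_one, e1]
    simp

theorem bgEq_shift {d a m T : ℝ} {f g : B} {v : C2} (hf : ∀ x, f (x + T) = f x)
    (hg : ∀ x, g (x + T) = g x) (ε : ℂ) (k : B2) :
    bgEq d a m f g v (ε, shiftB T k) = shiftB T (bgEq d a m f g v (ε, k)) := by
  obtain ⟨e1, e2⟩ := bdG_symmetry (σ := shiftB T) (s := 1) (one_mul 1) (fun _ _ => rfl)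
    (fun _ _ h => shiftB_hasDerivAt h) k
  refine BoundedContinuousFunction.ext fun x => ?_
  ext i
  fin_cases i
  · simp only [Fin.zero_eta, shiftB_apply]
    rw [bgEq_apply_zero, bgEq_apply_zero, e1, e2, one_smul, hf, hg]
    simp
  · simp only [Fin.mk_one, shiftB_apply]
    rw [bgEq_apply_one, bgEq_apply_one, e1]
    simp

namespace Wave

variable {d a m : ℝ} (W : Wave d a m)

theorem bgEq_zero (f g : B) : bgEq d a m f g W.v (0, 0) = 0 := by
  have h0 := W.react_zero
  have h1 := W.react_one
  refine BoundedContinuousFunction.ext fun x => ?_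
  ext i
  fin_cases i
  · simp only [Fin.zero_eta]
    rw [bgEq_apply_zero, map_zero, map_zero]
    simp
    linear_combination h0
  · simp only [Fin.mk_one]
    rw [bgEq_apply_one, map_zero]
    simp
    linear_combination h1

theorem hasFDerivAt_bgEq (f g : B) : HasFDerivAt (fun k => bgEq d a m f g W.v (0, k))
    (matB (-matD d) + matB (matD d + matJ m W.v) * bdG C2 one_re_pos) 0 := by
  have hb : HasFDerivAt (background W.v) (bdG C2 one_re_pos) 0 :=
    (bdG C2 one_re_pos).hasFDerivAt.const_add _
  have h1 : HasFDerivAt (fun k : B2 => matB (matD d) (bdG C2 one_re_pos k - k))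
      (matB (matD d) ∘L (bdG C2 one_re_pos - ContinuousLinearMap.id ℂ B2)) 0 :=
    (matB (matD d) ∘L (bdG C2 one_re_pos - ContinuousLinearMap.id ℂ B2)).hasFDerivAt
  have h2 := (matB (matN m)).hasFDerivAt.comp (0 : B2) hb
  have c0 := (comp 0).hasFDerivAt.comp (0 : B2) hb
  have c1 := (comp 1).hasFDerivAt.comp (0 : B2) hb
  have h3 := (incl 1 - incl 0).hasFDerivAt.comp (0 : B2) (c0.mul (c1.pow 2))
  have e : (fun k => bgEq d a m f g W.v (0, k)) = fun k =>
      matB (matD d) (bdG C2 one_re_pos k - k) + matB (matN m) (background W.v k)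
      + (incl 1 - incl 0) (comp 0 (background W.v k) * comp 1 (background W.v k) ^ 2)
      + BoundedContinuousFunction.const ℝ (EuclideanSpace.single 0 (a : ℂ)) := by
    funext k
    have h0 : (0 : ℂ) • incl 0 (f * comp 0 (bdDG C2 one_re_pos k)
        + g * comp 0 (background W.v k)) = 0 :=
      BoundedContinuousFunction.ext fun x => zero_smul ℂ (_ : C2)
    simp only [bgEq, h0, add_zero]
  rw [e]
  refine (((h1.add h2).add h3).add_const _).congr_fderiv ?_
  refine ContinuousLinearMap.ext fun k => BoundedContinuousFunction.ext fun x => ?_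
  ext i
  fin_cases i
  · simp [background, matB_apply_apply, incl_apply, matD, matN, matJ, matT0, matT1]
    ring
  · simp [background, matB_apply_apply, incl_apply, matD, matN, matJ, matT0, matT1]
    ring

end Wave


/-! ### The profile and eigenvalue equations -/

theorem mulL_mul (p q : B) (y : L2) : mulL (p * q) y = mulL p (mulL q y) := by
  refine Lp.ext ?_
  filter_upwards [coeFn_mulL (p * q) y, coeFn_mulL p (mulL q y), coeFn_mulL q y] with x h1 h2 h3
  rw [h1, h2, h3, smul_smul]
  rfl

theorem matC_T0 (y : C2) : matC matT0 y = y 0 • !₂[-1, 1] := by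
  ext i
  rw [matC_apply]
  fin_cases i <;> simp [matT0]

theorem matC_T1 (y : C2) : matC matT1 y = y 1 • !₂[-1, 1] := by
  ext i
  rw [matC_apply]
  fin_cases i <;> simp [matT1]

/-- Both sides are (G h)₀(G k)₁(-1, 1). The identity moves a variation k from the coefficient to the
argument, as needed to recognise the derivative of the profile equation as S. -/
theorem mulL_evG_T0 (h k : L2) : mulL (comp 1 (evG k)) (matL matT0 (opG h))
    = mulL (comp 0 (evG h)) (matL matT1 (opG k)) := by
  refine Lp.ext ?_
  filter_upwards [coeFn_mulL (comp 1 (evG k)) (matL matT0 (opG h)),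
    coeFn_mulL (comp 0 (evG h)) (matL matT1 (opG k)), coeFn_matL matT0 (opG h),
    coeFn_matL matT1 (opG k), coeFn_opG h, coeFn_opG k] with x h1 h2 h3 h4 h5 h6
  rw [h1, h2, h3, h4, h5, h6, matC_T0, matC_T1, comp_apply, comp_apply, smul_comm]

theorem mulL_evG_T1 (h k : L2) : mulL (comp 1 (evG k)) (matL matT1 (opG h))
    = mulL (comp 1 (evG h)) (matL matT1 (opG k)) := by
  refine Lp.ext ?_
  filter_upwards [coeFn_mulL (comp 1 (evG k)) (matL matT1 (opG h)),
    coeFn_mulL (comp 1 (evG h)) (matL matT1 (opG k)), coeFn_matL matT1 (opG h),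
    coeFn_matL matT1 (opG k), coeFn_opG h, coeFn_opG k] with x h1 h2 h3 h4 h5 h6
  rw [h1, h2, h3, h4, h5, h6, matC_T1, matC_T1, comp_apply, comp_apply, smul_comm]

theorem profS_apply (d m : ℝ) (f g : B) (ε : ℂ) (V ζ : B2) (h : L2) :
    profS d m f g ε V ζ h = matL (matD d) (opG h - h)
      + ε • (mulL f (matL matE (opDG h)) + mulL g (matL matE (opG h)))
      + matL (matN m) (opG h) + mulL ((comp 1 V + comp 1 ζ) ^ 2) (matL matT0 (opG h))
      + mulL (comp 0 V * (2 * comp 1 V + comp 1 ζ)) (matL matT1 (opG h)) := rfl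

theorem linS_apply (d m : ℝ) (f g : B) (ε : ℂ) (U : B2) (h : L2) :
    linS d m f g ε U h = matL (matD d) (opG h - h)
      + ε • (mulL f (matL matE (opDG h)) + mulL g (matL matE (opG h)))
      + matL (matN m) (opG h) + mulL (comp 1 U ^ 2) (matL matT0 (opG h))
      + mulL (2 * comp 0 U * comp 1 U) (matL matT1 (opG h)) := rfl

theorem star_matD (d : ℝ) (i j : Fin 2) : star (matD d i j) = matD d i j := by
  fin_cases i <;> fin_cases j <;> simp [matD]

theorem star_matN (m : ℝ) (i j : Fin 2) : star (matN m i j) = matN m i j := by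
  fin_cases i <;> fin_cases j <;> simp [matN]

theorem star_matE (i j : Fin 2) : star (matE i j) = matE i j := by
  fin_cases i <;> fin_cases j <;> simp [matE]

theorem star_matT0 (i j : Fin 2) : star (matT0 i j) = matT0 i j := by
  fin_cases i <;> fin_cases j <;> simp [matT0]

theorem star_matT1 (i j : Fin 2) : star (matT1 i j) = matT1 i j := by
  fin_cases i <;> fin_cases j <;> simp [matT1]

theorem star_comp (i : Fin 2) (y : B2) : star (comp i y) = comp i (conjB y) := rfl

theorem reflB_comp (i : Fin 2) (y : B2) : reflB ℂ (comp i y) = comp i (reflB C2 y) := rfl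

theorem reflB_mul (p q : B) : reflB ℂ (p * q) = reflB ℂ p * reflB ℂ q := rfl

theorem reflB_two : reflB ℂ (2 : B) = 2 := rfl

theorem star_two : star (2 : B) = 2 := by
  refine BoundedContinuousFunction.ext fun x => ?_
  change star (2 : ℂ) = 2
  simp

theorem profS_conj {d m : ℝ} {f g : B} (hf : star f = f) (hg : star g = g) (ε : ℝ) (V ζ : B2)
    (h : L2) : conjL (profS d m f g ε V ζ h)
      = profS d m f g ε (conjB V) (conjB ζ) (conjL h) := by
  simp only [profS_apply, map_add, map_sub, conjL_smul, conjL_mulL, conjL_matL (star_matD d),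
    conjL_matL (star_matN m), conjL_matL star_matE, conjL_matL star_matT0, conjL_matL star_matT1,
    conjL_opG, conjL_opDG, hf, hg, star_pow, star_mul', star_add, star_comp, star_two]
  simp

theorem linS_conj {d m : ℝ} {f g : B} (hf : star f = f) (hg : star g = g) (ε : ℝ) (U : B2)
    (h : L2) : conjL (linS d m f g ε U h) = linS d m f g ε (conjB U) (conjL h) := by
  simp only [linS_apply, map_add, map_sub, conjL_smul, conjL_mulL, conjL_matL (star_matD d),
    conjL_matL (star_matN m), conjL_matL star_matE, conjL_matL star_matT0, conjL_matL star_matT1,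
    conjL_opG, conjL_opDG, hf, hg, star_pow, star_mul', star_comp, star_two]
  simp

theorem profS_refl {d m : ℝ} {f g : B} (hf : reflB ℂ f = -f) (hg : reflB ℂ g = g) (ε : ℂ)
    (V ζ : B2) (h : L2) : reflL (profS d m f g ε V ζ h)
      = profS d m f g ε (reflB C2 V) (reflB C2 ζ) (reflL h) := by
  simp only [profS_apply, map_add, map_sub, map_smul, reflL_mulL, ← matL_reflL, reflL_opG,
    reflL_opDG, hf, hg, pow_two, reflB_mul, reflB_comp, reflB_two, map_neg, neg_apply, neg_neg]

theorem ContDiffAt.linS {E : Type*} [NormedAddCommGroup E] [NormedSpace ℂ E] {d m : ℝ} {f g : B}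
    {e : E → ℂ} {U : E → B2} {x : E} {n : ℕ∞ω} (he : ContDiffAt ℂ n e x)
    (hU : ContDiffAt ℂ n U x) : ContDiffAt ℂ n (fun y => linS d m f g (e y) (U y)) x := by
  unfold Klausmeier.linS
  fun_prop

theorem ContDiffAt.profS {E : Type*} [NormedAddCommGroup E] [NormedSpace ℂ E] {d m : ℝ} {f g : B}
    {e : E → ℂ} {V ζ : E → B2} {x : E} {n : ℕ∞ω} (he : ContDiffAt ℂ n e x)
    (hV : ContDiffAt ℂ n V x) (hζ : ContDiffAt ℂ n ζ x) :
    ContDiffAt ℂ n (fun y => profS d m f g (e y) (V y) (ζ y)) x := by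
  unfold Klausmeier.profS
  fun_prop

theorem hasFDerivAt_mulL_apply {q : L2 → B} {q' : L2 →L[ℂ] B} {x : L2} (hq : HasFDerivAt q q' x)
    (A : L2 →L[ℂ] L2) : HasFDerivAt (fun k => mulL (q k) (A k))
      (mulL (q x) ∘L A + mulL.flip (A x) ∘L q') x := by
  have h1 : HasFDerivAt (fun k => mulL (q k)) (mulL ∘L q') x := mulL.hasFDerivAt.comp x hq
  refine (h1.clm_apply A.hasFDerivAt).congr_fderiv ?_
  ext1 k
  rfl

namespace Wave

variable {d a m : ℝ} (W : Wave d a m)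

/-- The profile equation, with a phase condition and a Lagrange multiplier. -/
def profEq (f g : B) (V : ℂ → B2) (p : ℂ × (L2 × ℂ)) : L2 × ℂ :=
  (profS d m f g p.1 (V p.1) (evG p.2.1) p.2.1 + p.2.2 • W.Φ, W.ℓ p.2.1 - W.ℓ W.h)

theorem contDiffAt_profEq (f g : B) {V : ℂ → B2} {n : ℕ∞ω} (hV : ContDiffAt ℂ n V 0)
    (p : L2 × ℂ) : ContDiffAt ℂ n (W.profEq f g V) (0, p) := by
  have h1 : ContDiffAt ℂ n (fun p : ℂ × (L2 × ℂ) => V p.1) (0, p) :=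
    ContDiffAt.comp (0, p) hV contDiffAt_fst
  have h2 : ContDiffAt ℂ n (fun p : ℂ × (L2 × ℂ) => profS d m f g p.1 (V p.1) (evG p.2.1)) (0, p) :=
    ContDiffAt.profS contDiffAt_fst h1 (by fun_prop)
  unfold profEq
  fun_prop

theorem profEq_zero (f g : B) {V : ℂ → B2} (hV : V 0 = BoundedContinuousFunction.const ℝ W.v) :
    W.profEq f g V (0, (W.h, 0)) = 0 := by
  simp only [profEq]
  rw [hV, profS_zero, W.profile, zero_smul, zero_add, sub_self]
  rfl

/-- The product rule varies both the coefficients and the argument; after the exchanges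
`mulL_evG_T0` and `mulL_evG_T1` the terms recombine into the linearization at the full state v + G
h. -/
theorem hasFDerivAt_profS : HasFDerivAt
    (fun k => profS d m 0 0 0 (BoundedContinuousFunction.const ℝ W.v) (evG k) k) W.S W.h := by
  set V : B2 := BoundedContinuousFunction.const ℝ W.v with hV
  have c1 : HasFDerivAt (fun k : L2 => comp 1 V + comp 1 (evG k)) (comp 1 ∘L evG) W.h :=
    (comp 1 ∘L evG).hasFDerivAt.const_add _
  have c2 : HasFDerivAt (fun k : L2 => comp 0 V * (2 * comp 1 V + comp 1 (evG k)))
      (comp 0 V • (comp 1 ∘L evG)) W.h :=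
    ((comp 1 ∘L evG).hasFDerivAt.const_add _).const_mul _
  have a0 := (matL (matD d) * (opG - 1) + matL (matN m) * opG).hasFDerivAt (x := W.h)
  have a1 := hasFDerivAt_mulL_apply (c1.pow 2) (matL matT0 * opG)
  have a2 := hasFDerivAt_mulL_apply c2 (matL matT1 * opG)
  have e : (fun k => profS d m 0 0 0 V (evG k) k) = fun k =>
      (matL (matD d) * (opG - 1) + matL (matN m) * opG) k
      + mulL ((comp 1 V + comp 1 (evG k)) ^ 2) ((matL matT0 * opG) k)
      + mulL (comp 0 V * (2 * comp 1 V + comp 1 (evG k))) ((matL matT1 * opG) k) := by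
    funext k
    rw [profS_apply, zero_smul, add_zero]
    rfl
  rw [e]
  refine ((a0.add a1).add a2).congr_fderiv ?_
  refine ContinuousLinearMap.ext fun k => ?_
  have s1 := mulL_evG_T0 W.h k
  have s2 := mulL_evG_T1 W.h k
  have hS : W.S k = matL (matD d) (opG k - k) + matL (matN m) (opG k)
      + mulL (comp 1 W.U ^ 2) (matL matT0 (opG k))
      + mulL (2 * comp 0 W.U * comp 1 W.U) (matL matT1 (opG k)) := by
    rw [S, linS_apply, zero_smul, add_zero]
  have hU : ∀ i, comp i W.U = comp i V + comp i (evG W.h) := fun i => map_add (comp i) _ _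
  rw [hS, hU, hU, add_apply, add_apply, add_apply, add_apply]
  simp only [ContinuousLinearMap.comp_apply, ContinuousLinearMap.flip_apply, smul_apply,
    add_apply, mul_apply_eq_comp, sub_apply, one_apply_eq_self, smul_eq_mul]
  rw [mulL_mul _ (comp 1 (evG k)), mulL_mul (comp 0 V) (comp 1 (evG k)), s1, s2,
    ← mulL_mul, ← mulL_mul]
  have e2 : 2 * (comp 0 V + comp 0 (evG W.h)) * (comp 1 V + comp 1 (evG W.h))
      = 2 • (comp 1 V + comp 1 (evG W.h)) ^ 1 * comp 0 (evG W.h)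
        + comp 0 V * (2 * comp 1 V + comp 1 (evG W.h)) + comp 0 V * comp 1 (evG W.h) := by
    rw [two_smul]
    ring
  rw [e2, map_add mulL, map_add mulL, add_apply, add_apply]
  abel

theorem hasFDerivAt_profEq (f g : B) {V : ℂ → B2}
    (hV : V 0 = BoundedContinuousFunction.const ℝ W.v) :
    HasFDerivAt (fun p => W.profEq f g V (0, p)) (bordered W.S W.Φ W.ℓ) (W.h, 0) := by
  have h1 : HasFDerivAt (fun p : L2 × ℂ =>
      profS d m 0 0 0 (BoundedContinuousFunction.const ℝ W.v) (evG p.1) p.1)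
      (W.S ∘L ContinuousLinearMap.fst ℂ L2 ℂ) (W.h, 0) :=
    HasFDerivAt.comp (g := fun k =>
      profS d m 0 0 0 (BoundedContinuousFunction.const ℝ W.v) (evG k) k) (W.h, (0 : ℂ))
      W.hasFDerivAt_profS hasFDerivAt_fst
  have h2 : HasFDerivAt (fun p : L2 × ℂ => p.2 • W.Φ)
      (ContinuousLinearMap.toSpanSingleton ℂ W.Φ ∘L ContinuousLinearMap.snd ℂ L2 ℂ) (W.h, 0) :=
    (ContinuousLinearMap.toSpanSingleton ℂ W.Φ ∘L ContinuousLinearMap.snd ℂ L2 ℂ).hasFDerivAt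
  have h3 : HasFDerivAt (fun p : L2 × ℂ => W.ℓ p.1 - W.ℓ W.h)
      (W.ℓ ∘L ContinuousLinearMap.fst ℂ L2 ℂ) (W.h, 0) :=
    (W.ℓ ∘L ContinuousLinearMap.fst ℂ L2 ℂ).hasFDerivAt.sub_const _
  have e : (fun p => W.profEq f g V (0, p)) = fun p : L2 × ℂ =>
      (profS d m 0 0 0 (BoundedContinuousFunction.const ℝ W.v) (evG p.1) p.1 + p.2 • W.Φ,
        W.ℓ p.1 - W.ℓ W.h) := by
    funext p
    simp only [profEq]
    rw [hV, profS_zero]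
  rw [e]
  refine ((h1.add h2).prodMk h3).congr_fderiv ?_
  refine ContinuousLinearMap.ext fun ⟨k, α⟩ => ?_
  simp

/-- The eigenvalue equation `(S + μ G) κ = 0`, with a normalization. -/
def eigEq (f g : B) (U : ℂ → B2) (p : ℂ × (L2 × ℂ)) : L2 × ℂ :=
  (linS d m f g p.1 (U p.1) p.2.1 + p.2.2 • opG p.2.1, W.ℓ p.2.1 - W.ℓ W.η)

theorem contDiffAt_eigEq (f g : B) {U : ℂ → B2} {n : ℕ∞ω} (hU : ContDiffAt ℂ n U 0)
    (p : L2 × ℂ) : ContDiffAt ℂ n (W.eigEq f g U) (0, p) := by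
  have h1 : ContDiffAt ℂ n (fun p : ℂ × (L2 × ℂ) => U p.1) (0, p) :=
    ContDiffAt.comp (0, p) hU contDiffAt_fst
  have h2 : ContDiffAt ℂ n (fun p : ℂ × (L2 × ℂ) => linS d m f g p.1 (U p.1)) (0, p) :=
    ContDiffAt.linS contDiffAt_fst h1
  unfold eigEq
  fun_prop

theorem eigEq_zero (f g : B) {U : ℂ → B2} (hU : U 0 = W.U) :
    W.eigEq f g U (0, (W.η, 0)) = 0 := by
  have := W.S_η
  simp only [eigEq]
  rw [hU, linS_zero, zero_smul, add_zero, sub_self]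
  exact Prod.ext this rfl

/-- At (η, 0) the bilinear term μGκ has derivative αGη = αΦ, so the eigenvalue problem has the same
bordered derivative as the profile problem. -/
theorem hasFDerivAt_eigEq (f g : B) {U : ℂ → B2} (hU : U 0 = W.U) :
    HasFDerivAt (fun p => W.eigEq f g U (0, p)) (bordered W.S W.Φ W.ℓ) (W.η, 0) := by
  have h1 : HasFDerivAt (fun p : L2 × ℂ => W.S p.1)
      (W.S ∘L ContinuousLinearMap.fst ℂ L2 ℂ) (W.η, 0) :=
    (W.S ∘L ContinuousLinearMap.fst ℂ L2 ℂ).hasFDerivAt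
  have h2 : HasFDerivAt (fun p : L2 × ℂ => p.2 • opG p.1) _ (W.η, 0) :=
    hasFDerivAt_snd.smul (opG ∘L ContinuousLinearMap.fst ℂ L2 ℂ).hasFDerivAt
  have h3 : HasFDerivAt (fun p : L2 × ℂ => W.ℓ p.1 - W.ℓ W.η)
      (W.ℓ ∘L ContinuousLinearMap.fst ℂ L2 ℂ) (W.η, 0) :=
    (W.ℓ ∘L ContinuousLinearMap.fst ℂ L2 ℂ).hasFDerivAt.sub_const _
  have e : (fun p => W.eigEq f g U (0, p)) = fun p : L2 × ℂ =>
      (W.S p.1 + p.2 • opG p.1, W.ℓ p.1 - W.ℓ W.η) := by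
    funext p
    simp only [eigEq]
    rw [hU, linS_zero]
    rfl
  rw [e]
  refine ((h1.add h2).prodMk h3).congr_fderiv ?_
  refine ContinuousLinearMap.ext fun ⟨k, α⟩ => ?_
  simp [Φ]

theorem bordered_bijective : Function.Bijective (bordered W.S W.Φ W.ℓ) :=
  ContinuousLinearMap.isUnit_iff_bijective.1 W.isUnit_bordered

end Wave


/-! ### The bifurcating branch -/

/-- A branch of stationary states `v + G k + G H` through the wave, with an eigenpair
`(κ, -μ)` of the linearization. -/
structure Branch {d a m : ℝ} (W : Wave d a m) (f g : B) (T : ℝ) where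
  k : ℂ → B2
  H : ℂ → L2
  κ : ℂ → L2
  μ : ℂ → ℂ
  k_zero : k 0 = 0
  H_zero : H 0 = W.h
  κ_zero : κ 0 = W.η
  μ_zero : μ 0 = 0
  contDiff_k : ContDiffAt ℂ ω k 0
  contDiff_H : ContDiffAt ℂ ω H 0
  contDiff_κ : ContDiffAt ℂ ω κ 0
  contDiff_μ : ContDiffAt ℂ ω μ 0
  bg_eq : ∀ᶠ ε in 𝓝 0, bgEq d a m f g W.v (ε, k ε) = 0
  prof_eq : ∀ᶠ ε in 𝓝 0, profS d m f g ε (background W.v (k ε)) (evG (H ε)) (H ε) = 0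
  eig_eq : ∀ᶠ ε in 𝓝 0,
    linS d m f g ε (background W.v (k ε) + evG (H ε)) (κ ε) + μ ε • opG (κ ε) = 0
  ℓ_κ : ∀ᶠ ε in 𝓝 0, W.ℓ (κ ε) = W.ℓ W.η
  eig_unique : ∀ᶠ p in 𝓝 ((0, (W.η, 0)) : ℂ × (L2 × ℂ)),
    linS d m f g p.1 (background W.v (k p.1) + evG (H p.1)) p.2.1 + p.2.2 • opG p.2.1 = 0 →
      W.ℓ p.2.1 = W.ℓ W.η → p.2.2 = μ p.1
  conj_k : ∀ᶠ ε : ℝ in 𝓝 0, conjB (k ε) = k ε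
  conj_H : ∀ᶠ ε : ℝ in 𝓝 0, conjL (H ε) = H ε
  conj_μ : ∀ᶠ ε : ℝ in 𝓝 0, star (μ ε) = μ ε
  refl_k : ∀ᶠ ε in 𝓝 0, reflB C2 (k ε) = k ε
  refl_H : ∀ᶠ ε in 𝓝 0, reflL (H ε) = H ε
  shift_k : ∀ᶠ ε in 𝓝 0, shiftB T (k ε) = k ε

theorem conjB_background {v : C2} (hv : conjC v = v) (k : B2) :
    conjB (background v k) = background v (conjB k) := by
  obtain ⟨e1, -⟩ := bdG_symmetry (σ := conjB) (s := 1) (one_mul 1) (map_sub conjB)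
    (fun _ _ h => conjB_hasDerivAt h) k
  rw [background, background, map_add, e1]
  congr 1
  exact BoundedContinuousFunction.ext fun x => hv

theorem reflB_background (v : C2) (k : B2) :
    reflB C2 (background v k) = background v (reflB C2 k) := by
  obtain ⟨e1, -⟩ := bdG_symmetry (σ := reflB C2) (s := -1) (by norm_num) (map_sub (reflB C2))
    (fun _ _ h => reflB_hasDerivAt h) k
  rw [background, background, map_add, e1]
  rfl

theorem contDiff_background (v : C2) {n : ℕ∞ω} : ContDiff ℂ n (background v) := by
  unfold background
  fun_prop

theorem background_zero (v : C2) : background v 0 = BoundedContinuousFunction.const ℝ v := by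
  rw [background, map_zero, add_zero]

theorem inner_star_of_conj {y : L2} (hy : conjL y = y) (z : L2) :
    inner ℂ y (conjL z) = star (inner ℂ y z) := by
  rw [← inner_conjL, hy]

namespace Wave

variable {d a m : ℝ} (W : Wave d a m)

theorem ℓ_conj (h : L2) : W.ℓ (conjL h) = star (W.ℓ h) := by
  rw [ℓ_apply, ℓ_apply, ← conjL_opG, inner_star_of_conj W.conj_Φ]

theorem ℓ_refl (h : L2) : W.ℓ (reflL h) = -W.ℓ h := by
  rw [ℓ_apply, ℓ_apply, ← reflL_opG, inner_reflL, W.refl_Φ, inner_neg_left]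

theorem ℓ_h : W.ℓ W.h = 0 := by
  have := W.ℓ_refl W.h
  rw [W.refl_h] at this
  exact CharZero.eq_neg_self_iff.1 this

/-- Background, profile and eigenpair are solved for successively by the implicit function theorem
with n = ω, each using the previous curve as data. -/
theorem exists_branch {f g : B} {T : ℝ} (hf : star f = f) (hg : star g = g)
    (hf' : reflB ℂ f = -f) (hg' : reflB ℂ g = g) (hfT : ∀ x, f (x + T) = f x)
    (hgT : ∀ x, g (x + T) = g x) : Nonempty (Branch W f g T) := by
  obtain ⟨k, k0, kd, keq, ku⟩ := exists_implicit_curve (n := ω) (by decide)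
    (contDiff_bgEq d a m f g W.v).contDiffAt (W.bgEq_zero f g) (W.hasFDerivAt_bgEq f g)
    (ContinuousLinearMap.isUnit_iff_bijective.1 W.isUnit_constB)
  have kc := kd.continuousAt
  have kconj : ∀ᶠ ε : ℝ in 𝓝 0, conjB (k ε) = k ε := by
    refine eventually_map.1 (implicit_curve_symm k0 kc keq ku conjB.continuous (map_zero _)
      map_ofReal_le (eventually_map.2 (Eventually.of_forall fun ε x hx => ?_)))
    rw [bgEq_conj hf hg W.conj_v, hx, map_zero]
  have krefl : ∀ᶠ ε in 𝓝 0, reflB C2 (k ε) = k ε := by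
    refine implicit_curve_symm k0 kc keq ku (reflB C2).continuous (map_zero _)
      le_rfl (Eventually.of_forall fun ε x hx => ?_)
    rw [bgEq_refl hf' hg', hx, map_zero]
  have kshift : ∀ᶠ ε in 𝓝 0, shiftB T (k ε) = k ε := by
    refine implicit_curve_symm k0 kc keq ku (continuous_shiftB T) rfl
      le_rfl (Eventually.of_forall fun ε x hx => ?_)
    rw [bgEq_shift hfT hgT, hx]
    rfl
  set V : ℂ → B2 := fun ε => background W.v (k ε) with hV
  have V0 : V 0 = BoundedContinuousFunction.const ℝ W.v := by
    rw [hV]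
    simp only [k0, background_zero]
  have Vd : ContDiffAt ℂ ω V 0 := (contDiff_background W.v).contDiffAt.comp 0 kd
  have Vconj : ∀ᶠ ε : ℝ in 𝓝 0, conjB (V ε) = V ε :=
    kconj.mono fun ε hε => by rw [hV]; simp only [conjB_background W.conj_v, hε]
  have Vrefl : ∀ᶠ ε in 𝓝 0, reflB C2 (V ε) = V ε :=
    krefl.mono fun ε hε => by rw [hV]; simp only [reflB_background, hε]
  obtain ⟨X, X0, Xd, Xeq, Xu⟩ := exists_implicit_curve (n := ω) (by decide)
    (W.contDiffAt_profEq f g Vd _) (W.profEq_zero f g V0) (W.hasFDerivAt_profEq f g V0)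
    W.bordered_bijective
  have Xc := Xd.continuousAt
  have Xconj : ∀ᶠ ε : ℝ in 𝓝 0, conjL (X ε).1 = (X ε).1 := by
    have := implicit_curve_symm X0 Xc Xeq Xu
      (σ := fun p => (conjL p.1, star p.2)) (by fun_prop) (by simp [W.conj_h])
      map_ofReal_le (eventually_map.2 (Vconj.mono fun ε hε x hx => ?_))
    · exact (eventually_map.1 this).mono fun ε hε => congrArg Prod.fst hε
    · simp only [profEq, Prod.mk_eq_zero] at hx ⊢
      have h2 := congrArg conjL hx.1
      rw [map_add, conjL_smul, W.conj_Φ, profS_conj hf hg, hε, ← evG_conjL, map_zero] at h2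
      refine ⟨h2, ?_⟩
      have h3 := congrArg star hx.2
      rwa [star_sub, ← W.ℓ_conj, ← W.ℓ_conj, W.conj_h, star_zero] at h3
  -- Φ is odd, so reflecting the profile must be accompanied by α ↦ -α. Uniqueness then gives α =
  -- -α: the multiplier vanishes and the genuine equation is solved by an even profile.
  have Xrefl : ∀ᶠ ε in 𝓝 0, reflL (X ε).1 = (X ε).1 ∧ (X ε).2 = 0 := by
    have := implicit_curve_symm X0 Xc Xeq Xu
      (σ := fun p => (reflL p.1, -p.2)) (by fun_prop) (by simp [W.refl_h])
      le_rfl (Vrefl.mono fun ε hε x hx => ?_)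
    · exact this.mono fun ε hε => ⟨congrArg Prod.fst hε,
        CharZero.eq_neg_self_iff.1 (congrArg Prod.snd hε).symm⟩
    · simp only [profEq, Prod.mk_eq_zero] at hx ⊢
      have h2 := congrArg reflL hx.1
      rw [map_add, map_smul, W.refl_Φ, profS_refl hf' hg', hε, ← evG_reflL, map_zero] at h2
      refine ⟨by rw [neg_smul, ← smul_neg]; exact h2, ?_⟩
      rw [W.ℓ_refl, W.ℓ_h, sub_zero, neg_eq_zero]
      have h3 := hx.2
      rwa [W.ℓ_h, sub_zero] at h3
  set U : ℂ → B2 := fun ε => V ε + evG (X ε).1 with hU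
  have U0 : U 0 = W.U := by
    rw [hU]
    simp only [V0, X0]
    rfl
  have Ud : ContDiffAt ℂ ω U 0 := by
    rw [hU]
    fun_prop
  have Uconj : ∀ᶠ ε : ℝ in 𝓝 0, conjB (U ε) = U ε := by
    filter_upwards [Vconj, Xconj] with ε h1 h2
    rw [hU]
    simp only [map_add, h1, ← evG_conjL, h2]
  obtain ⟨Y, Y0, Yd, Yeq, Yu⟩ := exists_implicit_curve (n := ω) (by decide)
    (W.contDiffAt_eigEq f g Ud _) (W.eigEq_zero f g U0) (W.hasFDerivAt_eigEq f g U0)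
    W.bordered_bijective
  have Yc := Yd.continuousAt
  have Yconj : ∀ᶠ ε : ℝ in 𝓝 0, star (Y ε).2 = (Y ε).2 := by
    have := implicit_curve_symm Y0 Yc Yeq Yu
      (σ := fun p => (conjL p.1, star p.2)) (by fun_prop) (by simp [W.conj_η])
      map_ofReal_le (eventually_map.2 (Uconj.mono fun ε hε x hx => ?_))
    · exact (eventually_map.1 this).mono fun ε hε => congrArg Prod.snd hε
    · simp only [eigEq, Prod.mk_eq_zero] at hx ⊢
      have h2 := congrArg conjL hx.1
      rw [map_add, conjL_smul, conjL_opG, linS_conj hf hg, hε, map_zero] at h2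
      refine ⟨h2, ?_⟩
      have h3 := congrArg star hx.2
      rwa [star_sub, ← W.ℓ_conj, ← W.ℓ_conj, W.conj_η, star_zero] at h3
  exact ⟨{
    k := k
    H := fun ε => (X ε).1
    κ := fun ε => (Y ε).1
    μ := fun ε => (Y ε).2
    k_zero := k0
    H_zero := by rw [X0]
    κ_zero := by rw [Y0]
    μ_zero := by rw [Y0]
    contDiff_k := kd
    contDiff_H := by fun_prop
    contDiff_κ := by fun_prop
    contDiff_μ := by fun_prop
    bg_eq := keq
    prof_eq := by
      filter_upwards [Xeq, Xrefl] with ε h1 h2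
      have := congrArg Prod.fst h1
      simp only [profEq, h2.2, zero_smul, add_zero] at this
      exact this
    eig_eq := Yeq.mono fun ε h1 => congrArg Prod.fst h1
    ℓ_κ := Yeq.mono fun ε h1 => sub_eq_zero.1 (congrArg Prod.snd h1)
    eig_unique := Yu.mono fun p hp h1 h2 =>
      congrArg Prod.snd (hp (Prod.ext h1 (sub_eq_zero.2 h2)))
    conj_k := kconj
    conj_H := Xconj
    conj_μ := Yconj
    refl_k := krefl
    refl_H := Xrefl.mono fun ε h => h.1
    shift_k := kshift }⟩

end Wave


/-! ### Bordered operators and simple eigenvalues -/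

section

variable {X : Type*} [NormedAddCommGroup X] [NormedSpace ℂ X] [CompleteSpace X]
  {A : X →L[ℂ] X} {φ : X} {ℓ : X →L[ℂ] ℂ}

/-- A Schur complement argument: A x = -αφ with α ≠ 0 exhibits φ in the range of A, so the border is
not needed. -/
theorem isUnit_of_bordered (hB : Function.Bijective (bordered A φ ℓ)) {x : X} {α c : ℂ}
    (h : bordered A φ ℓ (x, α) = (0, c)) (hα : α ≠ 0) : IsUnit A := by
  rw [bordered_apply, Prod.mk.injEq] at h
  obtain ⟨h1, h2⟩ := h
  rw [ContinuousLinearMap.isUnit_iff_bijective]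
  constructor
  · rw [injective_iff_map_eq_zero]
    intro z hz
    -- This combination lies in the kernel of the bordered operator, which forces ℓ(z)α = 0.
    have e1 : bordered A φ ℓ (c • z - ℓ z • x, -(ℓ z * α)) = bordered A φ ℓ 0 := by
      rw [bordered_apply, map_zero, map_sub, map_sub, map_smul, map_smul, map_smul, map_smul, hz,
        h2, smul_zero, zero_sub, neg_smul, mul_smul, ← neg_add, ← smul_add, h1, smul_zero, neg_zero,
        smul_eq_mul, smul_eq_mul, mul_comm, sub_self]
      rfl
    have e2 := congrArg Prod.snd (hB.1 e1)
    have e3 : ℓ z = 0 := (mul_eq_zero.1 (neg_eq_zero.1 e2)).resolve_right hα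
    have e4 : bordered A φ ℓ (z, 0) = bordered A φ ℓ 0 := by
      rw [bordered_apply, map_zero, hz, e3, zero_smul, add_zero]
      rfl
    exact congrArg Prod.fst (hB.1 e4)
  · intro y
    obtain ⟨⟨z, β⟩, hz⟩ := hB.2 (y, 0)
    rw [bordered_apply, Prod.mk.injEq] at hz
    refine ⟨z - (β / α) • x, ?_⟩
    have h3 : A x = -(α • φ) := eq_neg_of_add_eq_zero_left h1
    rw [map_sub, map_smul, h3, smul_neg, sub_neg_eq_add, smul_smul, div_mul_cancel₀ _ hα]
    exact hz.1

theorem exists_smul_of_bordered (hB : Function.Injective (bordered A φ ℓ)) {κ z : X}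
    (hκ : A κ = 0) (hℓ : ℓ κ ≠ 0) (hz : A z = 0) : ∃ c : ℂ, z = c • κ := by
  refine ⟨ℓ z / ℓ κ, ?_⟩
  have e1 : bordered A φ ℓ (z, 0) = bordered A φ ℓ ((ℓ z / ℓ κ) • κ, 0) := by
    rw [bordered_apply, bordered_apply, map_smul, map_smul, hz, hκ, smul_zero, smul_eq_mul,
      div_mul_cancel₀ _ hℓ]
  exact congrArg Prod.fst (hB e1)

theorem isUnit_sub_of_norm_le {P V : X →L[ℂ] X} (hP : IsUnit P)
    (h : ∀ x, ‖V x‖ ≤ 1 / 2 * ‖P x‖) : IsUnit (P - V) := by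
  obtain ⟨u, rfl⟩ := hP
  have e : (↑u - V : X →L[ℂ] X) = (1 - V * ↑u⁻¹) * ↑u := by
    rw [sub_mul, one_mul, mul_assoc, u.inv_mul, mul_one]
  rw [e]
  refine IsUnit.mul (isUnit_one_sub_of_norm_lt_one ?_) u.isUnit
  refine lt_of_le_of_lt (ContinuousLinearMap.opNorm_le_bound _ (by norm_num) fun x => ?_)
    (by norm_num : (1 / 2 : ℝ) < 1)
  have h2 : (u : X →L[ℂ] X) ((↑u⁻¹ : X →L[ℂ] X) x) = x :=
    congrArg (fun T : X →L[ℂ] X => T x) u.mul_inv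
  have h3 := h ((↑u⁻¹ : X →L[ℂ] X) x)
  rwa [h2] at h3

end

/-! ### Resolvent estimates for large spectral parameters -/

/-- The vectors a = c(x - Gx) and b = Gx have a real inner product s ≥ 0, so ‖a + zb‖² = ‖a‖² + 2s
Re z + ‖zb‖². As Re z ≥ -ϱ/2 ≥ -‖z‖/4 and s ≤ ‖a‖‖b‖, a negative cross term is absorbed by the two
squares. -/
theorem norm_scalar_symbol {c ϱ : ℝ} (hc : 0 < c) {z : ℂ} (hz : -(ϱ / 2) ≤ z.re)
    (hz' : 2 * ϱ ≤ ‖z‖) (x : L2) :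
    ‖(c : ℂ) • (x - opG x)‖ ≤ 2 * ‖(c : ℂ) • (x - opG x) + z • opG x‖ ∧
      ‖z‖ * ‖opG x‖ ≤ 2 * ‖(c : ℂ) • (x - opG x) + z • opG x‖ := by
  set a := (c : ℂ) • (x - opG x)
  set b := opG x with hb
  set s : ℝ := c * (‖opRm x‖ ^ 2 - ‖b‖ ^ 2) with hs
  have hle : ‖b‖ ≤ ‖opRm x‖ := norm_opR_le (opRm x)
  have hs0 : 0 ≤ s := mul_nonneg hc.le (by nlinarith [norm_nonneg b])
  have hin : inner ℂ a b = (s : ℂ) := by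
    have h1 : inner ℂ x b = ((‖opRm x‖ ^ 2 : ℝ) : ℂ) := by
      rw [hb, inner_opG_eq, inner_self_eq_norm_sq_to_K]
      norm_cast
    have h2 : inner ℂ b b = ((‖b‖ ^ 2 : ℝ) : ℂ) := by
      rw [inner_self_eq_norm_sq_to_K]
      norm_cast
    simp only [a]
    rw [inner_smul_left, inner_sub_left, h1, h2, hs]
    simp
  have hsle : s ≤ ‖a‖ * ‖b‖ := by
    have := norm_inner_le_norm (𝕜 := ℂ) a b
    rwa [hin, Complex.norm_real, Real.norm_of_nonneg hs0] at this
  have hsq : ‖a + z • b‖ ^ 2 = ‖a‖ ^ 2 + 2 * (z.re * s) + (‖z‖ * ‖b‖) ^ 2 := by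
    rw [norm_add_sq (𝕜 := ℂ), inner_smul_right, hin, norm_smul z b]
    simp
  set A := ‖a‖
  set Bn := ‖b‖
  have hA : 0 ≤ A := norm_nonneg _
  have hB : 0 ≤ Bn := norm_nonneg _
  have hZ : 0 ≤ ‖z‖ := norm_nonneg _
  have h3 : -(1 / 2 * (A * (‖z‖ * Bn))) ≤ 2 * (z.re * s) := by
    rcases le_total 0 z.re with h | h
    · have := mul_nonneg h hs0
      have := mul_nonneg hA (mul_nonneg hZ hB)
      linarith
    · have h4 : z.re * (A * Bn) ≤ z.re * s := mul_le_mul_of_nonpos_left hsle h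
      have h5 : -(‖z‖ / 4) * (A * Bn) ≤ z.re * (A * Bn) :=
        mul_le_mul_of_nonneg_right (by linarith) (mul_nonneg hA hB)
      nlinarith
  have hP : 0 ≤ ‖a + z • b‖ := norm_nonneg _
  have q₀ : 0 ≤ A ^ 2 := sq_nonneg _
  have q₁ : 0 ≤ (‖z‖ * Bn) ^ 2 := sq_nonneg _
  have q₂ : 0 ≤ ‖a + z • b‖ ^ 2 := sq_nonneg _
  have q₃ := sub_sq A (‖z‖ * Bn)
  have q₄ := sq_nonneg (A - ‖z‖ * Bn)
  have h6 : A ^ 2 + (‖z‖ * Bn) ^ 2 ≤ 2 * ‖a + z • b‖ ^ 2 := by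
    rw [hsq]
    linarith
  constructor
  · refine abs_le_of_sq_le_sq' ?_ (mul_nonneg zero_le_two hP) |>.2
    rw [mul_pow]
    linarith
  · refine abs_le_of_sq_le_sq' ?_ (mul_nonneg zero_le_two hP) |>.2
    rw [mul_pow]
    linarith

/-- The principal part of `μ - L`, composed with `(1 - ∂²)⁻¹`. -/
def freeS (d : ℝ) (z : ℂ) : L2 →L[ℂ] L2 := matL (matD d) + matL (z • 1 - matD d) * opG

theorem freeS_apply (d : ℝ) (z : ℂ) (x : L2) :
    freeS d z x = matL (matD d) (x - opG x) + z • opG x := by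
  have : freeS d z x = matL (matD d) x + matL (z • 1 - matD d) (opG x) := rfl
  rw [this, map_sub matL, map_smul, map_one, sub_apply, map_sub, smul_apply, one_apply_eq_self]
  abel

/-- The symbol is diagonal with entries (1 - t)c + tz. A zero would make z real and nonpositive,
hence in [-ϱ/2, 0], against ‖z‖ ≥ 2ϱ. -/
theorem isUnit_freeS {d ϱ : ℝ} (hd : 0 < d) (hϱ : 0 < ϱ) {z : ℂ} (hz : -(ϱ / 2) ≤ z.re)
    (hz' : 2 * ϱ ≤ ‖z‖) : IsUnit (freeS d z) := by
  refine isUnit_symbol spectrum_opG_subset matL commute_matL_opG _ _ fun t ht => ?_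
  have key : ∀ c : ℝ, 0 < c → (c : ℂ) + t * (z - c) ≠ 0 := fun c hc h => by
    have h1 := congrArg Complex.im h
    have h2 := congrArg Complex.re h
    simp at h1 h2
    rcases ht.1.eq_or_lt with rfl | ht0
    · simp at h2
      exact hc.ne' h2
    · have him : z.im = 0 := h1.resolve_left ht0.ne'
      have hn : ‖z‖ = |z.re| := by
        rw [← Complex.re_add_im z, him]
        simp
      have hre : z.re ≤ 0 := by
        by_contra! hpos
        nlinarith [ht.2, mul_pos ht0 hpos, mul_nonneg (sub_nonneg.2 ht.2) hc.le]
      rw [hn, abs_of_nonpos hre] at hz'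
      linarith
  have hd2 : (0 : ℝ) < d ^ 2 := by positivity
  have : (matD d + (t : ℂ) • (z • 1 - matD d)).det
      = (((1 : ℝ) : ℂ) + t * (z - (1 : ℝ))) * (((d ^ 2 : ℝ) : ℂ) + t * (z - (d ^ 2 : ℝ))) := by
    simp [Matrix.det_fin_two, matD]
  rw [this]
  exact mul_ne_zero (key 1 one_pos) (key _ hd2)

theorem norm_le_scalar_symbol {c ϱ : ℝ} (hc : 0 < c) {z : ℂ} (hz : -(ϱ / 2) ≤ z.re)
    (hz' : 2 * ϱ ≤ ‖z‖) (hz1 : 1 ≤ ‖z‖) (x : L2) :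
    ‖x‖ ≤ (2 / c + 2) * ‖(c : ℂ) • (x - opG x) + z • opG x‖ := by
  obtain ⟨h1, h2⟩ := norm_scalar_symbol hc hz hz' x
  rw [norm_smul, Complex.norm_real, Real.norm_of_nonneg hc.le] at h1
  set y := ‖(c : ℂ) • (x - opG x) + z • opG x‖
  have h3 : ‖x - opG x‖ ≤ 2 / c * y := by
    rw [div_mul_eq_mul_div, le_div_iff₀ hc]
    linarith
  have h4 : ‖opG x‖ ≤ ‖z‖ * ‖opG x‖ := le_mul_of_one_le_left (norm_nonneg _) hz1
  linarith [norm_le_norm_sub_add x (opG x)]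

/-- Projection to the second component. -/
def matE' : Matrix (Fin 2) (Fin 2) ℂ := !![0, 0; 0, 1]

theorem matE_add_matE' : matE + matE' = 1 := by
  ext i j
  fin_cases i <;> fin_cases j <;> simp [matE, matE']

theorem matE_freeS (d : ℝ) (z : ℂ) (x : L2) : matL matE (freeS d z x)
    = ((1 : ℝ) : ℂ) • (matL matE x - opG (matL matE x)) + z • opG (matL matE x) := by
  have : matE * matD d = matE := by
    ext i j
    fin_cases i <;> fin_cases j <;> simp [matE, matD]
  rw [freeS_apply, map_add, map_smul, ← mul_apply_eq_comp, ← map_mul, ← matL_opG, ← map_sub, this,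
    Complex.ofReal_one, one_smul]

theorem matE'_freeS (d : ℝ) (z : ℂ) (x : L2) : matL matE' (freeS d z x)
    = ((d ^ 2 : ℝ) : ℂ) • (matL matE' x - opG (matL matE' x)) + z • opG (matL matE' x) := by
  have : matE' * matD d = ((d ^ 2 : ℝ) : ℂ) • matE' := by
    ext i j
    fin_cases i <;> fin_cases j <;> simp [matE', matD]
  rw [freeS_apply, map_add, map_smul, ← mul_apply_eq_comp, ← map_mul, ← matL_opG, ← map_sub, this,
    map_smul, smul_apply]

theorem exists_freeS_bound {d ϱ : ℝ} (hd : 0 < d) :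
    ∃ C : ℝ, 0 < C ∧ ∀ z : ℂ, -(ϱ / 2) ≤ z.re → 2 * ϱ ≤ ‖z‖ → 1 ≤ ‖z‖ → ∀ x : L2,
      ‖x‖ ≤ C * ‖freeS d z x‖ ∧ ‖z‖ * ‖opG x‖ ≤ C * ‖freeS d z x‖ := by
  have hd2 : (0 : ℝ) < d ^ 2 := by positivity
  refine ⟨4 * ‖matL matE‖ + (2 / d ^ 2 + 2) * ‖matL matE'‖ + 1, by positivity,
    fun z hz hz' hz1 x => ?_⟩
  have n0 := (matL matE).le_opNorm (freeS d z x)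
  have n1 := (matL matE').le_opNorm (freeS d z x)
  have b0 := (norm_scalar_symbol one_pos hz hz' (matL matE x)).2
  have b1 := (norm_scalar_symbol hd2 hz hz' (matL matE' x)).2
  have a0 := norm_le_scalar_symbol one_pos hz hz' hz1 (matL matE x)
  have a1 := norm_le_scalar_symbol hd2 hz hz' hz1 (matL matE' x)
  rw [← matE_freeS] at b0 a0
  rw [← matE'_freeS] at b1 a1
  have hx : x = matL matE x + matL matE' x := by
    rw [← add_apply, ← map_add, matE_add_matE', map_one, one_apply_eq_self]
  have hx1 : ‖x‖ ≤ ‖matL matE x‖ + ‖matL matE' x‖ := by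
    nth_rewrite 1 [hx]
    exact norm_add_le _ _
  have hG : ‖opG x‖ ≤ ‖opG (matL matE x)‖ + ‖opG (matL matE' x)‖ := by
    nth_rewrite 1 [hx]
    rw [map_add]
    exact norm_add_le _ _
  generalize ‖matL matE (freeS d z x)‖ = y₀ at *
  generalize ‖matL matE' (freeS d z x)‖ = y₁ at *
  have hy : 0 ≤ ‖freeS d z x‖ := norm_nonneg _
  generalize ‖freeS d z x‖ = y at *
  have hM₀ : 0 ≤ ‖matL matE‖ := norm_nonneg _
  have hM₁ : 0 ≤ ‖matL matE'‖ := norm_nonneg _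
  generalize ‖matL matE‖ = M₀ at *
  generalize ‖matL matE'‖ = M₁ at *
  have hq : 0 ≤ 2 / d ^ 2 := by positivity
  generalize 2 / d ^ 2 = q at *
  have hm0 : 0 ≤ M₀ * y := mul_nonneg hM₀ hy
  have hm1 : 0 ≤ q * (M₁ * y) := mul_nonneg hq (mul_nonneg hM₁ hy)
  have a1' : ‖matL matE' x‖ ≤ (q + 2) * (M₁ * y) := a1.trans (by gcongr)
  constructor
  · norm_num at a0
    linarith
  · have : ‖z‖ * ‖opG x‖ ≤ ‖z‖ * ‖opG (matL matE x)‖ + ‖z‖ * ‖opG (matL matE' x)‖ := by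
      rw [← mul_add]
      gcongr
    linarith

/-- The terms of the linearization of order zero. -/
def potential (m : ℝ) (U : B2) : L2 →L[ℂ] L2 :=
  matL (matN m) + mulL (comp 1 U ^ 2) * matL matT0 + mulL (2 * comp 0 U * comp 1 U) * matL matT1

theorem linS_sub_eq_freeS (d m : ℝ) (f g : B) (ε : ℂ) (U : B2) (z : ℂ) :
    linS d m f g ε U - z • opG = -(freeS d z
      - (ε • (mulL f * matL matE * opDG + mulL g * matL matE * opG) + potential m U * opG)) := by
  rw [linS, freeS, potential]
  simp only [map_sub, map_smul, map_one, sub_mul, add_mul, mul_sub, mul_one, smul_mul_assoc,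
    one_mul]
  abel

/-- The potential is small relative to the principal part because ‖z‖‖Gx‖ is controlled by it; the
terms with f and g are small because of the factor ε. Each takes at most a quarter, uniformly in z.
-/
theorem exists_isUnit_of_large {d m ϱ : ℝ} (hd : 0 < d) (hϱ : 0 < ϱ) (f g : B) {U : ℂ → B2}
    (hU : ContinuousAt U 0) : ∃ R : ℝ, ∀ᶠ ε in 𝓝 0, ∀ z : ℂ, -(ϱ / 2) ≤ z.re → R ≤ ‖z‖ →
      IsUnit (linS d m f g ε (U ε) - z • opG) := by
  obtain ⟨C, hC, hb⟩ := exists_freeS_bound (ϱ := ϱ) hd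
  have hpot : ContinuousAt (fun ε => potential m (U ε)) 0 := by
    unfold potential
    fun_prop
  set M := ‖potential m (U 0)‖ + 1 with hM
  have hM0 : 0 < M := by positivity
  set A := mulL f * matL matE * opDG + mulL g * matL matE * opG
  have e1 : ∀ᶠ ε in 𝓝 0, ‖potential m (U ε)‖ ≤ M :=
    hpot.norm.eventually (ge_mem_nhds (lt_add_one _))
  have e2 : ∀ᶠ ε : ℂ in 𝓝 0, ‖ε‖ * ‖A‖ * C ≤ 1 / 4 := by
    have : ContinuousAt (fun ε : ℂ => ‖ε‖ * ‖A‖ * C) 0 := by fun_prop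
    exact this.eventually (ge_mem_nhds (by simp))
  refine ⟨max (max (2 * ϱ) 1) (4 * M * C), ?_⟩
  filter_upwards [e1, e2] with ε h1 h2 z hz hR
  have hz1 : 2 * ϱ ≤ ‖z‖ := (le_max_left _ _).trans ((le_max_left _ _).trans hR)
  have hz2 : 1 ≤ ‖z‖ := (le_max_right _ _).trans ((le_max_left _ _).trans hR)
  have hz3 : 4 * M * C ≤ ‖z‖ := (le_max_right _ _).trans hR
  rw [linS_sub_eq_freeS, IsUnit.neg_iff]
  refine isUnit_sub_of_norm_le (isUnit_freeS hd hϱ hz hz1) fun x => ?_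
  obtain ⟨b1, b2⟩ := hb z hz hz1 hz2 x
  set y := ‖freeS d z x‖
  have hy : 0 ≤ y := norm_nonneg _
  have t1 : ‖(ε • A) x‖ ≤ 1 / 4 * y := by
    calc ‖(ε • A) x‖ = ‖ε‖ * ‖A x‖ := by rw [smul_apply, norm_smul]
      _ ≤ ‖ε‖ * (‖A‖ * (C * y)) := by
        gcongr
        exact (A.le_opNorm x).trans (by gcongr)
      _ = ‖ε‖ * ‖A‖ * C * y := by ring
      _ ≤ _ := by gcongr
  have t2 : ‖(potential m (U ε) * opG) x‖ ≤ 1 / 4 * y := by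
    have h3 : ‖(potential m (U ε) * opG) x‖ ≤ M * ‖opG x‖ :=
      ((potential m (U ε)).le_opNorm (opG x)).trans (by gcongr)
    have hGn : 0 ≤ ‖opG x‖ := norm_nonneg _
    have h4 : 4 * M * C * ‖opG x‖ ≤ C * y := (mul_le_mul_of_nonneg_right hz3 hGn).trans b2
    have h5 : C * (4 * M * ‖opG x‖) ≤ C * y := by linarith
    have h6 := le_of_mul_le_mul_left h5 hC
    linarith
  rw [add_apply]
  linarith [norm_add_le ((ε • A) x) ((potential m (U ε) * opG) x)]


/-! ### Spectrum and multiplicity along the branch -/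

theorem tendsto_clm_apply {X Y α : Type*} [NormedAddCommGroup X] [NormedSpace ℂ X]
    [NormedAddCommGroup Y] [NormedSpace ℂ Y] {l : Filter α} {A : α → X →L[ℂ] Y} {x : α → X}
    {A₀ : X →L[ℂ] Y} {x₀ : X} (hA : Tendsto A l (𝓝 A₀)) (hx : Tendsto x l (𝓝 x₀)) :
    Tendsto (fun t => A t (x t)) l (𝓝 (A₀ x₀)) :=
  (isBoundedBilinearMap_apply.continuous.tendsto (A₀, x₀)).comp (hA.prodMk_nhds hx)

namespace Branch

variable {d a m T : ℝ} {W : Wave d a m} {f g : B} (Br : Branch W f g T)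

/-- The full state on the branch. -/
def U (ε : ℂ) : B2 := background W.v (Br.k ε) + evG (Br.H ε)

/-- The linearization on the branch, composed with `(1 - ∂²)⁻¹`. -/
def S (ε : ℂ) : L2 →L[ℂ] L2 := linS d m f g ε (Br.U ε)

theorem U_zero : Br.U 0 = W.U := by
  rw [U, Br.k_zero, Br.H_zero, background_zero]
  rfl

theorem S_zero : Br.S 0 = W.S := by
  rw [S, U_zero, linS_zero]
  rfl

theorem contDiff_U : ContDiffAt ℂ ω Br.U 0 := by
  have h1 : ContDiffAt ℂ ω (fun ε => background W.v (Br.k ε)) 0 :=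
    (contDiff_background W.v).contDiffAt.comp 0 Br.contDiff_k
  have h2 : ContDiffAt ℂ ω (fun ε => evG (Br.H ε)) 0 :=
    evG.contDiff.contDiffAt.comp 0 Br.contDiff_H
  exact h1.add h2

theorem contDiff_S : ContDiffAt ℂ ω Br.S 0 :=
  ContDiffAt.linS contDiffAt_id Br.contDiff_U

/-- The bordered linearization, with spectral parameter `-z`. -/
def bd (p : ℂ × ℂ) : L2 × ℂ →L[ℂ] L2 × ℂ := bordered (Br.S p.1 + p.2 • opG) W.Φ W.ℓ

theorem bd_zero : Br.bd (0, 0) = bordered W.S W.Φ W.ℓ := by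
  rw [bd, S_zero, zero_smul, add_zero]

theorem continuousAt_bd : ContinuousAt Br.bd (0, 0) := by
  have h1 : ContinuousAt (fun p : ℂ × ℂ => Br.S p.1) (0, 0) :=
    ContinuousAt.comp (f := Prod.fst) (g := Br.S) Br.contDiff_S.continuousAt continuousAt_fst
  exact (continuous_bordered W.Φ W.ℓ).continuousAt.comp
    (h1.add (continuousAt_snd.smul continuousAt_const))

theorem eventually_isUnit_bd : ∀ᶠ p in 𝓝 ((0, 0) : ℂ × ℂ), IsUnit (Br.bd p) := by
  refine Br.continuousAt_bd.eventually (Units.isOpen.mem_nhds ?_)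
  change IsUnit (Br.bd (0, 0))
  rw [bd_zero]
  exact W.isUnit_bordered

theorem tendsto_inverse_bd : Tendsto (fun p => Ring.inverse (Br.bd p)) (𝓝 (0, 0))
    (𝓝 (Ring.inverse (bordered W.S W.Φ W.ℓ))) := by
  obtain ⟨u, hu⟩ := W.isUnit_bordered
  have h1 := Br.continuousAt_bd.tendsto
  rw [bd_zero, ← hu] at h1
  rw [← hu]
  exact (NormedRing.inverse_continuousAt u).tendsto.comp h1

theorem inverse_bd_apply {A : L2 × ℂ →L[ℂ] L2 × ℂ} (hA : IsUnit A) (x : L2 × ℂ) :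
    Ring.inverse A (A x) = x := by
  have := Ring.inverse_mul_cancel A hA
  exact congrArg (fun T : L2 × ℂ →L[ℂ] L2 × ℂ => T x) this

theorem bd_inverse_apply {A : L2 × ℂ →L[ℂ] L2 × ℂ} (hA : IsUnit A) (x : L2 × ℂ) :
    A (Ring.inverse A x) = x := by
  have := Ring.mul_inverse_cancel A hA
  exact congrArg (fun T : L2 × ℂ →L[ℂ] L2 × ℂ => T x) this

theorem inverse_bordered_ℓ :
    Ring.inverse (bordered W.S W.Φ W.ℓ) (0, W.ℓ W.η) = (W.η, 0) := by
  have h1 : bordered W.S W.Φ W.ℓ (W.η, 0) = (0, W.ℓ W.η) := by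
    rw [bordered_apply, zero_smul, add_zero]
    exact Prod.ext W.S_η rfl
  rw [← h1, inverse_bd_apply W.isUnit_bordered]

theorem inverse_bordered_Φ :
    Ring.inverse (bordered W.S W.Φ W.ℓ) (W.Φ, 0) = (0, 1) := by
  have h1 : bordered W.S W.Φ W.ℓ (0, 1) = (W.Φ, 0) := by
    rw [bordered_apply, one_smul, map_zero, zero_add, map_zero]
  rw [← h1, inverse_bd_apply W.isUnit_bordered]

/-- Near zero, the only spectral value is `-μ ε`. -/
theorem spectrum_near_zero : ∀ᶠ p in 𝓝 ((0, 0) : ℂ × ℂ),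
    ¬ IsUnit (Br.S p.1 + p.2 • opG) → p.2 = Br.μ p.1 := by
  have h1 : Tendsto (fun p : ℂ × ℂ => (p.1, ((Ring.inverse (Br.bd p) (0, W.ℓ W.η)).1, p.2)))
      (𝓝 (0, 0)) (𝓝 (0, (W.η, 0))) := by
    have h2 : Tendsto (fun p : ℂ × ℂ => Ring.inverse (Br.bd p) (0, W.ℓ W.η)) (𝓝 (0, 0))
        (𝓝 (W.η, 0)) := by
      have := tendsto_clm_apply Br.tendsto_inverse_bd (tendsto_const_nhds (x := ((0, W.ℓ W.η) : L2 × ℂ)))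
      rwa [inverse_bordered_ℓ] at this
    have h3 : Tendsto (fun p : ℂ × ℂ => (Ring.inverse (Br.bd p) (0, W.ℓ W.η)).1) (𝓝 (0, 0))
        (𝓝 W.η) := (continuous_fst.tendsto (W.η, (0 : ℂ))).comp h2
    exact (continuous_fst.tendsto ((0, 0) : ℂ × ℂ)).prodMk_nhds
      (h3.prodMk_nhds (continuous_snd.tendsto ((0, 0) : ℂ × ℂ)))
  filter_upwards [h1.eventually Br.eig_unique, Br.eventually_isUnit_bd] with p hp hu hn
  -- If the second component of x is nonzero, S + zG is a unit; if it is zero, the first component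
  -- is a normalized eigenvector close to η, and uniqueness of the eigenpair identifies the
  -- parameter.
  set x := Ring.inverse (Br.bd p) (0, W.ℓ W.η) with hx
  have e1 : Br.bd p (x.1, x.2) = (0, W.ℓ W.η) := bd_inverse_apply hu _
  have hα : x.2 = 0 := by
    by_contra hne
    exact hn (isUnit_of_bordered (ContinuousLinearMap.isUnit_iff_bijective.1 hu) e1 hne)
  rw [hα, bd, bordered_apply, zero_smul, add_zero, Prod.mk.injEq] at e1
  exact hp e1.1 e1.2

theorem eventually_bd_μ : ∀ᶠ ε in 𝓝 0, IsUnit (Br.bd (ε, Br.μ ε)) := by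
  have h1 : Tendsto (fun ε => (ε, Br.μ ε)) (𝓝 0) (𝓝 ((0, 0) : ℂ × ℂ)) := by
    have := Br.contDiff_μ.continuousAt.tendsto
    rw [Br.μ_zero] at this
    exact tendsto_id.prodMk_nhds this
  exact h1.eventually Br.eventually_isUnit_bd

theorem eventually_kernel : ∀ᶠ ε in 𝓝 0, ∀ h, Br.S ε h + Br.μ ε • opG h = 0 →
    ∃ c : ℂ, h = c • Br.κ ε := by
  filter_upwards [Br.eventually_bd_μ, Br.eig_eq, Br.ℓ_κ] with ε h1 h2 h3 h hh
  refine exists_smul_of_bordered (ContinuousLinearMap.isUnit_iff_bijective.1 h1).1 h2 ?_ hh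
  rw [h3]
  exact W.ℓ_η_ne_zero

/-- Subtracting a multiple of κ from a solution h makes ℓ vanish on it, so the bordered inverse of
(Gκ, 0) would have multiplier 0. At ε = 0 this multiplier is 1, and it varies continuously. -/
theorem eventually_no_generalized : ∀ᶠ ε in 𝓝 0, ∀ h,
    Br.S ε h + Br.μ ε • opG h ≠ opG (Br.κ ε) := by
  have h1 : Tendsto (fun ε => (ε, Br.μ ε)) (𝓝 0) (𝓝 ((0, 0) : ℂ × ℂ)) := by
    have := Br.contDiff_μ.continuousAt.tendsto
    rw [Br.μ_zero] at this
    exact tendsto_id.prodMk_nhds this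
  have h2 : Tendsto (fun ε => ((opG (Br.κ ε), 0) : L2 × ℂ)) (𝓝 0) (𝓝 (W.Φ, 0)) := by
    have := (opG.continuous.tendsto _).comp Br.contDiff_κ.continuousAt.tendsto
    rw [Br.κ_zero] at this
    exact this.prodMk_nhds tendsto_const_nhds
  have h3 := tendsto_clm_apply (Br.tendsto_inverse_bd.comp h1) h2
  rw [inverse_bordered_Φ] at h3
  have h4 := (continuous_snd.tendsto ((0, 1) : L2 × ℂ)).comp h3
  have h5 := h4.eventually_ne (one_ne_zero (α := ℂ))
  filter_upwards [Br.eventually_bd_μ, Br.eig_eq, Br.ℓ_κ, h5] with ε u1 u2 u3 u4 h hh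
  refine u4 ?_
  have hℓ : W.ℓ (Br.κ ε) ≠ 0 := by
    rw [u3]
    exact W.ℓ_η_ne_zero
  have hκ : (Br.S ε + Br.μ ε • opG) (Br.κ ε) = 0 := u2
  have hh' : (Br.S ε + Br.μ ε • opG) h = opG (Br.κ ε) := hh
  have e : Br.bd (ε, Br.μ ε) (h - (W.ℓ h / W.ℓ (Br.κ ε)) • Br.κ ε, 0) = (opG (Br.κ ε), 0) := by
    rw [bd, bordered_apply, map_sub, map_sub, map_smul, map_smul, hκ, hh', smul_zero, sub_zero,
      zero_smul, add_zero, smul_eq_mul, div_mul_cancel₀ _ hℓ, sub_self]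
  simp only [Function.comp_apply]
  rw [← e, inverse_bd_apply u1]

theorem eventually_isUnit_of_compact {K : Set ℂ} (hK : IsCompact K)
    (h : ∀ z ∈ K, IsUnit (W.S - z • opG)) :
    ∀ᶠ ε in 𝓝 0, ∀ z ∈ K, IsUnit (Br.S ε - z • opG) := by
  refine hK.eventually_forall_of_forall_eventually fun z hz => ?_
  have h1 : ContinuousAt (fun p : ℂ × ℂ => Br.S p.1) (0, z) :=
    ContinuousAt.comp (f := Prod.fst) (g := Br.S) Br.contDiff_S.continuousAt continuousAt_fst
  have h2 : ContinuousAt (fun p : ℂ × ℂ => Br.S p.1 - p.2 • opG) (0, z) :=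
    h1.sub (continuousAt_snd.smul continuousAt_const)
  refine h2.eventually (Units.isOpen.mem_nhds ?_)
  change IsUnit (Br.S 0 - z • opG)
  rw [S_zero]
  exact h z hz

/-- The spectrum to the right of `Re z = -ϱ / 2` consists of `-μ ε`. -/
theorem spectrum_eq : ∀ᶠ ε in 𝓝 0, ∀ z : ℂ, -(W.ϱ / 2) ≤ z.re →
    ¬ IsUnit (Br.S ε - z • opG) → z = -Br.μ ε := by
  obtain ⟨R, hR⟩ := exists_isUnit_of_large (m := m) W.d_pos W.ϱ_pos f g Br.contDiff_U.continuousAt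
  have hs := Br.spectrum_near_zero
  rw [nhds_prod_eq, eventually_prod_iff] at hs
  obtain ⟨p, hp, q, hq, hpq⟩ := hs
  obtain ⟨δ, hδ, hδq⟩ := Metric.eventually_nhds_iff.1 hq
  -- The intermediate region between the neighbourhood of zero and the large parameters; at ε = 0 it
  -- lies in the resolvent set.
  set K : Set ℂ := Metric.closedBall 0 R ∩ {z | δ ≤ ‖z‖ ∧ -(W.ϱ / 2) ≤ z.re} with hKdef
  have hK : IsCompact K := by
    refine (isCompact_closedBall _ _).inter_right ?_
    exact (isClosed_le continuous_const continuous_norm).inter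
      (isClosed_le continuous_const Complex.continuous_re)
  have hKu : ∀ z ∈ K, IsUnit (W.S - z • opG) := fun z hz => by
    refine W.isUnit z (norm_pos_iff.1 (hδ.trans_le hz.2.1)) ?_
    have h1 : -(W.ϱ / 2) ≤ z.re := hz.2.2
    have := W.ϱ_pos
    linarith
  filter_upwards [hR, hp, Br.eventually_isUnit_of_compact hK hKu] with ε h1 h2 h3 z hz hn
  rcases lt_or_ge ‖z‖ δ with h4 | h4
  · have h5 := hpq h2 (hδq (y := -z) (by rwa [dist_zero_right, norm_neg]))
    rw [← h5 (by rwa [neg_smul, ← sub_eq_add_neg]), neg_neg]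
  · rcases le_total R ‖z‖ with h5 | h5
    · exact absurd (h1 z hz h5) hn
    · exact absurd (h3 z ⟨mem_closedBall_zero_iff.2 h5, h4, hz⟩) hn

end Branch


/-! ### Testing the adjoint zero mode against bounded functions -/

/-- Smooth cutoffs at scale `n` with derivatives of order `1 / n`. -/
theorem exists_cutoff_family : ∃ (χ χ₁ χ₂ : ℝ → ℝ → ℝ) (C : ℝ), 0 ≤ C ∧
    (∀ n, 1 ≤ n → ∀ x, HasDerivAt (χ n) (χ₁ n x) x) ∧
    (∀ n, 1 ≤ n → ∀ x, HasDerivAt (χ₁ n) (χ₂ n x) x) ∧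
    (∀ n, 1 ≤ n → Continuous (χ₂ n)) ∧ (∀ n x, |χ n x| ≤ 1) ∧
    (∀ n, 1 ≤ n → ∀ x, |χ₁ n x| ≤ C / n) ∧ (∀ n, 1 ≤ n → ∀ x, |χ₂ n x| ≤ C / n) ∧
    (∀ n, 1 ≤ n → ∀ x, x ∉ Icc (-(2 * n)) (2 * n) → χ n x = 0 ∧ χ₁ n x = 0 ∧ χ₂ n x = 0) ∧
    ∀ x, ∀ᶠ n in atTop, χ n x = 1 := by
  let ψ : ContDiffBump (0 : ℝ) := ⟨1, 2, by norm_num, by norm_num⟩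
  have hψ : ContDiff ℝ 2 ψ := ψ.contDiff
  have hψ1 : ContDiff ℝ 1 (deriv ψ) := by
    have : ContDiff ℝ (1 + 1) ψ := by convert hψ using 1; norm_num
    exact (contDiff_succ_iff_deriv.1 this).2.2
  have hψ2 : Continuous (deriv (deriv ψ)) := hψ1.continuous_deriv le_rfl
  have d0 : ∀ x, HasDerivAt ψ (deriv ψ x) x := fun x =>
    (hψ.differentiable (by norm_num) x).hasDerivAt
  have d1 : ∀ x, HasDerivAt (deriv ψ) (deriv (deriv ψ) x) x := fun x =>
    (hψ1.differentiable (by norm_num) x).hasDerivAt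
  have s0 : HasCompactSupport ψ := ψ.hasCompactSupport
  obtain ⟨C1, hC1⟩ := s0.deriv.exists_bound_of_continuous (hψ1.continuous)
  obtain ⟨C2', hC2⟩ := s0.deriv.deriv.exists_bound_of_continuous hψ2
  have hC1' : 0 ≤ C1 := (norm_nonneg _).trans (hC1 0)
  have ht : ∀ n : ℝ, ∀ x, HasDerivAt (fun x => x / n) (1 / n) x := fun n x =>
    (hasDerivAt_id x).div_const n
  have hz : ∀ n : ℝ, 1 ≤ n → ∀ x, x ∉ Icc (-(2 * n)) (2 * n) → x / n ∉ tsupport ψ := by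
    intro n hn x hx hx'
    have hn0 : 0 < n := by linarith
    rw [ψ.tsupport_eq, Metric.mem_closedBall, dist_zero_right, Real.norm_eq_abs, abs_le] at hx'
    change -2 ≤ _ ∧ _ ≤ (2 : ℝ) at hx'
    rw [le_div_iff₀ hn0, div_le_iff₀ hn0] at hx'
    exact hx ⟨by linarith [hx'.1], hx'.2⟩
  refine ⟨fun n x => ψ (x / n), fun n x => deriv ψ (x / n) / n,
    fun n x => deriv (deriv ψ) (x / n) / n ^ 2, max C1 C2', le_max_of_le_left hC1', ?_, ?_, ?_, ?_,
    ?_, ?_, ?_, ?_⟩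
  · intro n hn x
    refine ((d0 (x / n)).comp x (ht n x)).congr_deriv ?_
    rw [mul_one_div]
  · intro n hn x
    refine (((d1 (x / n)).comp x (ht n x)).div_const n).congr_deriv ?_
    field_simp
  · intro n hn
    fun_prop
  · intro n x
    rw [abs_of_nonneg ψ.nonneg]
    exact ψ.le_one
  · intro n hn x
    have hn0 : 0 < n := by linarith
    rw [abs_div, abs_of_pos hn0]
    gcongr
    exact (hC1 _).trans (le_max_left _ _)
  · intro n hn x
    have hn0 : 0 < n := by linarith
    rw [abs_div, abs_of_pos (by positivity : 0 < n ^ 2)]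
    exact div_le_div₀ (le_max_of_le_left hC1') ((hC2 _).trans (le_max_right _ _)) hn0 (by nlinarith)
  · intro n hn x hx
    have h0 := hz n hn x hx
    have z0 : ψ (x / n) = 0 := image_eq_zero_of_notMem_tsupport h0
    have z1 : deriv ψ (x / n) = 0 :=
      image_eq_zero_of_notMem_tsupport fun h => h0 (tsupport_deriv_subset h)
    have z2 : deriv (deriv ψ) (x / n) = 0 :=
      image_eq_zero_of_notMem_tsupport fun h =>
        h0 (tsupport_deriv_subset (tsupport_deriv_subset h))
    simp only [z0, z1, z2, zero_div, and_self]
  · intro x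
    filter_upwards [eventually_ge_atTop (max 1 |x|)] with n hn
    have hn0 : 0 < n := by linarith [(le_max_left 1 |x|).trans hn]
    refine ψ.one_of_mem_closedBall ?_
    rw [Metric.mem_closedBall, dist_zero_right, Real.norm_eq_abs, abs_div, abs_of_pos hn0]
    change _ ≤ (1 : ℝ)
    rw [div_le_one hn0]
    exact (le_max_right _ _).trans hn

theorem linS_ae (d m : ℝ) (U : B2) (h : L2) : ∀ᵐ x, linS d m 0 0 0 U h x =
    matC (matD d) (opG h x - h x) + matC (matN m) (opG h x) + U x 1 ^ 2 • matC matT0 (opG h x)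
      + (2 * U x 0 * U x 1) • matC matT1 (opG h x) := by
  have e : linS d m 0 0 0 U h = asymptS (-matD d) (matD d + matN m) (comp 1 U ^ 2)
      (2 * comp 0 U * comp 1 U) h := by
    have : linS d m 0 0 0 U = asymptS (-matD d) (matD d + matN m) (comp 1 U ^ 2)
        (2 * comp 0 U * comp 1 U) := by
      rw [linS, asymptS]
      simp only [map_add, map_neg, zero_smul, add_zero, mul_sub, mul_one, add_mul]
      abel
    rw [this]
  rw [e]
  filter_upwards [asymptS_ae (-matD d) (matD d + matN m) (comp 1 U ^ 2)
    (2 * comp 0 U * comp 1 U) h] with x hx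
  rw [hx, map_neg, map_add, map_sub, neg_apply, add_apply]
  have e1 : (comp 1 U ^ 2 : B) x = U x 1 ^ 2 := rfl
  have e2 : (2 * comp 0 U * comp 1 U : B) x = 2 * U x 0 * U x 1 := rfl
  rw [e1, e2]
  abel

namespace Wave

variable {d a m : ℝ} (W : Wave d a m)

/-- For q in H² this is the adjoint equation. For merely bounded q and q', the cutoff χₙq is used:
the commutator with ∂² is O(1/n) on an interval of length 4n, hence O(n^{-1/2}) in L², and dominated
convergence removes the cutoff. -/
theorem integral_inner_eq_zero {q r p F : ℝ → C2} {M : ℝ} (hq : ∀ x, HasDerivAt q (r x) x)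
    (hr : ∀ x, HasDerivAt r (p x) x) (hp : Continuous p) (hqM : ∀ x, ‖q x‖ ≤ M)
    (hrM : ∀ x, ‖r x‖ ≤ M)
    (hF : ∀ᵐ x, matC (matD d) (p x) + matC (matN m) (q x) + W.U x 1 ^ 2 • matC matT0 (q x)
      + (2 * W.U x 0 * W.U x 1) • matC matT1 (q x) = F x)
    (hint : Integrable (fun x => inner ℂ (W.Ψ x) (F x))) :
    ∫ x, inner ℂ (W.Ψ x) (F x) = 0 := by
  obtain ⟨χ, χ₁, χ₂, C, hC, h1, h2, h3, h4, h5, h6, h7, h8⟩ := exists_cutoff_family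
  have hM : 0 ≤ M := (norm_nonneg _).trans (hqM 0)
  set K := ‖matC (matD d)‖ * (3 * C * M) with hK
  have hK0 : 0 ≤ K := by positivity
  have qc : Continuous q := continuous_iff_continuousAt.2 fun x => (hq x).continuousAt
  have rc : Continuous r := continuous_iff_continuousAt.2 fun x => (hr x).continuousAt
  have key : ∀ n : ℝ, 1 ≤ n → ‖∫ x, (χ n x : ℂ) * inner ℂ (W.Ψ x) (F x)‖
      ≤ ‖W.Ψ‖ * (K / n * Real.sqrt (4 * n)) := by
    intro n hn
    have hn0 : 0 < n := by linarith
    have c0 : Continuous (χ n) := continuous_iff_continuousAt.2 fun x => (h1 n hn x).continuousAt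
    have c1 : Continuous (χ₁ n) := continuous_iff_continuousAt.2 fun x => (h2 n hn x).continuousAt
    have c2 := h3 n hn
    let y : ℝ → C2 := fun x => χ n x • q x
    let y1 : ℝ → C2 := fun x => χ₁ n x • q x + χ n x • r x
    let y2 : ℝ → C2 := fun x => (χ₂ n x • q x + (2 * χ₁ n x) • r x) + χ n x • p x
    have b0 : ∀ x, HasDerivAt y (y1 x) x := fun x => by
      refine ((h1 n hn x).smul (hq x)).congr_deriv ?_
      simp only [y1]
      abel
    have b1 : ∀ x, HasDerivAt y1 (y2 x) x := fun x => by
      refine (((h2 n hn x).smul (hq x)).add ((h1 n hn x).smul (hr x))).congr_deriv ?_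
      simp only [y2, two_mul, add_smul]
      abel
    have m0 : MemLp y 2 volume := by
      refine Continuous.memLp_of_hasCompactSupport (by fun_prop)
        (HasCompactSupport.intro (isCompact_Icc (a := -(2 * n)) (b := 2 * n)) fun x hx => ?_)
      simp only [y]
      rw [(h7 n hn x hx).1, zero_smul]
    have m1 : MemLp y1 2 volume := by
      refine Continuous.memLp_of_hasCompactSupport (by fun_prop)
        (HasCompactSupport.intro (isCompact_Icc (a := -(2 * n)) (b := 2 * n)) fun x hx => ?_)
      simp only [y1]
      rw [(h7 n hn x hx).1, (h7 n hn x hx).2.1, zero_smul, zero_smul, add_zero]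
    have c2' : Continuous y2 := by fun_prop
    have m2 : MemLp y2 2 volume := by
      refine c2'.memLp_of_hasCompactSupport
        (HasCompactSupport.intro (isCompact_Icc (a := -(2 * n)) (b := 2 * n)) fun x hx => ?_)
      simp only [y2]
      rw [(h7 n hn x hx).1, (h7 n hn x hx).2.1, (h7 n hn x hx).2.2, mul_zero, zero_smul, zero_smul,
        zero_smul, add_zero, add_zero]
    have w0 := (hasWeakDeriv_of_hasDerivAt b0 (by fun_prop)).congr m0.coeFn_toLp.symm
      m1.coeFn_toLp.symm
    have w1 := (hasWeakDeriv_of_hasDerivAt b1 c2').congr m1.coeFn_toLp.symm m2.coeFn_toLp.symm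
    have hG := eq_opG_of_hasWeakDeriv w0 w1
    -- The commutator term D(χ''q + 2χ'q').
    let e : ℝ → C2 := fun x => matC (matD d) (χ₂ n x • q x + (2 * χ₁ n x) • r x)
    have me : MemLp e 2 volume := by
      refine Continuous.memLp_of_hasCompactSupport (by fun_prop)
        (HasCompactSupport.intro (isCompact_Icc (a := -(2 * n)) (b := 2 * n)) fun x hx => ?_)
      simp only [e]
      rw [(h7 n hn x hx).2.1, (h7 n hn x hx).2.2, mul_zero, zero_smul, zero_smul, add_zero, map_zero]
    have hne : ‖me.toLp e‖ ≤ K / n * Real.sqrt (2 * n - -(2 * n)) := by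
      refine norm_le_of_ae_le_indicator (by linarith) (by positivity) ?_
      filter_upwards [me.coeFn_toLp] with x hx
      rw [hx]
      by_cases hxm : x ∈ Icc (-(2 * n)) (2 * n)
      · rw [indicator_of_mem hxm]
        have t1 : ‖χ₂ n x • q x + (2 * χ₁ n x) • r x‖ ≤ C / n * M + 2 * (C / n) * M := by
          refine (norm_add_le _ _).trans (add_le_add ?_ ?_)
          · rw [norm_smul]
            exact mul_le_mul (h6 n hn x) (hqM x) (norm_nonneg _) (by positivity)
          · rw [norm_smul, norm_mul, Real.norm_ofNat]
            refine mul_le_mul ?_ (hrM x) (norm_nonneg _) (by positivity)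
            gcongr
            exact h5 n hn x
        calc ‖e x‖ ≤ ‖matC (matD d)‖ * (C / n * M + 2 * (C / n) * M) :=
              ((matC (matD d)).le_opNorm _).trans (by gcongr)
          _ = K / n := by rw [hK]; ring
      · rw [indicator_of_notMem hxm]
        simp only [e]
        rw [(h7 n hn x hxm).2.1, (h7 n hn x hxm).2.2, mul_zero, zero_smul, zero_smul, add_zero,
          map_zero, norm_zero]
    have hS : ∀ᵐ x, W.S (m0.toLp y - m2.toLp y2) x = (χ n x : ℂ) • F x + e x := by
      filter_upwards [linS_ae d m W.U (m0.toLp y - m2.toLp y2), m0.coeFn_toLp, m2.coeFn_toLp,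
        Lp.coeFn_sub (m0.toLp y) (m2.toLp y2), hF] with x a1 a2 a3 a4 a5
      rw [hG] at a1
      rw [S, a1, a4, Pi.sub_apply, a2, a3, sub_sub_cancel, ← a5]
      simp only [y, y2, e, ← Complex.coe_smul, map_add, map_smul, smul_add]
      rw [smul_comm (W.U x 1 ^ 2), smul_comm (2 * W.U x 0 * W.U x 1)]
      abel
    have h0 : inner ℂ W.Ψ (W.S (m0.toLp y - m2.toLp y2)) = 0 := W.inner_S _
    have h0' : (∫ x, (χ n x : ℂ) * inner ℂ (W.Ψ x) (F x)) + inner ℂ W.Ψ (me.toLp e) = 0 := by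
      rw [← h0, L2.inner_def, L2.inner_def, ← integral_add]
      · refine integral_congr_ae ?_
        filter_upwards [hS, me.coeFn_toLp] with x a1 a2
        rw [a1, a2, inner_add_right, inner_smul_right]
      · refine hint.bdd_mul (c := 1) (by fun_prop) (ae_of_all _ fun x => ?_)
        rw [Complex.norm_real]
        exact h4 n x
      · exact L2.integrable_inner _ _
    rw [eq_neg_of_add_eq_zero_left h0', norm_neg]
    refine (norm_inner_le_norm _ _).trans ?_
    refine mul_le_mul_of_nonneg_left (hne.trans_eq ?_) (norm_nonneg _)
    congr 2
    ring
  have lim1 : Tendsto (fun n : ℝ => ∫ x, (χ n x : ℂ) * inner ℂ (W.Ψ x) (F x)) atTop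
      (𝓝 (∫ x, inner ℂ (W.Ψ x) (F x))) := by
    refine tendsto_integral_filter_of_dominated_convergence
      (fun x => ‖inner ℂ (W.Ψ x) (F x)‖) ?_ ?_ hint.norm ?_
    · filter_upwards [eventually_ge_atTop 1] with n hn
      have c0 : Continuous (χ n) := continuous_iff_continuousAt.2 fun x => (h1 n hn x).continuousAt
      exact (by fun_prop : Continuous fun x => (χ n x : ℂ)).aestronglyMeasurable.mul hint.1
    · refine Eventually.of_forall fun n => ae_of_all _ fun x => ?_
      rw [norm_mul, Complex.norm_real]
      exact mul_le_of_le_one_left (norm_nonneg _) (h4 n x)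
    · refine ae_of_all _ fun x => ?_
      refine tendsto_const_nhds.congr' ?_
      filter_upwards [h8 x] with n hn
      rw [hn, Complex.ofReal_one, one_mul]
  have lim2 : Tendsto (fun n : ℝ => ‖W.Ψ‖ * (K / n * Real.sqrt (4 * n))) atTop (𝓝 0) := by
    have t1 : Tendsto (fun n : ℝ => Real.sqrt n) atTop atTop := Real.tendsto_sqrt_atTop
    have t2 : Tendsto (fun n : ℝ => (‖W.Ψ‖ * K * 2) * (Real.sqrt n)⁻¹) atTop
        (𝓝 ((‖W.Ψ‖ * K * 2) * 0)) := (tendsto_inv_atTop_zero.comp t1).const_mul _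
    rw [mul_zero] at t2
    refine t2.congr' ?_
    filter_upwards [eventually_gt_atTop 0] with n hn
    have hs : Real.sqrt (4 * n) = 2 * Real.sqrt n := by
      rw [Real.sqrt_mul (by norm_num), show (4 : ℝ) = 2 ^ 2 by norm_num,
        Real.sqrt_sq (by norm_num)]
    rw [hs]
    have hs0 : Real.sqrt n ≠ 0 := (Real.sqrt_pos.2 hn).ne'
    have hs2 : n = Real.sqrt n * Real.sqrt n := (Real.mul_self_sqrt hn.le).symm
    nth_rewrite 2 [hs2]
    field_simp
  have lim3 : Tendsto (fun n : ℝ => ∫ x, (χ n x : ℂ) * inner ℂ (W.Ψ x) (F x)) atTop (𝓝 0) := by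
    refine squeeze_zero_norm' ?_ lim2
    filter_upwards [eventually_ge_atTop 1] with n hn
    exact key n hn
  exact tendsto_nhds_unique lim1 lim3

end Wave


/-! ### The derivative of the critical eigenvalue -/

/-- The diffusive and linear reaction part, composed with `(1 - ∂²)⁻¹`. -/
def diffS (d m : ℝ) : L2 →L[ℂ] L2 := matL (matD d) * (opG - 1) + matL (matN m) * opG

/-- The part of the equations with variable coefficients, composed with `(1 - ∂²)⁻¹`. -/
def coeffS (f g q₀ q₁ : B) : L2 →L[ℂ] L2 :=
  mulL f * (matL matE * opDG) + mulL g * (matL matE * opG) + mulL q₀ * (matL matT0 * opG)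
    + mulL q₁ * (matL matT1 * opG)

theorem profS_eq (d m : ℝ) (f g : B) (ε : ℂ) (V ζ : B2) : profS d m f g ε V ζ
    = diffS d m + coeffS (ε • f) (ε • g) ((comp 1 V + comp 1 ζ) ^ 2)
      (comp 0 V * (2 * comp 1 V + comp 1 ζ)) := by
  rw [profS, diffS, coeffS, map_smul, map_smul, smul_mul_assoc, smul_mul_assoc, smul_add]
  simp only [mul_assoc]
  abel

theorem linS_eq (d m : ℝ) (f g : B) (ε : ℂ) (U : B2) : linS d m f g ε U
    = diffS d m + coeffS (ε • f) (ε • g) (comp 1 U ^ 2) (2 * comp 0 U * comp 1 U) := by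
  rw [linS, diffS, coeffS, map_smul, map_smul, smul_mul_assoc, smul_mul_assoc, smul_add]
  simp only [mul_assoc]
  abel

theorem diffS_ae (d m : ℝ) (h : L2) : ∀ᵐ x, diffS d m h x 0 = -h x 0 ∧
    diffS d m h x 1 = d ^ 2 * (evG h x 1 - h x 1) - m * evG h x 1 := by
  have e : diffS d m h = matL (matD d) (opG h - h) + matL (matN m) (opG h) := rfl
  rw [e]
  filter_upwards [Lp.coeFn_add (matL (matD d) (opG h - h)) (matL (matN m) (opG h)),
    coeFn_matL (matD d) (opG h - h), coeFn_matL (matN m) (opG h), Lp.coeFn_sub (opG h) h,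
    coeFn_opG h] with x h1 h2 h3 h4 h5
  rw [h1, Pi.add_apply, h2, h3, h4, Pi.sub_apply, h5]
  constructor
  · simp [matC_apply, matD, matN]
    ring
  · simp [matC_apply, matD, matN]
    ring

theorem coeffS_ae (f g q₀ q₁ : B) (h : L2) : ∀ᵐ x,
    coeffS f g q₀ q₁ h x 0 = f x * evDG h x 0 + g x * evG h x 0
      - (q₀ x * evG h x 0 + q₁ x * evG h x 1) ∧
    coeffS f g q₀ q₁ h x 1 = q₀ x * evG h x 0 + q₁ x * evG h x 1 := by
  have e : coeffS f g q₀ q₁ h = mulL f (matL matE (opDG h)) + mulL g (matL matE (opG h))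
    + mulL q₀ (matL matT0 (opG h)) + mulL q₁ (matL matT1 (opG h)) := rfl
  rw [e]
  filter_upwards [Lp.coeFn_add (mulL f (matL matE (opDG h)) + mulL g (matL matE (opG h))
      + mulL q₀ (matL matT0 (opG h))) (mulL q₁ (matL matT1 (opG h))),
    Lp.coeFn_add (mulL f (matL matE (opDG h)) + mulL g (matL matE (opG h)))
      (mulL q₀ (matL matT0 (opG h))),
    Lp.coeFn_add (mulL f (matL matE (opDG h))) (mulL g (matL matE (opG h))),
    coeFn_mulL f (matL matE (opDG h)), coeFn_mulL g (matL matE (opG h)),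
    coeFn_mulL q₀ (matL matT0 (opG h)), coeFn_mulL q₁ (matL matT1 (opG h)),
    coeFn_matL matE (opDG h), coeFn_matL matE (opG h), coeFn_matL matT0 (opG h),
    coeFn_matL matT1 (opG h), coeFn_opG h, coeFn_opDG h]
    with x h1 h2 h3 h4 h5 h6 h7 h8 h9 h10 h11 h12 h13
  rw [h1, Pi.add_apply, h2, Pi.add_apply, h3, Pi.add_apply, h4, h5, h6, h7, h8, h9, h10, h11, h12,
    h13]
  constructor
  · simp [matC_apply, matE, matT0, matT1]
    ring
  · simp [matC_apply, matE, matT0, matT1]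

/-- The product rule at ε = 0, where εf and εg vanish but contribute f and g to the derivative. It
serves both the profile and the eigenvalue equation. -/
theorem hasDerivAt_coeffS (d m : ℝ) (f g : B) {q₀ q₁ : ℂ → B} {q₀' q₁' : B} {y : ℂ → L2} {y' : L2}
    (h0 : HasDerivAt q₀ q₀' 0) (h1 : HasDerivAt q₁ q₁' 0) (hy : HasDerivAt y y' 0) :
    HasDerivAt (fun ε => (diffS d m + coeffS (ε • f) (ε • g) (q₀ ε) (q₁ ε)) (y ε))
      ((diffS d m + coeffS 0 0 (q₀ 0) (q₁ 0)) y' + coeffS f g q₀' q₁' (y 0)) 0 := by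
  have b : ∀ (q : B), HasDerivAt (fun ε : ℂ => ε • q) q 0 := fun q =>
    ((hasDerivAt_id (0 : ℂ)).smul_const q).congr_deriv (one_smul ℂ q)
  have c : ∀ {q : ℂ → B} {q' : B} (A : L2 →L[ℂ] L2), HasDerivAt q q' 0 →
      HasDerivAt (fun ε => mulL (q ε) * A) (mulL q' * A) 0 := fun A hq =>
    (mulL.hasFDerivAt.comp_hasDerivAt (0 : ℂ) hq).mul_const A
  have d1 := ((((c (matL matE * opDG) (b f)).add (c (matL matE * opG) (b g))).add
    (c (matL matT0 * opG) h0)).add (c (matL matT1 * opG) h1)).const_add (diffS d m)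
  have d2 := d1.clm_apply hy
  refine d2.congr_deriv ?_
  rw [add_comm]
  refine congrArg₂ (· + ·) (congrArg (fun A : L2 →L[ℂ] L2 => A y') ?_) rfl
  have hz : ∀ q : B, (0 : ℂ) • q = 0 := fun q =>
    BoundedContinuousFunction.ext fun x => zero_smul ℂ (q x)
  simp only [coeffS, Pi.add_apply, hz]

/-- The cubic coupling for a profile on a constant background `v`. -/
def profCoupling (v : C2) (ζ : B2) : B :=
  (BoundedContinuousFunction.const ℝ (v 1) + comp 1 ζ) ^ 2 * comp 0 ζ
    + BoundedContinuousFunction.const ℝ (v 0)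
      * (BoundedContinuousFunction.const ℝ (2 * v 1) + comp 1 ζ) * comp 1 ζ

/-- The continuous representative of `h` for a profile `G h` on a constant background `v`. -/
def profRep (d m : ℝ) (v : C2) (ζ : B2) : B2 :=
  incl 0 (-profCoupling v ζ)
    + incl 1 (comp 1 ζ + BoundedContinuousFunction.const ℝ (((d : ℂ) ^ 2)⁻¹)
      * (BoundedContinuousFunction.const ℝ (-(m : ℂ)) * comp 1 ζ + profCoupling v ζ))

theorem hasDerivAt_incl {a b a' b' : B} {x : ℝ} (ha : HasDerivAt a (a' x) x)
    (hb : HasDerivAt b (b' x) x) :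
    HasDerivAt (incl 0 a + incl 1 b) ((incl 0 a' + incl 1 b') x) x :=
  (ha.smul_const (EuclideanSpace.single 0 (1 : ℂ) : C2)).add
    (hb.smul_const (EuclideanSpace.single 1 (1 : ℂ) : C2))

theorem HasDerivAt.comp_apply {y : ℝ → C2} {y' : C2} {x : ℝ} (h : HasDerivAt y y' x) (i : Fin 2) :
    HasDerivAt (fun x => y x i) (y' i) x :=
  ((EuclideanSpace.proj (𝕜 := ℂ) i).restrictScalars ℝ).hasFDerivAt.comp_hasDerivAt x h

/-- Since (G h)'' = G h - h, the profile equation can be solved algebraically for h in terms of the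
continuous function G h. This starts the regularity bootstrap. -/
theorem ae_eq_profRep {d m : ℝ} (hd : 0 < d) {v : C2} {h : L2}
    (hp : profS d m 0 0 0 (BoundedContinuousFunction.const ℝ v) (evG h) h = 0) :
    (h : ℝ → C2) =ᵐ[volume] profRep d m v (evG h) := by
  have hd' : (d : ℂ) ≠ 0 := Complex.ofReal_ne_zero.2 hd.ne'
  rw [profS_eq, add_apply, zero_smul] at hp
  filter_upwards [diffS_ae d m h, coeffS_ae 0 0
    ((comp 1 (BoundedContinuousFunction.const ℝ v) + comp 1 (evG h)) ^ 2)
    (comp 0 (BoundedContinuousFunction.const ℝ v)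
      * (2 * comp 1 (BoundedContinuousFunction.const ℝ v) + comp 1 (evG h))) h,
    Lp.coeFn_add (diffS d m h) (coeffS 0 0
    ((comp 1 (BoundedContinuousFunction.const ℝ v) + comp 1 (evG h)) ^ 2)
    (comp 0 (BoundedContinuousFunction.const ℝ v)
      * (2 * comp 1 (BoundedContinuousFunction.const ℝ v) + comp 1 (evG h))) h),
    Lp.coeFn_zero C2 2 (volume : Measure ℝ)] with x h1 h2 h3 h4
  rw [hp, h4] at h3
  have e0 := congrArg (fun y : C2 => y 0) h3
  have e1 := congrArg (fun y : C2 => y 1) h3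
  simp only [Pi.add_apply, PiLp.add_apply, h1.1, h1.2, h2.1, h2.2] at e0 e1
  simp at e0 e1
  ext i
  fin_cases i
  · change h x 0 = profRep d m v (evG h) x 0
    simp [profRep, profCoupling, incl_apply]
    linear_combination e0
  · change h x 1 = profRep d m v (evG h) x 1
    simp [profRep, profCoupling, incl_apply]
    field_simp
    linear_combination e1


/-- Evaluation of a component at a point. -/
def evalAt (i : Fin 2) (x : ℝ) : B2 →L[ℂ] ℂ :=
  EuclideanSpace.proj (𝕜 := ℂ) i ∘L BoundedContinuousFunction.evalCLM ℂ x

theorem evalAt_apply (i : Fin 2) (x : ℝ) (y : B2) : evalAt i x y = y x i := rfl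

theorem hasDerivAt_clm {X Y : Type*} [NormedAddCommGroup X] [NormedSpace ℂ X]
    [NormedAddCommGroup Y] [NormedSpace ℂ Y] (L : X →L[ℂ] Y) {y : ℂ → X} {y' : X} {x : ℂ}
    (hy : HasDerivAt y y' x) : HasDerivAt (fun ε => L (y ε)) (L y') x :=
  L.hasFDerivAt.comp_hasDerivAt x hy

theorem eq_zero_of_hasDerivAt {X : Type*} [NormedAddCommGroup X] [NormedSpace ℂ X]
    {y : ℂ → X} {y' : X} (hy : HasDerivAt y y' 0) (h : ∀ᶠ ε in 𝓝 0, y ε = 0) : y' = 0 :=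
  hy.unique ((hasDerivAt_const (0 : ℂ) (0 : X)).congr_of_eventuallyEq h)

theorem ae_of_diffS_add_coeffS {d m : ℝ} {f g p₀ p₁ q₀ q₁ : B} {h k : L2}
    (e : (diffS d m + coeffS 0 0 p₀ p₁) k + coeffS f g q₀ q₁ h = 0) : ∀ᵐ x,
    -k x 0 - (p₀ x * evG k x 0 + p₁ x * evG k x 1) + (f x * evDG h x 0 + g x * evG h x 0
      - (q₀ x * evG h x 0 + q₁ x * evG h x 1)) = 0 ∧
    d ^ 2 * (evG k x 1 - k x 1) - m * evG k x 1 + (p₀ x * evG k x 0 + p₁ x * evG k x 1)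
      + (q₀ x * evG h x 0 + q₁ x * evG h x 1) = 0 := by
  rw [add_apply] at e
  filter_upwards [diffS_ae d m k, coeffS_ae 0 0 p₀ p₁ k, coeffS_ae f g q₀ q₁ h,
    Lp.coeFn_add (diffS d m k) (coeffS 0 0 p₀ p₁ k),
    Lp.coeFn_add (diffS d m k + coeffS 0 0 p₀ p₁ k) (coeffS f g q₀ q₁ h),
    Lp.coeFn_zero C2 2 (volume : Measure ℝ)] with x h1 h2 h3 h4 h5 h6
  rw [e, h6, Pi.add_apply, h4, Pi.add_apply] at h5
  have e0 := congrArg (fun y : C2 => y 0) h5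
  have e1 := congrArg (fun y : C2 => y 1) h5
  simp only [PiLp.add_apply, h1.1, h1.2, h2.1, h2.2, h3.1, h3.2] at e0 e1
  simp at e0 e1
  exact ⟨by linear_combination -e0, by linear_combination -e1⟩

/-! ### The tangent of the branch at zero -/

namespace Branch

variable {d a m T : ℝ} {W : Wave d a m} {f g : B} (Br : Branch W f g T)

theorem hasDerivAt_k : HasDerivAt Br.k (deriv Br.k 0) 0 :=
  (Br.contDiff_k.differentiableAt (by simp)).hasDerivAt

theorem hasDerivAt_H : HasDerivAt Br.H (deriv Br.H 0) 0 :=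
  (Br.contDiff_H.differentiableAt (by simp)).hasDerivAt

theorem hasDerivAt_κ : HasDerivAt Br.κ (deriv Br.κ 0) 0 :=
  (Br.contDiff_κ.differentiableAt (by simp)).hasDerivAt

theorem hasDerivAt_μ : HasDerivAt Br.μ (deriv Br.μ 0) 0 :=
  (Br.contDiff_μ.differentiableAt (by simp)).hasDerivAt

/-- The tangent of the branch of states. -/
def U' : B2 := bdG C2 one_re_pos (deriv Br.k 0) + evG (deriv Br.H 0)

theorem hasDerivAt_background :
    HasDerivAt (fun ε => background W.v (Br.k ε)) (bdG C2 one_re_pos (deriv Br.k 0)) 0 :=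
  (hasDerivAt_clm _ Br.hasDerivAt_k).const_add _

theorem hasDerivAt_U : HasDerivAt Br.U Br.U' 0 :=
  Br.hasDerivAt_background.add (hasDerivAt_clm evG Br.hasDerivAt_H)

theorem background_tangent (x : ℝ) :
    bdG C2 one_re_pos (deriv Br.k 0) x 0 - deriv Br.k 0 x 0 + g x * W.v 0
      - bdG C2 one_re_pos (deriv Br.k 0) x 0
      - (W.v 1 ^ 2 * bdG C2 one_re_pos (deriv Br.k 0) x 0
        + 2 * W.v 0 * W.v 1 * bdG C2 one_re_pos (deriv Br.k 0) x 1) = 0 ∧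
    d ^ 2 * (bdG C2 one_re_pos (deriv Br.k 0) x 1 - deriv Br.k 0 x 1)
      - m * bdG C2 one_re_pos (deriv Br.k 0) x 1
      + (W.v 1 ^ 2 * bdG C2 one_re_pos (deriv Br.k 0) x 0
        + 2 * W.v 0 * W.v 1 * bdG C2 one_re_pos (deriv Br.k 0) x 1) = 0 := by
  set k₁ := deriv Br.k 0 with hk₁
  have K : ∀ i, HasDerivAt (fun ε => Br.k ε x i) (k₁ x i) 0 := fun i =>
    hasDerivAt_clm (evalAt i x) Br.hasDerivAt_k
  have G : ∀ i, HasDerivAt (fun ε => bdG C2 one_re_pos (Br.k ε) x i) (bdG C2 one_re_pos k₁ x i) 0 :=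
    fun i => hasDerivAt_clm (evalAt i x ∘L bdG C2 one_re_pos) Br.hasDerivAt_k
  have D : HasDerivAt (fun ε => bdDG C2 one_re_pos (Br.k ε) x 0) (bdDG C2 one_re_pos k₁ x 0) 0 :=
    hasDerivAt_clm (evalAt 0 x ∘L bdDG C2 one_re_pos) Br.hasDerivAt_k
  have V : ∀ i, HasDerivAt (fun ε => W.v i + bdG C2 one_re_pos (Br.k ε) x i)
      (bdG C2 one_re_pos k₁ x i) 0 := fun i => (G i).const_add _
  have hz : ∀ i, bdG C2 one_re_pos (Br.k 0) x i = 0 := fun i => by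
    rw [Br.k_zero, map_zero]
    rfl
  have hz' : bdDG C2 one_re_pos (Br.k 0) x 0 = 0 := by
    rw [Br.k_zero, map_zero]
    rfl
  have e0 := eq_zero_of_hasDerivAt (((((((G 0).sub (K 0)).add ((hasDerivAt_id (0 : ℂ)).mul
    ((D.const_mul (f x)).add ((V 0).const_mul (g x))))).sub (V 0)).sub
    ((V 0).mul ((V 1).pow 2))).add_const (a : ℂ))) (by
      filter_upwards [Br.bg_eq] with ε hε
      have := congrArg (evalAt 0 x) hε
      rw [evalAt_apply, bgEq_apply_zero, map_zero] at this
      exact this)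
  have e1 := eq_zero_of_hasDerivAt (((((G 1).sub (K 1)).const_mul ((d : ℂ) ^ 2)).sub ((V 1).const_mul (m : ℂ))).add
    ((V 0).mul ((V 1).pow 2))) (by
      filter_upwards [Br.bg_eq] with ε hε
      have := congrArg (evalAt 1 x) hε
      rw [evalAt_apply, bgEq_apply_one, map_zero] at this
      exact this)
  simp [hz, hz'] at e0 e1
  exact ⟨by linear_combination e0, by linear_combination e1⟩

theorem hasDerivAt_comp_U (i : Fin 2) :
    HasDerivAt (fun ε => comp i (Br.U ε)) (comp i Br.U') 0 :=
  hasDerivAt_clm (comp i) Br.hasDerivAt_U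

/-- Differentiate the eigenvalue equation at ε = 0 and pair with Ψ: the unknown Sκ'(0) drops out,
and ⟨Ψ, Gη⟩ = 1 isolates μ'(0). -/
theorem deriv_μ_eq : deriv Br.μ 0 = -inner ℂ W.Ψ (coeffS f g
    (2 * comp 1 W.U * comp 1 Br.U') (2 * (comp 0 Br.U' * comp 1 W.U + comp 0 W.U * comp 1 Br.U'))
    W.η) := by
  have q0 : HasDerivAt (fun ε => comp 1 (Br.U ε) ^ 2) (2 * comp 1 W.U * comp 1 Br.U') 0 := by
    refine ((Br.hasDerivAt_comp_U 1).pow 2).congr_deriv ?_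
    rw [Br.U_zero]
    norm_num
  have q1 : HasDerivAt (fun ε => 2 * comp 0 (Br.U ε) * comp 1 (Br.U ε))
      (2 * (comp 0 Br.U' * comp 1 W.U + comp 0 W.U * comp 1 Br.U')) 0 := by
    refine (((Br.hasDerivAt_comp_U 0).const_mul 2).mul (Br.hasDerivAt_comp_U 1)).congr_deriv ?_
    rw [Br.U_zero]
    ring
  have h1 := (hasDerivAt_coeffS d m f g q0 q1 Br.hasDerivAt_κ).add
    (Br.hasDerivAt_μ.smul (hasDerivAt_clm opG Br.hasDerivAt_κ))
  have h2 := eq_zero_of_hasDerivAt h1 (by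
    filter_upwards [Br.eig_eq] with ε hε
    rw [linS_eq] at hε
    exact hε)
  have h3 : diffS d m + coeffS 0 0 (comp 1 (Br.U 0) ^ 2) (2 * comp 0 (Br.U 0) * comp 1 (Br.U 0))
      = W.S := by
    rw [Wave.S, linS_eq, Br.U_zero, zero_smul]
  rw [h3, Br.μ_zero, zero_smul, zero_add, Br.κ_zero] at h2
  have h4 := congrArg (fun y => inner ℂ W.Ψ y) h2
  simp only [inner_add_right, inner_smul_right, inner_zero_right] at h4
  have h5 : inner ℂ W.Ψ (W.S (deriv Br.κ 0)) = 0 := W.inner_S _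
  rw [h5, W.inner_η] at h4
  linear_combination h4

/-- The tangent equations of background and profile are added; the cubic differences recombine into
the linearization at the full state, applied to the full tangent. -/
theorem state_tangent : ∀ᵐ x,
    Br.U' x 0 - deriv Br.k 0 x 0 - deriv Br.H 0 x 0 + f x * evDG W.h x 0 + g x * W.U x 0
      - Br.U' x 0 - (W.U x 1 ^ 2 * Br.U' x 0 + 2 * W.U x 0 * W.U x 1 * Br.U' x 1) = 0 ∧
    d ^ 2 * (Br.U' x 1 - deriv Br.k 0 x 1 - deriv Br.H 0 x 1) - m * Br.U' x 1
      + (W.U x 1 ^ 2 * Br.U' x 0 + 2 * W.U x 0 * W.U x 1 * Br.U' x 1) = 0 := by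
  have V : ∀ i, HasDerivAt (fun ε => comp i (background W.v (Br.k ε)))
      (comp i (bdG C2 one_re_pos (deriv Br.k 0))) 0 := fun i => hasDerivAt_clm (comp i) Br.hasDerivAt_background
  have Z : ∀ i, HasDerivAt (fun ε => comp i (evG (Br.H ε))) (comp i (evG (deriv Br.H 0))) 0 := fun i =>
    hasDerivAt_clm (comp i ∘L evG) Br.hasDerivAt_H
  have h1 := hasDerivAt_coeffS d m f g (((V 1).add (Z 1)).pow 2)
    ((V 0).mul (((V 1).const_mul 2).add (Z 1))) Br.hasDerivAt_H
  have h2 := eq_zero_of_hasDerivAt h1 (by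
    filter_upwards [Br.prof_eq] with ε hε
    rw [profS_eq] at hε
    exact hε)
  filter_upwards [ae_of_diffS_add_coeffS h2] with x hx
  obtain ⟨b0, b1⟩ := Br.background_tangent x
  obtain ⟨e0, e1⟩ := hx
  have hU : ∀ i, W.U x i = W.v i + evG W.h x i := fun i => rfl
  have hU' : ∀ i, Br.U' x i = bdG C2 one_re_pos (deriv Br.k 0) x i + evG (deriv Br.H 0) x i := fun i => rfl
  have hB : ∀ i, background W.v (Br.k 0) x i = W.v i := fun i => by
    rw [Br.k_zero, background_zero]
    rfl
  simp at e0 e1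
  rw [Br.H_zero, hB, hB] at e0 e1
  rw [hU, hU, hU', hU']
  exact ⟨by linear_combination b0 + e0, by linear_combination b1 + e1⟩

end Branch


/-! ### Spatial derivatives of the tangent and the Melnikov integral -/

namespace Wave

variable {d a m : ℝ} (W : Wave d a m)

/-- The second derivative of the wave. -/
def U'' : B2 := evG W.h - profRep d m W.v (evG W.h)

theorem hasDerivAt_U (x : ℝ) : HasDerivAt W.U (evDG W.h x) x :=
  (hasDerivAt_evG W.h x).const_add _

theorem hasDerivAt_evDG (x : ℝ) : HasDerivAt (evDG W.h) (W.U'' x) x :=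
  Klausmeier.hasDerivAt_evDG (profRep d m W.v (evG W.h)).continuous
    (ae_eq_profRep W.d_pos W.profile) x

theorem evG_η_ae : ∀ᵐ x, evG W.η x = evDG W.h x := by
  filter_upwards [coeFn_opG W.η, coeFn_opDG W.h] with x h1 h2
  rw [← h1, ← h2, W.opG_η]

theorem evDG_η_ae : ∀ᵐ x, evDG W.η x = W.U'' x := by
  have h1 := hasWeakDeriv_opG W.η
  have h2 : HasWeakDeriv (opG W.η : ℝ → C2) W.U'' := by
    refine (hasWeakDeriv_of_hasDerivAt W.hasDerivAt_evDG W.U''.continuous).congr ?_ (ae_eq_refl _)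
    rw [W.opG_η]
    exact (coeFn_opDG W.h).symm
  filter_upwards [h1.ae_unique h2, coeFn_opDG W.η] with x h3 h4
  rw [← h4, h3]

end Wave

theorem hasDerivAt_mul {p q p' q' : B} {x : ℝ} (hp : HasDerivAt p (p' x) x)
    (hq : HasDerivAt q (q' x) x) : HasDerivAt (p * q : B) ((p' * q + p * q' : B) x) x :=
  hp.mul hq

theorem hasDerivAt_comp {y y' : B2} {x : ℝ} (h : HasDerivAt y (y' x) x) (i : Fin 2) :
    HasDerivAt (comp i y) (comp i y' x) x :=
  HasDerivAt.comp_apply h i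

namespace Branch

variable {d a m T : ℝ} {W : Wave d a m} {f g : B} (Br : Branch W f g T)

/-- The spatial derivative of the tangent. -/
def U'x : B2 := bdDG C2 one_re_pos (deriv Br.k 0) + evDG (deriv Br.H 0)

/-- The linearized coupling term, applied to the tangent. -/
def coupling : B := comp 1 W.U * comp 1 W.U * comp 0 Br.U'
  + 2 * (comp 0 W.U * comp 1 W.U * comp 1 Br.U')

/-- The derivative of `coupling`. -/
def couplingx : B := (comp 1 (evDG W.h) * comp 1 W.U + comp 1 W.U * comp 1 (evDG W.h)) * comp 0 Br.U'
    + comp 1 W.U * comp 1 W.U * comp 0 Br.U'x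
  + 2 * ((comp 0 (evDG W.h) * comp 1 W.U + comp 0 W.U * comp 1 (evDG W.h)) * comp 1 Br.U'
    + comp 0 W.U * comp 1 W.U * comp 1 Br.U'x)

/-- The second spatial derivative of the tangent. -/
def U'xx : B2 :=
  incl 0 (comp 0 Br.U' + Br.coupling - (f * comp 0 (evDG W.h) + g * comp 0 W.U))
    + incl 1 (((d : ℂ) ^ 2)⁻¹ • ((m : ℂ) • comp 1 Br.U' - Br.coupling))

/-- The third spatial derivative of the tangent. -/
def U'xxx (f' g' : B) : B2 :=
  incl 0 (comp 0 Br.U'x + Br.couplingx - ((f' * comp 0 (evDG W.h) + f * comp 0 W.U'')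
      + (g' * comp 0 W.U + g * comp 0 (evDG W.h))))
    + incl 1 (((d : ℂ) ^ 2)⁻¹ • ((m : ℂ) • comp 1 Br.U'x - Br.couplingx))

/-- Solving the tangent equation for the highest-order part gives H'(0) a continuous representative.
Hence the tangent is classically twice differentiable, and a third time when f and g are
differentiable. -/
theorem H'_ae : ((deriv Br.H 0 : L2) : ℝ → C2) =ᵐ[volume] (Br.U' - deriv Br.k 0 - Br.U'xx : B2) := by
  have hd' : (d : ℂ) ≠ 0 := Complex.ofReal_ne_zero.2 W.d_pos.ne'
  filter_upwards [Br.state_tangent] with x hx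
  ext i
  fin_cases i
  · simp [U'xx, incl_apply, coupling]
    linear_combination -hx.1
  · simp [U'xx, incl_apply, coupling]
    field_simp
    linear_combination -hx.2

theorem hasDerivAt_U' (x : ℝ) : HasDerivAt Br.U' (Br.U'x x) x :=
  (hasDerivAt_bdG _ _ x).add (hasDerivAt_evG _ x)

theorem hasDerivAt_U'x (x : ℝ) : HasDerivAt Br.U'x (Br.U'xx x) x := by
  refine ((hasDerivAt_bdDG _ _ x).add (Klausmeier.hasDerivAt_evDG
    (Br.U' - deriv Br.k 0 - Br.U'xx : B2).continuous Br.H'_ae x)).congr_deriv ?_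
  rw [one_pow, one_smul]
  change _ + (_ - (bdG C2 one_re_pos (deriv Br.k 0) x + evG (deriv Br.H 0) x
    - deriv Br.k 0 x - Br.U'xx x)) = _
  abel

theorem hasDerivAt_coupling (x : ℝ) : HasDerivAt Br.coupling (Br.couplingx x) x := by
  have u0 := hasDerivAt_comp (W.hasDerivAt_U x) 0
  have u1 := hasDerivAt_comp (W.hasDerivAt_U x) 1
  have t0 := hasDerivAt_comp (Br.hasDerivAt_U' x) 0
  have t1 := hasDerivAt_comp (Br.hasDerivAt_U' x) 1
  exact (hasDerivAt_mul (hasDerivAt_mul u1 u1) t0).add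
    ((hasDerivAt_mul (hasDerivAt_mul u0 u1) t1).const_mul 2)

theorem hasDerivAt_U'xx {f' g' : B} (hf : ∀ x, HasDerivAt f (f' x) x)
    (hg : ∀ x, HasDerivAt g (g' x) x) (x : ℝ) :
    HasDerivAt Br.U'xx (Br.U'xxx f' g' x) x := by
  have u0 := hasDerivAt_comp (W.hasDerivAt_U x) 0
  have z0 := hasDerivAt_comp (W.hasDerivAt_evDG x) 0
  have t0 := hasDerivAt_comp (Br.hasDerivAt_U' x) 0
  have t1 := hasDerivAt_comp (Br.hasDerivAt_U' x) 1
  have c := Br.hasDerivAt_coupling x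
  refine hasDerivAt_incl ?_ ?_
  · exact (t0.add c).sub ((hasDerivAt_mul (hf x) z0).add (hasDerivAt_mul (hg x) u0))
  · exact ((t1.const_smul (m : ℂ)).sub c).const_smul _

theorem inner_C2 (x y : C2) : inner ℂ x y = y 0 * star (x 0) + y 1 * star (x 1) := by
  rw [PiLp.inner_apply, Fin.sum_univ_two]
  rfl

/-- The derivative of the critical eigenvalue is given by the Melnikov integral. -/
theorem deriv_μ_eq_melnikov {f' g' : B} (hf : ∀ x, HasDerivAt f (f' x) x)
    (hg : ∀ x, HasDerivAt g (g' x) x)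
    (hint : Integrable fun x => (f' x * evDG W.h x 0 + g' x * W.U x 0) * star (W.Ψ x 0)) :
    deriv Br.μ 0 = ∫ x, (f' x * evDG W.h x 0 + g' x * W.U x 0) * star (W.Ψ x 0) := by
  have hd' : (d : ℂ) ≠ 0 := Complex.ofReal_ne_zero.2 W.d_pos.ne'
  set A : L2 := coeffS f g (2 * comp 1 W.U * comp 1 Br.U')
    (2 * (comp 0 Br.U' * comp 1 W.U + comp 0 W.U * comp 1 Br.U')) W.η with hA
  -- The x-derivative of the tangent equation says that L₀ applied to `U'x` is F: `A` collects the
  -- terms in which f, g or the varied Jacobian act on ∂ₓu₀ = Gη, and the rest comes from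
  -- differentiating f and g.
  let F : ℝ → C2 := fun x => -A x
    - (f' x * evDG W.h x 0 + g' x * W.U x 0) • EuclideanSpace.single 0 (1 : ℂ)
  have hi : ∀ x, inner ℂ (W.Ψ x) (F x) = -inner ℂ (W.Ψ x) (A x)
      - (f' x * evDG W.h x 0 + g' x * W.U x 0) * star (W.Ψ x 0) := fun x => by
    simp only [F]
    rw [inner_sub_right, inner_neg_right, inner_C2 _ (_ • _)]
    simp
  have hA' : Integrable (fun x => inner ℂ (W.Ψ x) (A x)) := L2.integrable_inner W.Ψ A
  have hF : ∀ᵐ x, matC (matD d) (Br.U'xxx f' g' x) + matC (matN m) (Br.U'x x)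
      + W.U x 1 ^ 2 • matC matT0 (Br.U'x x)
      + (2 * W.U x 0 * W.U x 1) • matC matT1 (Br.U'x x) = F x := by
    filter_upwards [coeffS_ae f g (2 * comp 1 W.U * comp 1 Br.U')
      (2 * (comp 0 Br.U' * comp 1 W.U + comp 0 W.U * comp 1 Br.U')) W.η, W.evG_η_ae,
      W.evDG_η_ae] with x h1 h2 h3
    obtain ⟨e0, e1⟩ := h1
    rw [h2] at e0 e1
    rw [h3] at e0
    simp only [F, matC_T0, matC_T1]
    ext i
    fin_cases i
    · simp [U'xxx, incl_apply, couplingx, matC_apply, matD, matN, hA] at e0 ⊢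
      rw [e0]
      ring
    · simp [U'xxx, incl_apply, couplingx, matC_apply, matD, matN, hA] at e1 ⊢
      rw [e1]
      field_simp
      ring
  have key := W.integral_inner_eq_zero (M := max ‖Br.U'x‖ ‖Br.U'xx‖) Br.hasDerivAt_U'x
    (Br.hasDerivAt_U'xx hf hg) (Br.U'xxx f' g').continuous
    (fun x => (Br.U'x.norm_coe_le_norm x).trans (le_max_left _ _))
    (fun x => (Br.U'xx.norm_coe_le_norm x).trans (le_max_right _ _)) hF (by
      simp only [hi]
      exact hA'.neg.sub hint)
  simp only [hi] at key
  rw [integral_sub (f := fun x => -inner ℂ (W.Ψ x) (A x)) hA'.neg hint, integral_neg] at key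
  rw [Br.deriv_μ_eq, ← hA, L2.inner_def]
  linear_combination key

end Branch


/-! ### Waves from real stationary solutions -/

/-- Complexification of real values. -/
def cplx : R2 →L[ℝ] C2 :=
  LinearMap.toContinuousLinearMap
    { toFun := fun v => WithLp.toLp 2 fun i => (v i : ℂ)
      map_add' := fun v w => by
        ext i
        simp
      map_smul' := fun c v => by
        ext i
        simp }

@[simp] theorem cplx_apply (v : R2) (i : Fin 2) : cplx v i = (v i : ℂ) := rfl

theorem conjC_cplx (v : R2) : conjC (cplx v) = cplx v := by
  ext i
  simp

theorem inner_cplx (v w : R2) : inner ℂ (cplx v) (cplx w) = ((inner ℝ w v : ℝ) : ℂ) := by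
  rw [PiLp.inner_apply, PiLp.inner_apply, Complex.ofReal_sum]
  refine Finset.sum_congr rfl fun i _ => ?_
  simp [mul_comm]

theorem memLp_cplx {z : ℝ → R2} (hz : MemLp z 2 volume) :
    MemLp (fun x => cplx (z x)) 2 volume :=
  cplx.comp_memLp' hz

theorem MemH2.cplx {z : ℝ → R2} (hz : MemH2 z) : MemH2 (fun x => cplx (z x)) := by
  obtain ⟨h0, z₁, z₂, a, b, h1, h2⟩ := hz
  exact ⟨memLp_cplx h0, _, _, a.clm_comp _, b.clm_comp _, memLp_cplx h1, memLp_cplx h2⟩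

theorem eq_zero_of_ae_eq_const {y : L2} {c : C2} (h : ∀ᵐ x, y x = c) : c = 0 := by
  have h1 : MemLp (fun _ : ℝ => c) 2 volume := (memLp_congr_ae h).1 (Lp.memLp y)
  rw [memLp_const_iff (by norm_num) (by norm_num)] at h1
  simpa using h1

/-- G is symmetric and injective. Density of the domain is what makes the adjoint a formal adjoint.
-/
theorem dense_range_opG : (LinearMap.range (opG : L2 →ₗ[ℂ] L2))ᗮ = ⊥ := by
  rw [Submodule.eq_bot_iff]
  intro y hy
  refine opG_injective ?_
  rw [map_zero]
  refine ext_inner_left ℂ fun k => ?_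
  rw [inner_zero_right, inner_opG]
  exact (Submodule.mem_orthogonal _ _).1 hy _ ⟨k, rfl⟩

theorem inner_eq_zero_of_spansAdjointKernel {A : L2 →ₗ.[ℂ] L2} {S : L2 →L[ℂ] L2}
    (hdom : ∀ y, y ∈ A.domain ↔ ∃ h, opG h = y)
    (hA : ∀ h (hy : opG h ∈ A.domain), A ⟨opG h, hy⟩ = S h) {Ψ : ℝ → R2} {Ψc : L2}
    (hΨ : ∀ᵐ x, Ψc x = cplx (Ψ x)) (hk : SpansAdjointKernel A Ψ) (k : L2) :
    inner ℂ Ψc (S k) = 0 := by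
  have hd : Dense (A.domain : Set L2) := by
    rw [Submodule.dense_iff_topologicalClosure_eq_top, Submodule.topologicalClosure_eq_top_iff]
    have e : A.domain = LinearMap.range (opG : L2 →ₗ[ℂ] L2) := by
      ext y
      exact hdom y
    rw [e]
    exact dense_range_opG
  obtain ⟨h1, h2⟩ := (hk Ψc).2 ⟨1, by
    filter_upwards [hΨ] with x hx i
    rw [hx, one_mul, cplx_apply]⟩
  have hy : opG k ∈ A.domain := (hdom _).2 ⟨k, rfl⟩
  have := LinearPMap.adjoint_isFormalAdjoint hd ⟨Ψc, h1⟩ ⟨opG k, hy⟩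
  rw [h2, inner_zero_left, hA k hy] at this
  exact this.symm

/-- The inverse diffusion matrix. -/
def matDinv (d : ℝ) : Matrix (Fin 2) (Fin 2) ℂ := !![1, 0; 0, ((d : ℂ) ^ 2)⁻¹]

/-- The preimage of the translational mode under `(1 - ∂²)⁻¹`. -/
def transMode (d m : ℝ) (v : C2) (h : L2) : L2 :=
  opDG h + matL (matDinv d) (matL (matN m) (opDG h)
    + mulL (comp 1 (BoundedContinuousFunction.const ℝ v + evG h) ^ 2) (matL matT0 (opDG h))
    + mulL (2 * comp 0 (BoundedContinuousFunction.const ℝ v + evG h)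
      * comp 1 (BoundedContinuousFunction.const ℝ v + evG h)) (matL matT1 (opDG h)))

theorem transMode_ae (d m : ℝ) (v : C2) (h : L2) : ∀ᵐ x,
    transMode d m v h x 0 = -((v 1 + evG h x 1) ^ 2 * evDG h x 0
      + 2 * (v 0 + evG h x 0) * (v 1 + evG h x 1) * evDG h x 1) ∧
    transMode d m v h x 1 = evDG h x 1 + ((d : ℂ) ^ 2)⁻¹ * (-m * evDG h x 1
      + ((v 1 + evG h x 1) ^ 2 * evDG h x 0
      + 2 * (v 0 + evG h x 0) * (v 1 + evG h x 1) * evDG h x 1)) := by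
  set U : B2 := BoundedContinuousFunction.const ℝ v + evG h with hU
  rw [transMode, ← hU]
  set y₀ := matL (matN m) (opDG h) with e₀
  set y₁ := mulL (comp 1 U ^ 2) (matL matT0 (opDG h)) with e₁
  set y₂ := mulL (2 * comp 0 U * comp 1 U) (matL matT1 (opDG h)) with e₂
  filter_upwards [Lp.coeFn_add (opDG h) (matL (matDinv d) (y₀ + y₁ + y₂)),
    coeFn_matL (matDinv d) (y₀ + y₁ + y₂), Lp.coeFn_add (y₀ + y₁) y₂, Lp.coeFn_add y₀ y₁,
    coeFn_matL (matN m) (opDG h), coeFn_mulL (comp 1 U ^ 2) (matL matT0 (opDG h)),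
    coeFn_mulL (2 * comp 0 U * comp 1 U) (matL matT1 (opDG h)), coeFn_matL matT0 (opDG h),
    coeFn_matL matT1 (opDG h), coeFn_opDG h] with x h1 h2 h3 h4 h5 h6 h7 h8 h9 h10
  rw [h1, Pi.add_apply, h2, h3, Pi.add_apply, h4, Pi.add_apply, h5, h6, h7, h8, h9, h10]
  constructor
  · simp [matC_apply, matN, matDinv, matT0, matT1, hU]
    ring
  · simp [matC_apply, matN, matDinv, matT0, matT1, hU]
    ring

theorem hasWeakDeriv_transMode {d m : ℝ} {v : C2} {h : L2}
    (hr : (h : ℝ → C2) =ᵐ[volume] profRep d m v (evG h)) :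
    HasWeakDeriv (h : ℝ → C2) (transMode d m v h) := by
  have z : ∀ i x, HasDerivAt (comp i (evG h)) (comp i (evDG h) x) x := fun i x =>
    hasDerivAt_comp (hasDerivAt_evG h x) i
  have c : ∀ (w : ℂ) i x, HasDerivAt (BoundedContinuousFunction.const ℝ w + comp i (evG h) : B)
      (comp i (evDG h) x) x := fun w i x => (z i x).const_add _
  set q : B := BoundedContinuousFunction.const ℝ (v 1) + comp 1 (evG h) with hq
  set r : B := BoundedContinuousFunction.const ℝ (2 * v 1) + comp 1 (evG h) with hrr
  let P' : B := ((comp 1 (evDG h) * q + q * comp 1 (evDG h)) * comp 0 (evG h)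
      + q * q * comp 0 (evDG h)) + (BoundedContinuousFunction.const ℝ (v 0) * comp 1 (evDG h)
      * comp 1 (evG h) + BoundedContinuousFunction.const ℝ (v 0) * r * comp 1 (evDG h))
  have cr : ∀ x, HasDerivAt (BoundedContinuousFunction.const ℝ (v 0) * r : B)
      ((BoundedContinuousFunction.const ℝ (v 0) * comp 1 (evDG h) : B) x) x := fun x =>
    (c (2 * v 1) 1 x).const_mul (v 0)
  have hP : ∀ x, HasDerivAt (profCoupling v (evG h)) (P' x) x := fun x => by
    have := (hasDerivAt_mul (hasDerivAt_mul (c (v 1) 1 x) (c (v 1) 1 x)) (z 0 x)).add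
      (hasDerivAt_mul (cr x) (z 1 x))
    rw [profCoupling, pow_two]
    exact this
  let R' : B2 := incl 0 (-P') + incl 1 (comp 1 (evDG h)
    + BoundedContinuousFunction.const ℝ (((d : ℂ) ^ 2)⁻¹)
      * (BoundedContinuousFunction.const ℝ (-(m : ℂ)) * comp 1 (evDG h) + P'))
  have hR : ∀ x, HasDerivAt (profRep d m v (evG h)) (R' x) x := fun x =>
    hasDerivAt_incl (hP x).neg
      ((z 1 x).add ((((z 1 x).const_mul (-(m : ℂ))).add (hP x)).const_mul (((d : ℂ) ^ 2)⁻¹)))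
  refine (hasWeakDeriv_of_hasDerivAt hR R'.continuous).congr hr.symm ?_
  filter_upwards [transMode_ae d m v h] with x hx
  ext i
  fin_cases i
  · change R' x 0 = transMode d m v h x 0
    rw [hx.1]
    simp [R', P', incl_apply, hq, hrr]
    ring
  · change R' x 1 = transMode d m v h x 1
    rw [hx.2]
    simp [R', P', incl_apply, hq, hrr]
    left
    ring

/-- Put y = ∂ₓG h. Then y' = G h - h, and differentiating the representative of h gives y'' = y -
`transMode`, so y is G of `transMode`. -/
theorem opG_transMode {d m : ℝ} {v : C2} {h : L2}
    (hr : (h : ℝ → C2) =ᵐ[volume] profRep d m v (evG h)) :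
    opG (transMode d m v h) = opDG h := by
  have h1 : HasWeakDeriv ((opG h - h : L2) : ℝ → C2) ((opDG h - transMode d m v h : L2) : ℝ → C2) :=
    ((hasWeakDeriv_opG h).sub (hasWeakDeriv_transMode hr)).congr (Lp.coeFn_sub _ _).symm
      (Lp.coeFn_sub _ _).symm
  have := eq_opG_of_hasWeakDeriv (hasWeakDeriv_opDG h) h1
  rwa [sub_sub_cancel] at this

/-- Translation invariance at ε = 0: `transMode` is defined by solving L₀∂ₓu₀ = 0 for the diffusion
term, which `opG_transMode` makes consistent. -/
theorem linS_transMode {d m : ℝ} (hd : 0 < d) {v : C2} {h : L2}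
    (hr : (h : ℝ → C2) =ᵐ[volume] profRep d m v (evG h)) :
    linS d m 0 0 0 (BoundedContinuousFunction.const ℝ v + evG h) (transMode d m v h) = 0 := by
  have hd' : (d : ℂ) ≠ 0 := Complex.ofReal_ne_zero.2 hd.ne'
  have hD : ∀ y : L2, matL (matD d) (matL (matDinv d) y) = y := fun y => by
    have e : matD d * matDinv d = 1 := by
      ext i j
      fin_cases i <;> fin_cases j <;> simp [matD, matDinv, hd']
    rw [← mul_apply_eq_comp, ← map_mul, e, map_one, one_apply_eq_self]
  rw [linS_apply, opG_transMode hr, zero_smul, add_zero]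
  have e : opDG h - transMode d m v h = -matL (matDinv d) (matL (matN m) (opDG h)
    + mulL (comp 1 (BoundedContinuousFunction.const ℝ v + evG h) ^ 2) (matL matT0 (opDG h))
    + mulL (2 * comp 0 (BoundedContinuousFunction.const ℝ v + evG h)
      * comp 1 (BoundedContinuousFunction.const ℝ v + evG h)) (matL matT1 (opDG h))) := by
    rw [transMode]
    abel
  rw [e, map_neg, hD]
  abel

theorem exists_wave {d a m : ℝ} (hd : 0 < d) {f g : ℝ → ℝ} {fB gB : B}
    (hf : ∀ x, fB x = (f x : ℂ)) (hg : ∀ x, gB x = (g x : ℂ))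
    {z₀ : ℝ → R2} {v₀ : R2} {u₀ : ℝ → R2} (hu₀ : u₀ = fun x => z₀ x + v₀)
    (hz₀ : MemH2 z₀) (hu₀_even : IsEvenAE u₀)
    (hu₀_sol : IsStationarySolution d a m 0 f g u₀)
    (hu₀_stab : SpectrallyStableWithSimpleZero (linearization d m 0 f g u₀))
    {Ψ : ℝ → R2} (hΨ : MemH2 Ψ)
    (hΨ_ker : SpansAdjointKernel (linearization d m 0 f g u₀) Ψ)
    (hΨ_norm : ∫ x : ℝ, inner ℝ (weakDeriv u₀ x) (Ψ x) = 1) :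
    ∃ W : Wave d a m, W.v = cplx v₀ ∧ (∀ᵐ x, W.U x = cplx (u₀ x)) ∧
      (∀ᵐ x, evDG W.h x = cplx (weakDeriv u₀ x)) ∧ ∀ᵐ x, W.Ψ x = cplx (Ψ x) := by
  obtain ⟨ϱ, hϱ, hspec⟩ := hu₀_stab.1
  have mZ := memLp_cplx hz₀.1
  have mΨ := memLp_cplx hΨ.1
  set Z : L2 := mZ.toLp _ with hZ
  set Ψc : L2 := mΨ.toLp _ with hΨc
  have cZ : (Z : ℝ → C2) =ᵐ[volume] fun x => cplx (z₀ x) := mZ.coeFn_toLp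
  have cΨ : ∀ᵐ x, Ψc x = cplx (Ψ x) := mΨ.coeFn_toLp
  obtain ⟨h, hh⟩ := exists_opG_eq_of_memH2 (hz₀.cplx.congr cZ.symm)
  set v : C2 := cplx v₀ with hv
  set U : B2 := BoundedContinuousFunction.const ℝ v + evG h with hUdef
  have hU : ∀ᵐ x, U x = cplx (u₀ x) := by
    filter_upwards [cZ, coeFn_opG h] with x h1 h2
    rw [hh, h1] at h2
    change v + evG h x = _
    rw [← h2, hu₀, map_add, add_comm]
  have hU' : ∀ᵐ x : ℝ, ∀ i, U x i = ((u₀ x i : ℝ) : ℂ) := by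
    filter_upwards [hU] with x hx i
    rw [hx, cplx_apply]
  obtain ⟨u₁, u₂, w1, w2, heq⟩ := hu₀_sol
  have k1 : HasWeakDeriv (fun x => cplx (u₀ x)) (opDG h) := by
    have := (hasWeakDeriv_opG h).add (hasWeakDeriv_const v)
    refine this.congr ?_ ?_
    · filter_upwards [hU, coeFn_opG h] with x h1 h2
      rw [← h1, Pi.add_apply, h2, add_comm]
      rfl
    · exact ae_of_all _ fun x => add_zero _
  have a1 : ∀ᵐ x, cplx (u₁ x) = opDG h x := (w1.clm_comp cplx).ae_unique k1
  have a2 : ∀ᵐ x, cplx (u₂ x) = (opG h - h : L2) x :=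
    (w2.clm_comp cplx).ae_unique ((hasWeakDeriv_opDG h).congr (a1.mono fun x hx => hx.symm)
      (ae_eq_refl _))
  have a3 : ∀ᵐ x, evDG h x = cplx (weakDeriv u₀ x) := by
    filter_upwards [a1, w1.weakDeriv_ae, coeFn_opDG h] with x h1 h2 h3
    rw [h2, h1, h3]
  have hprof : ∀ᵐ x, profS d m 0 0 0 (BoundedContinuousFunction.const ℝ v) (evG h) h x
      = !₂[-(-v 0 - v 0 * v 1 ^ 2 + a), -(-m * v 1 + v 0 * v 1 ^ 2)] := by
    rw [profS_eq, add_apply, zero_smul]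
    filter_upwards [diffS_ae d m h, coeffS_ae 0 0
      ((comp 1 (BoundedContinuousFunction.const ℝ v) + comp 1 (evG h)) ^ 2)
      (comp 0 (BoundedContinuousFunction.const ℝ v)
        * (2 * comp 1 (BoundedContinuousFunction.const ℝ v) + comp 1 (evG h))) h,
      Lp.coeFn_add (diffS d m h) (coeffS 0 0
      ((comp 1 (BoundedContinuousFunction.const ℝ v) + comp 1 (evG h)) ^ 2)
      (comp 0 (BoundedContinuousFunction.const ℝ v)
        * (2 * comp 1 (BoundedContinuousFunction.const ℝ v) + comp 1 (evG h))) h),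
      heq, a2, hU', Lp.coeFn_sub (opG h) h, coeFn_opG h] with x h1 h2 h3 h4 h5 h6 h7 h8
    have e0 := congrArg (fun y : R2 => (y 0 : ℂ)) h4
    have e1 := congrArg (fun y : R2 => (y 1 : ℂ)) h4
    have g0 := congrArg (fun y : C2 => y 0) h5
    have g1 := congrArg (fun y : C2 => y 1) h5
    have i0 : v 0 + evG h x 0 = _ := h6 0
    have i1 : v 1 + evG h x 1 = _ := h6 1
    rw [h7, Pi.sub_apply, h8] at g0 g1
    rw [h3, Pi.add_apply]
    simp [reaction] at e0 e1 g0 g1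
    ext i
    fin_cases i
    · simp only [Fin.zero_eta, PiLp.add_apply, h1.1, h2.1]
      simp
      rw [← i0, ← i1, g0] at e0
      linear_combination e0
    · simp only [Fin.mk_one, PiLp.add_apply, h1.2, h2.2]
      simp
      rw [← i0, ← i1, g1] at e1
      linear_combination e1
  -- The profile expression lies in L² and equals a constant, minus the reaction at v. Hence both
  -- vanish: v is a homogeneous steady state, and G h solves the profile equation.
  have hconst := eq_zero_of_ae_eq_const hprof
  have r0 := congrArg (fun y : C2 => y 0) hconst
  have r1 := congrArg (fun y : C2 => y 1) hconst
  have hprofile : profS d m 0 0 0 (BoundedContinuousFunction.const ℝ v) (evG h) h = 0 := by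
    refine Lp.ext ?_
    filter_upwards [hprof, Lp.coeFn_zero C2 2 (volume : Measure ℝ)] with x h1 h2
    rw [h1, h2, hconst]
    rfl
  have hrep := ae_eq_profRep hd hprofile
  have hdom := mem_linearization_domain_iff d m 0 hf hg hU'
  have hA : ∀ k (hy : opG k ∈ (linearization d m 0 f g u₀).domain),
      linearization d m 0 f g u₀ ⟨opG k, hy⟩ = linS d m 0 0 0 U k := fun k hy => by
    rw [linearization_opG d m 0 hf hg hU' k hy, Complex.ofReal_zero, linS_zero]
  have hη : opG (transMode d m v h) = opDG h := opG_transMode hrep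
  have hS := linS_transMode hd hrep
  have hinner : inner ℂ Ψc (opG (transMode d m v h)) = 1 := by
    rw [hη, L2.inner_def]
    have : ∫ x, inner ℂ (Ψc x) (opDG h x)
        = ∫ x, ((inner ℝ (weakDeriv u₀ x) (Ψ x) : ℝ) : ℂ) := by
      refine integral_congr_ae ?_
      filter_upwards [cΨ, a3, coeFn_opDG h] with x h1 h2 h3
      rw [h1, h3, h2, inner_cplx]
    rw [this, integral_complex_ofReal, hΨ_norm, Complex.ofReal_one]
  have hη0 : transMode d m v h ≠ 0 := fun h0 => by
    rw [h0, map_zero, inner_zero_right] at hinner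
    exact zero_ne_one hinner
  refine ⟨{ v := v, h := h, η := transMode d m v h, Ψ := Ψc, ϱ := ϱ, d_pos := hd, ϱ_pos := hϱ
            conj_v := conjC_cplx v₀
            react_zero := ?_, react_one := ?_
            profile := hprofile
            conj_h := ?_, refl_h := ?_
            opG_η := hη, η_ne_zero := hη0, S_η := hS
            kernel := ?_
            inner_S := inner_eq_zero_of_spansAdjointKernel hdom hA cΨ hΨ_ker
            inner_η := hinner
            isUnit := ?_ }, rfl, hU, a3, cΨ⟩
  · simp only [PiLp.zero_apply] at r0
    exact neg_eq_zero.1 r0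
  · simp only [PiLp.zero_apply] at r1
    exact neg_eq_zero.1 r1
  · refine opG_injective ?_
    rw [← conjL_opG, hh]
    refine Lp.ext ?_
    filter_upwards [coeFn_conjL Z, cZ] with x h1 h2
    rw [h1, h2, conjC_cplx]
  · refine opG_injective ?_
    rw [← reflL_opG, hh]
    refine Lp.ext ?_
    filter_upwards [coeFn_reflL Z, cZ, ae_comp_neg (p := fun x => Z x = cplx (z₀ x)) cZ,
      hu₀_even] with x h1 h2 h3 h4
    rw [hu₀] at h4
    rw [h1, h2, h3, add_right_cancel h4]
  · intro k hk
    refine IsSimpleEigenvalue.exists_smul_eq hu₀_stab.2 opG_injective hdom hA hη0 ?_ ?_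
    · rw [hS, zero_smul, sub_zero]
    · rw [hk, zero_smul, sub_zero]
  · intro μ hμ hre
    refine (isInResolventSet_iff_isUnit opG_injective hdom hA μ).1 ?_
    by_contra hcon
    rcases hspec hcon with h1 | h1
    · exact absurd (h1 : μ.re ≤ -ϱ) (not_le.2 hre)
    · exact hμ h1


/-! ### Real states on the branch -/

/-- Componentwise real part. -/
def reC : C2 →L[ℝ] R2 :=
  LinearMap.toContinuousLinearMap
    { toFun := fun v => WithLp.toLp 2 fun i => (v i).re
      map_add' := fun v w => by
        ext i
        simp
      map_smul' := fun c v => by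
        ext i
        simp }

@[simp] theorem reC_apply (v : C2) (i : Fin 2) : reC v i = (v i).re := rfl

theorem cplx_reC {v : C2} (hv : conjC v = v) : cplx (reC v) = v := by
  ext i
  rw [cplx_apply, reC_apply]
  exact Complex.conj_eq_iff_re.1 (congrArg (fun y : C2 => y i) hv)

theorem reC_cplx (v : R2) : reC (cplx v) = v := by
  ext i
  simp

theorem norm_reC_le (v : C2) : ‖reC v‖ ≤ ‖v‖ := by
  rw [EuclideanSpace.norm_eq, EuclideanSpace.norm_eq]
  gcongr with i
  exact Complex.abs_re_le_norm _

theorem eventually_ofReal {p : ℂ → Prop} (h : ∀ᶠ ε in 𝓝 0, p ε) : ∀ᶠ ε : ℝ in 𝓝 0, p ε :=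
  map_ofReal_le h

theorem add_sq_le_of_le {x y z a b c : ℝ} (hx : 0 ≤ x) (hy : 0 ≤ y) (hz : 0 ≤ z) (ha : x ≤ a)
    (hb : y ≤ b) (hc : z ≤ c) : x ^ 2 + y ^ 2 + z ^ 2 ≤ (a + b + c) ^ 2 := by
  have h : (x + y + z) ^ 2 ≤ (a + b + c) ^ 2 := by gcongr
  nlinarith [mul_nonneg hx hy, mul_nonneg hx hz, mul_nonneg hy hz]

theorem hasDerivAt_bdDG_one (k : B2) (x : ℝ) :
    HasDerivAt (bdDG C2 one_re_pos k) ((bdG C2 one_re_pos k - k) x) x := by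
  refine (hasDerivAt_bdDG one_re_pos k x).congr_deriv ?_
  simp

theorem hasWeakDeriv_re_bdG (v : C2) (k : B2) :
    HasWeakDeriv (fun x => reC (background v k x)) (fun x => reC (bdDG C2 one_re_pos k x)) := by
  have h1 : ∀ x, HasDerivAt (background v k) (bdDG C2 one_re_pos k x) x := fun x =>
    (hasDerivAt_bdG one_re_pos k x).const_add v
  exact (hasWeakDeriv_of_hasDerivAt h1 (bdDG C2 one_re_pos k).continuous).clm_comp reC

theorem hasWeakDeriv_re_bdDG (k : B2) : HasWeakDeriv (fun x => reC (bdDG C2 one_re_pos k x))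
    (fun x => reC ((bdG C2 one_re_pos k - k : B2) x)) :=
  (hasWeakDeriv_of_hasDerivAt (hasDerivAt_bdDG_one k)
    (bdG C2 one_re_pos k - k : B2).continuous).clm_comp reC

theorem memLp_re_of_bounded {T : ℝ} (y : B2) :
    MemLp (fun x => reC (y x)) 2 (volume.restrict (Ioc 0 T)) :=
  MemLp.of_bound (reC.continuous.comp y.continuous).aestronglyMeasurable ‖y‖
    (ae_of_all _ fun x => (norm_reC_le _).trans (y.norm_coe_le_norm x))

theorem memH2Per_re_background {T : ℝ} {v : C2} {k : B2} (hk : shiftB T k = k) :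
    MemH2Per T (fun x => reC (background v k x)) := by
  obtain ⟨e1, -⟩ := bdG_symmetry (σ := shiftB T) (s := 1) (one_mul 1) (fun _ _ => rfl)
    (fun _ _ h => shiftB_hasDerivAt h) k
  rw [hk] at e1
  refine ⟨ae_of_all _ fun x => ?_, memLp_re_of_bounded _, _, _, hasWeakDeriv_re_bdG v k,
    hasWeakDeriv_re_bdDG k, memLp_re_of_bounded _, memLp_re_of_bounded _⟩
  have : bdG C2 one_re_pos k (x + T) = bdG C2 one_re_pos k x :=
    (congrArg (fun y : B2 => y x) e1).symm
  change reC (v + bdG C2 one_re_pos k (x + T)) = reC (v + bdG C2 one_re_pos k x)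
  rw [this]

theorem memH2_re_evG (h : L2) : MemH2 (fun x => reC (evG h x)) := by
  obtain ⟨h0, z₁, z₂, a, b, h1, h2⟩ := (memH2_opG h).congr (coeFn_opG h)
  exact ⟨reC.comp_memLp' h0, _, _, a.clm_comp _, b.clm_comp _, reC.comp_memLp' h1,
    reC.comp_memLp' h2⟩

/-- The deviation and its two derivatives are bounded operators applied to k; sup norms over a
period of length T give the factor √T. -/
theorem h2PerNorm_re_background_le {T : ℝ} (hT : 0 < T) (v₀ : R2) (k : B2) :
    h2PerNorm T (fun x => reC (background (cplx v₀) k x) - v₀)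
      ≤ Real.sqrt T * (‖(bdG C2 one_re_pos : B2 →L[ℂ] B2)‖
        + ‖(bdDG C2 one_re_pos : B2 →L[ℂ] B2)‖
        + ‖(bdG C2 one_re_pos - 1 : B2 →L[ℂ] B2)‖) * ‖k‖ := by
  set c₀ := ‖(bdG C2 one_re_pos : B2 →L[ℂ] B2)‖ with hc₀
  set c₁ := ‖(bdDG C2 one_re_pos : B2 →L[ℂ] B2)‖ with hc₁
  set c₂ := ‖(bdG C2 one_re_pos - 1 : B2 →L[ℂ] B2)‖ with hc₂
  have p₀ : 0 ≤ c₀ := norm_nonneg _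
  have p₁ : 0 ≤ c₁ := norm_nonneg _
  have p₂ : 0 ≤ c₂ := norm_nonneg _
  have e0 : (fun x => reC (background (cplx v₀) k x) - v₀)
      = fun x => reC (background 0 k x) := by
    funext x
    change reC (cplx v₀ + bdG C2 one_re_pos k x) - v₀ = reC (0 + bdG C2 one_re_pos k x)
    rw [map_add, reC_cplx, zero_add, add_sub_cancel_left]
  have w1 := hasWeakDeriv_re_bdG 0 k
  have w2 := hasWeakDeriv_re_bdDG k
  have bound : ∀ {A : B2 →L[ℂ] B2} x, ‖reC (A k x)‖ ≤ ‖A‖ * ‖k‖ := fun {A} x =>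
    (norm_reC_le _).trans (((A k).norm_coe_le_norm x).trans (A.le_opNorm k))
  have hb : ∀ᵐ x, ‖‖reC (background 0 k x)‖ ^ 2
      + ‖weakDeriv (fun x => reC (background 0 k x)) x‖ ^ 2
      + ‖weakDeriv (weakDeriv (fun x => reC (background 0 k x))) x‖ ^ 2‖
      ≤ ((c₀ + c₁ + c₂) * ‖k‖) ^ 2 := by
    filter_upwards [w1.weakDeriv_ae, w1.weakDeriv_weakDeriv_ae w2] with x h1 h2
    rw [h1, h2, Real.norm_of_nonneg (by positivity)]
    have b0 : ‖reC (background 0 k x)‖ ≤ c₀ * ‖k‖ := by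
      have e : background 0 k x = bdG C2 one_re_pos k x := zero_add _
      rw [e]
      exact bound x
    have b1 : ‖reC (bdDG C2 one_re_pos k x)‖ ≤ c₁ * ‖k‖ := bound x
    have b2 : ‖reC ((bdG C2 one_re_pos k - k : B2) x)‖ ≤ c₂ * ‖k‖ := by
      have e : bdG C2 one_re_pos k - k = (bdG C2 one_re_pos - 1 : B2 →L[ℂ] B2) k := by
        rw [sub_apply, one_apply_eq_self]
      rw [e]
      exact bound x
    rw [add_mul, add_mul]
    exact add_sq_le_of_le (norm_nonneg _) (norm_nonneg _) (norm_nonneg _) b0 b1 b2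
  have hint := norm_setIntegral_le_of_norm_le_const_ae (μ := volume) (s := Ioc (0 : ℝ) T)
    (by simp) (ae_restrict_of_ae (s := Ioc 0 T) hb)
  rw [measureReal_def, Real.volume_Ioc, sub_zero, ENNReal.toReal_ofReal hT.le] at hint
  rw [e0, h2PerNorm]
  refine (Real.sqrt_le_sqrt ((le_abs_self _).trans hint)).trans ?_
  clear_value c₀ c₁ c₂
  rw [mul_comm, Real.sqrt_mul hT.le, mul_assoc,
    Real.sqrt_sq (mul_nonneg (add_nonneg (add_nonneg p₀ p₁) p₂) (norm_nonneg k))]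

namespace Branch

variable {d a m T : ℝ} {W : Wave d a m} {f g : B} (Br : Branch W f g T)

/-- The real state on the branch. -/
def re (ε : ℝ) (x : ℝ) : R2 := reC (Br.U ε x)

theorem eventually_cplx_re : ∀ᶠ ε : ℝ in 𝓝 0, ∀ x, cplx (Br.re ε x) = Br.U ε x := by
  filter_upwards [Br.conj_k, Br.conj_H] with ε h1 h2 x
  refine cplx_reC ?_
  have e : conjB (Br.U ε) = Br.U ε := by
    rw [U, map_add, conjB_background W.conj_v, h1, ← evG_conjL, h2]
  exact congrArg (fun y : B2 => y x) e

theorem eventually_even : ∀ᶠ ε : ℝ in 𝓝 0, ∀ x, Br.re ε (-x) = Br.re ε x := by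
  filter_upwards [eventually_ofReal Br.refl_k, eventually_ofReal Br.refl_H] with ε h1 h2 x
  have e : reflB C2 (Br.U ε) = Br.U ε := by
    rw [U, map_add, reflB_background, h1, ← evG_reflL, h2]
  exact congrArg (fun y : B2 => reC (y x)) e

/-- The profile equation was obtained by subtracting the background equation from the full one, so
their sum is the full equation; real parts are then taken. -/
theorem eventually_isStationarySolution {fr gr : ℝ → ℝ} (hf : ∀ x, f x = (fr x : ℂ))
    (hg : ∀ x, g x = (gr x : ℂ)) :
    ∀ᶠ ε : ℝ in 𝓝 0, IsStationarySolution d a m ε fr gr (Br.re ε) := by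
  filter_upwards [eventually_ofReal Br.bg_eq, eventually_ofReal Br.prof_eq,
    Br.eventually_cplx_re] with ε h1 h2 h3
  have a0 := (hasWeakDeriv_opG (Br.H ε)).congr (coeFn_opG _) (coeFn_opDG _)
  have a1 := (hasWeakDeriv_opDG (Br.H ε)).congr (coeFn_opDG _) (ae_eq_refl _)
  refine ⟨_, _, ((hasWeakDeriv_re_bdG W.v (Br.k ε)).add (a0.clm_comp reC)).congr
    (ae_of_all _ fun x => ?_) (ae_eq_refl _), (hasWeakDeriv_re_bdDG (Br.k ε)).add
    (a1.clm_comp reC), ?_⟩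
  · change reC (background W.v (Br.k ε) x) + reC (evG (Br.H ε) x) = reC _
    rw [← map_add]
    rfl
  rw [profS_eq, add_apply] at h2
  set V := background W.v (Br.k ε) with hV
  set ζ := evG (Br.H ε) with hζ
  filter_upwards [diffS_ae d m (Br.H ε), coeffS_ae ((ε : ℂ) • f) ((ε : ℂ) • g)
    ((comp 1 V + comp 1 ζ) ^ 2) (comp 0 V * (2 * comp 1 V + comp 1 ζ)) (Br.H ε),
    Lp.coeFn_add (diffS d m (Br.H ε)) (coeffS ((ε : ℂ) • f) ((ε : ℂ) • g)
    ((comp 1 V + comp 1 ζ) ^ 2) (comp 0 V * (2 * comp 1 V + comp 1 ζ)) (Br.H ε)),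
    Lp.coeFn_zero C2 2 (volume : Measure ℝ), Lp.coeFn_sub (opG (Br.H ε)) (Br.H ε),
    coeFn_opG (Br.H ε)] with x d1 d2 d3 d4 d5 d6
  rw [h2, d4, Pi.add_apply] at d3
  have e0 := congrArg (fun y : C2 => y 0) d3
  have e1 := congrArg (fun y : C2 => y 1) d3
  simp only [PiLp.add_apply, d1.1, d1.2, d2.1, d2.2] at e0 e1
  have b0 := bgEq_apply_zero d a m f g W.v ε (Br.k ε) x
  have b1 := bgEq_apply_one d a m f g W.v ε (Br.k ε) x
  rw [h1] at b0 b1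
  have u0 : V x 0 + ζ x 0 = (Br.re ε x 0 : ℂ) := (congrArg (fun y : C2 => y 0) (h3 x)).symm
  have u1 : V x 1 + ζ x 1 = (Br.re ε x 1 : ℂ) := (congrArg (fun y : C2 => y 1) (h3 x)).symm
  have v0 : V x 0 = W.v 0 + bdG C2 one_re_pos (Br.k ε) x 0 := rfl
  have v1 : V x 1 = W.v 1 + bdG C2 one_re_pos (Br.k ε) x 1 := rfl
  simp [hf, hg] at e0 e1 b0 b1
  rw [← v0, ← v1] at b0 b1
  have E0 : (bdG C2 one_re_pos (Br.k ε) x 0 - Br.k ε x 0) + (ζ x 0 - Br.H ε x 0)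
      + ε * fr x * (bdDG C2 one_re_pos (Br.k ε) x 0 + evDG (Br.H ε) x 0)
      + ((ε * gr x * Br.re ε x 0 - Br.re ε x 0 - Br.re ε x 0 * Br.re ε x 1 ^ 2 + a : ℝ) : ℂ)
      = 0 := by
    push_cast
    rw [← u0, ← u1]
    linear_combination -e0 - b0
  have E1 : (d ^ 2 : ℝ) * ((bdG C2 one_re_pos (Br.k ε) x 1 - Br.k ε x 1) + (ζ x 1 - Br.H ε x 1))
      + ((-m * Br.re ε x 1 + Br.re ε x 0 * Br.re ε x 1 ^ 2 : ℝ) : ℂ) = 0 := by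
    push_cast
    rw [← u0, ← u1]
    linear_combination -e1 - b1
  have R0 := congrArg Complex.re E0
  have R1 := congrArg Complex.re E1
  rw [← Complex.ofReal_mul] at R0
  simp only [Complex.add_re, Complex.re_ofReal_mul, Complex.sub_re, Complex.ofReal_re,
    Complex.zero_re] at R0 R1
  simp only [Pi.add_apply, d5, Pi.sub_apply, d6]
  ext i
  fin_cases i
  · simp [reaction, ← hζ]
    linear_combination R0
  · simp [reaction, ← hζ]
    linear_combination R1

theorem exists_bound {X : Type*} [NormedAddCommGroup X] [NormedSpace ℂ X] {y : ℂ → X} {y' : X}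
    (hy : HasDerivAt y y' 0) : ∃ C : ℝ, 0 < C ∧ ∀ᶠ ε : ℝ in 𝓝 0, ‖y ε - y 0‖ ≤ C * |ε| := by
  obtain ⟨C, hC, h⟩ := hy.isBigO_sub.exists_pos
  refine ⟨C, hC, ?_⟩
  filter_upwards [eventually_ofReal h.bound] with ε hε
  simpa using hε

/-- μ is analytic with μ(0) = 0, so its second-order Taylor remainder is O(ε²). -/
theorem exists_μ_bound :
    ∃ C : ℝ, 0 < C ∧ ∀ᶠ ε : ℝ in 𝓝 0, ‖Br.μ ε - ε * deriv Br.μ 0‖ ≤ C * ε ^ 2 := by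
  obtain ⟨p, hp⟩ := Br.contDiff_μ.analyticAt
  obtain ⟨C, hC, h⟩ := (hp.isBigO_sub_partialSum_pow 2).exists_pos
  refine ⟨C, hC, ?_⟩
  filter_upwards [eventually_ofReal h.bound] with ε hε
  have h0 : p.coeff 0 = 0 := by
    have := hp.coeff_zero fun _ => (1 : ℂ)
    rw [Br.μ_zero] at this
    simpa using this
  have h1 : deriv Br.μ 0 = p.coeff 1 := hp.deriv
  simp only [FormalMultilinearSeries.partialSum] at hε
  rw [Finset.sum_range_succ, Finset.sum_range_one] at hε
  simp only [FormalMultilinearSeries.apply_eq_pow_smul_coeff, h0, ← h1] at hε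
  simpa using hε

/-- A nonzero derivative keeps the only spectral value to the right of -ϱ/2 away from 0 for small ε
≠ 0. -/
theorem eventually_isInvertible (hM : deriv Br.μ 0 ≠ 0) :
    ∀ᶠ ε : ℝ in 𝓝 0, ε ≠ 0 → IsUnit (Br.S ε - (0 : ℂ) • opG) := by
  have h1 := eventually_nhdsWithin_iff.1 (Br.hasDerivAt_μ.eventually_ne (c := 0) hM)
  filter_upwards [eventually_ofReal h1, eventually_ofReal Br.spectrum_eq] with ε h2 h3 hε
  by_contra hcon
  have h4 := h3 0 (by simpa using (half_pos W.ϱ_pos).le) hcon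
  exact h2 (by simpa using hε) (by linear_combination h4)

end Branch


/-! ### Conclusion -/

theorem exists_bounded_of_periodic {q : ℝ → ℝ} {T : ℝ} (hT : 0 < T) (hq : Continuous q)
    (hp : Function.Periodic q T) : ∃ Q : B, ∀ x, Q x = (q x : ℂ) := by
  obtain ⟨C, hC⟩ := (hp.isBounded_of_continuous hT.ne' hq).exists_norm_le
  refine ⟨BoundedContinuousFunction.ofNormedAddCommGroup (fun x => (q x : ℂ)) (by fun_prop) C
    fun x => ?_, fun x => rfl⟩
  rw [Complex.norm_real]
  exact hC _ ⟨x, rfl⟩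

theorem periodic_deriv {q : ℝ → ℝ} {T : ℝ} (hp : Function.Periodic q T) :
    Function.Periodic (deriv q) T := fun x => by
  have h : (fun y => q (y + T)) = q := funext hp
  rw [← deriv_comp_add_const, h]

namespace Branch

variable {d a m T : ℝ} {W : Wave d a m} {f g : B} (Br : Branch W f g T)

theorem deriv_μ_eq_ofReal {fr gr : ℝ → ℝ} {u Ψ : ℝ → R2} {f' g' : B}
    (hf : ∀ x, f x = (fr x : ℂ)) (hg : ∀ x, g x = (gr x : ℂ)) (hf' : ∀ x, f' x = ((deriv fr x : ℝ) : ℂ))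
    (hg' : ∀ x, g' x = ((deriv gr x : ℝ) : ℂ)) (df : Differentiable ℝ fr) (dg : Differentiable ℝ gr)
    (hu : ∀ᵐ x, W.U x = cplx (u x)) (hu' : ∀ᵐ x, evDG W.h x = cplx (weakDeriv u x))
    (hΨ : ∀ᵐ x, W.Ψ x = cplx (Ψ x)) (hM : melnikov fr gr u Ψ ≠ 0) :
    deriv Br.μ 0 = (melnikov fr gr u Ψ : ℂ) := by
  -- A non-integrable integrand would give the Melnikov integral the default value 0, which `hM`
  -- excludes.
  have hint : Integrable fun x => (deriv fr x * weakDeriv u x 0 + deriv gr x * u x 0) * Ψ x 0 := by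
    by_contra h
    exact hM (integral_undef h)
  have e : (fun x => (f' x * evDG W.h x 0 + g' x * W.U x 0) * star (W.Ψ x 0)) =ᵐ[volume]
      fun x => (((deriv fr x * weakDeriv u x 0 + deriv gr x * u x 0) * Ψ x 0 : ℝ) : ℂ) := by
    filter_upwards [hu, hu', hΨ] with x h1 h2 h3
    rw [h1, h2, h3, hf', hg']
    simp
  have hf0 : (f : ℝ → ℂ) = fun x => (fr x : ℂ) := funext hf
  have hg0 : (g : ℝ → ℂ) = fun x => (gr x : ℂ) := funext hg
  rw [Br.deriv_μ_eq_melnikov (f' := f') (g' := g')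
    (fun x => by
      rw [hf', hf0]
      exact (df x).hasDerivAt.ofReal_comp)
    (fun x => by
      rw [hg', hg0]
      exact (dg x).hasDerivAt.ofReal_comp) ((integrable_congr e).2 hint.ofReal), integral_congr_ae e,
    integral_complex_ofReal]
  rfl

theorem eventually_spectral {fr gr : ℝ → ℝ} (hf : ∀ x, f x = (fr x : ℂ))
    (hg : ∀ x, g x = (gr x : ℂ)) (hM : deriv Br.μ 0 ≠ 0) : ∀ᶠ ε : ℝ in 𝓝 0,
    (ε ≠ 0 → IsInvertible (linearization d m ε fr gr (Br.re ε))) ∧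
    spectrumOf (linearization d m ε fr gr (Br.re ε)) ⊆
      {z : ℂ | z.re ≤ -(W.ϱ / 2)} ∪ {((-(Br.μ ε).re : ℝ) : ℂ)} ∧
    IsSimpleEigenvalue (linearization d m ε fr gr (Br.re ε)) ((-(Br.μ ε).re : ℝ) : ℂ) := by
  filter_upwards [Br.eventually_cplx_re, Br.eventually_isInvertible hM,
    eventually_ofReal Br.spectrum_eq, eventually_ofReal Br.eventually_kernel,
    eventually_ofReal Br.eventually_no_generalized, eventually_ofReal Br.eig_eq,
    eventually_ofReal Br.ℓ_κ, Br.conj_μ] with ε h1 h2 h3 h4 h5 h6 h7 h8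
  have hU : ∀ᵐ x : ℝ, ∀ i, Br.U ε x i = ((Br.re ε x i : ℝ) : ℂ) :=
    ae_of_all _ fun x i => by rw [← h1, cplx_apply]
  have hdom := mem_linearization_domain_iff d m ε hf hg hU
  have hA : ∀ k (hy : opG k ∈ (linearization d m ε fr gr (Br.re ε)).domain),
      linearization d m ε fr gr (Br.re ε) ⟨opG k, hy⟩ = Br.S ε k := fun k hy =>
    linearization_opG d m ε hf hg hU k hy
  -- The conjugation symmetry makes μ(ε) real, so its real part loses nothing.
  have hμ : ((-(Br.μ ε).re : ℝ) : ℂ) = -Br.μ ε := by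
    rw [Complex.ofReal_neg]
    exact congrArg Neg.neg (Complex.conj_eq_iff_re.1 h8)
  have hres := isInResolventSet_iff_isUnit opG_injective hdom hA
  rw [hμ]
  refine ⟨fun hε => (hres 0).2 (h2 hε), fun z hz => ?_, ?_⟩
  · by_cases hre : z.re ≤ -(W.ϱ / 2)
    · exact Or.inl hre
    · exact Or.inr (h3 z (not_le.1 hre).le fun h => hz ((hres z).2 h))
  · refine isSimpleEigenvalue_of_factored opG_injective hdom hA (η := Br.κ ε) ?_ ?_ ?_ ?_
    · intro h0
      rw [h0, map_zero] at h7
      exact W.ℓ_η_ne_zero h7.symm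
    · rw [neg_smul, sub_neg_eq_add]
      exact h6
    · intro h hh
      rw [neg_smul, sub_neg_eq_add] at hh
      exact h4 h hh
    · intro h hh
      rw [neg_smul, sub_neg_eq_add] at hh
      exact h5 h hh

theorem exists_eLpNorm_bound {u : ℝ → R2} (hu : ∀ᵐ x, W.U x = cplx (u x)) :
    ∃ C : ℝ, 0 < C ∧ ∀ᶠ ε : ℝ in 𝓝 0,
      eLpNorm (fun x => Br.re ε x - u x) ∞ volume ≤ ENNReal.ofReal (C * |ε|) := by
  obtain ⟨C, hC, h⟩ := exists_bound Br.hasDerivAt_U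
  refine ⟨C, hC, ?_⟩
  filter_upwards [h] with ε hε
  rw [eLpNorm_exponent_top]
  refine eLpNormEssSup_le_of_ae_bound ?_
  filter_upwards [hu] with x hx
  rw [Br.U_zero] at hε
  have e : Br.re ε x - u x = reC ((Br.U ε - W.U : B2) x) := by
    rw [BoundedContinuousFunction.sub_apply, map_sub, hx, reC_cplx]
    rfl
  rw [e]
  exact (norm_reC_le _).trans (((Br.U ε - W.U).norm_coe_le_norm x).trans hε)

theorem exists_h2PerNorm_bound (hT : 0 < T) {v₀ : R2} (hv : W.v = cplx v₀) :
    ∃ C : ℝ, 0 < C ∧ ∀ᶠ ε : ℝ in 𝓝 0,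
      h2PerNorm T (fun x => reC (background W.v (Br.k ε) x) - v₀) ≤ C * |ε| := by
  obtain ⟨C, hC, h⟩ := exists_bound Br.hasDerivAt_k
  set K := Real.sqrt T * (‖(bdG C2 one_re_pos : B2 →L[ℂ] B2)‖
        + ‖(bdDG C2 one_re_pos : B2 →L[ℂ] B2)‖
        + ‖(bdG C2 one_re_pos - 1 : B2 →L[ℂ] B2)‖) with hK
  have hK0 : 0 ≤ K := by positivity
  refine ⟨(K + 1) * C, by positivity, ?_⟩
  filter_upwards [h] with ε hε
  rw [Br.k_zero, sub_zero] at hε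
  rw [hv]
  refine (h2PerNorm_re_background_le hT v₀ (Br.k ε)).trans ?_
  rw [← hK]
  calc K * ‖Br.k ε‖ ≤ (K + 1) * ‖Br.k ε‖ := by gcongr; linarith
    _ ≤ (K + 1) * (C * |ε|) := by gcongr
    _ = (K + 1) * C * |ε| := by ring

end Branch

end Klausmeier

end

theorem mainTheorem12 (T d a m : ℝ) (hT : 0 < T) (hd : 0 < d) (ha : 0 < a) (hm : 0 < m)
    (f g : ℝ → ℝ)
    (hf : ContDiff ℝ 1 f) (hfT : Function.Periodic f T) (hf_odd : Function.Odd f)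
    (hg : ContDiff ℝ 1 g) (hgT : Function.Periodic g T) (hg_even : Function.Even g)
    (z₀ : ℝ → R2) (v₀ : R2) (u₀ : ℝ → R2) (hu₀ : u₀ = fun x => z₀ x + v₀)
    (hz₀ : MemH2 z₀) (hu₀_even : IsEvenAE u₀)
    (hu₀_sol : IsStationarySolution d a m 0 f g u₀)
    (hu₀_stab : SpectrallyStableWithSimpleZero (linearization d m 0 f g u₀))
    (Ψ : ℝ → R2) (hΨ : MemH2 Ψ)
    (hΨ_ker : SpansAdjointKernel (linearization d m 0 f g u₀) Ψ)
    (hΨ_norm : ∫ x : ℝ, inner ℝ (weakDeriv u₀ x) (Ψ x) = 1)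
    (hM : melnikov f g u₀ Ψ ≠ 0) :
    ∃ C ε₀ η : ℝ, 0 < C ∧ 0 < ε₀ ∧ 0 < η ∧
      ∃ (z v u : ℝ → ℝ → R2) (lam : ℝ → ℝ), ∀ ε ∈ Ioo (-ε₀) ε₀,
        MemH2 (z ε) ∧ MemH2Per T (v ε) ∧ (u ε = fun x => z ε x + v ε x) ∧
        IsEvenAE (u ε) ∧
        IsStationarySolution d a m ε f g (u ε) ∧
        (ε ≠ 0 → IsInvertible (linearization d m ε f g (u ε))) ∧
        eLpNorm (fun x => u ε x - u₀ x) ∞ volume ≤ ENNReal.ofReal (C * |ε|) ∧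
        h2PerNorm T (fun x => v ε x - v₀) ≤ C * |ε| ∧
        spectrumOf (linearization d m ε f g (u ε)) ⊆
          {μ : ℂ | μ.re ≤ -η} ∪ {(lam ε : ℂ)} ∧
        IsSimpleEigenvalue (linearization d m ε f g (u ε)) (lam ε : ℂ) ∧
        |lam ε + ε * melnikov f g u₀ Ψ| ≤ C * ε ^ 2 := by
  obtain ⟨fB, hfB⟩ := exists_bounded_of_periodic hT hf.continuous hfT
  obtain ⟨gB, hgB⟩ := exists_bounded_of_periodic hT hg.continuous hgT
  obtain ⟨fB', hfB'⟩ := exists_bounded_of_periodic hT (hf.continuous_deriv le_rfl)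
    (periodic_deriv hfT)
  obtain ⟨gB', hgB'⟩ := exists_bounded_of_periodic hT (hg.continuous_deriv le_rfl)
    (periodic_deriv hgT)
  obtain ⟨W, hWv, hWU, hWU', hWΨ⟩ := exists_wave hd hfB hgB hu₀ hz₀ hu₀_even hu₀_sol hu₀_stab hΨ
    hΨ_ker hΨ_norm
  obtain ⟨Br⟩ := W.exists_branch (f := fB) (g := gB) (T := T)
    (BoundedContinuousFunction.ext fun x => by
      change star (fB x) = fB x
      rw [hfB]
      exact Complex.conj_ofReal _)
    (BoundedContinuousFunction.ext fun x => by
      change star (gB x) = gB x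
      rw [hgB]
      exact Complex.conj_ofReal _)
    (BoundedContinuousFunction.ext fun x => by
      change fB (-x) = -fB x
      rw [hfB, hfB, hf_odd, Complex.ofReal_neg])
    (BoundedContinuousFunction.ext fun x => by
      change gB (-x) = gB x
      rw [hgB, hgB, hg_even])
    (fun x => by rw [hfB, hfB, hfT]) (fun x => by rw [hgB, hgB, hgT])
  have hμ := Br.deriv_μ_eq_ofReal hfB hgB hfB' hgB' (hf.differentiable one_ne_zero)
    (hg.differentiable one_ne_zero) hWU hWU' hWΨ hM
  have hμ0 : deriv Br.μ 0 ≠ 0 := by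
    rw [hμ]
    exact Complex.ofReal_ne_zero.2 hM
  obtain ⟨C₁, hC₁, b₁⟩ := Br.exists_eLpNorm_bound hWU
  obtain ⟨C₂, hC₂, b₂⟩ := Br.exists_h2PerNorm_bound hT hWv
  obtain ⟨C₃, hC₃, b₃⟩ := Br.exists_μ_bound
  obtain ⟨ε₀, hε₀, key⟩ := Metric.eventually_nhds_iff.1 ((Br.eventually_spectral hfB hgB hμ0).and
    (Br.eventually_even.and ((Br.eventually_isStationarySolution hfB hgB).and
      ((eventually_ofReal Br.shift_k).and (b₁.and (b₂.and b₃))))))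
  -- Half of the original gap is kept, and λ₀(ε) = -Re μ(ε), the minus sign because the eigenvalue
  -- equation was written as S κ + μ G κ = 0.
  refine ⟨max C₁ (max C₂ C₃), ε₀, W.ϱ / 2, lt_max_of_lt_left hC₁, hε₀, half_pos W.ϱ_pos,
    fun ε x => reC (evG (Br.H ε) x), fun ε x => reC (background W.v (Br.k ε) x), Br.re,
    fun ε => -(Br.μ ε).re, fun ε hε => ?_⟩
  obtain ⟨⟨s1, s2, s3⟩, s4, s5, s6, s7, s8, s9⟩ := key (y := ε) (by
    rw [Real.dist_eq, sub_zero]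
    exact abs_lt.2 hε)
  refine ⟨memH2_re_evG _, memH2Per_re_background s6, ?_, ae_of_all _ s4, s5, s1, ?_, ?_, s2, s3, ?_⟩
  · funext x
    rw [← map_add, add_comm]
    rfl
  · refine s7.trans (ENNReal.ofReal_le_ofReal ?_)
    gcongr
    exact le_max_left _ _
  · refine s8.trans ?_
    gcongr
    exact (le_max_left _ _).trans (le_max_right _ _)
  · have e : -(Br.μ ε).re + ε * melnikov f g u₀ Ψ
        = -(Br.μ ε - ε * (melnikov f g u₀ Ψ : ℂ)).re := by
      rw [Complex.sub_re, Complex.re_ofReal_mul, Complex.ofReal_re]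
      ring
    rw [e, abs_neg, ← hμ]
    refine (Complex.abs_re_le_norm _).trans (s9.trans ?_)
    gcongr
    exact (le_max_right _ _).trans (le_max_right _ _)
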